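/- **Setup.** Let $(B,\mathcal P)$ be a polyhedral affine pseudomanifold of dimension $n$: a space glued from $n$-dimensional integral polyhedra along integral affine identifications of faces, in which any two maximal cells that meet do so in a common face, every $(n-1)$-cell lies in one or two maximal cells, and $B$ satisfies the $S_2$ condition along cells of codimension $\ge 2$; it carries an integral affine structure on $B\setminus\Delta$, where the discriminant locus $\Delta$ has codimension two, contains all cells of codimension $\ge2$, and is disjoint from the interiors of maximal cells and of boundary $(n-1)$-cells. Let $A$ be a Noetherian ring, $Q$ a toric monoid, and $\varphi$ a convex $Q$-valued multivalued piecewise affine function, that is, a kink $\kappa_{\underline\rho}\in Q$ for each connected component $\underline\rho$ of $\rho\setminus\Delta$ for each interior $(n-1)$-cell $\rho$. Let $I\subset A[Q]$ be an ideal with $z^{\kappa_{\underline\rho}}\in I_0:=\sqrt I$ for all $\underline\rho$. For a maximal cell $\sigma$ with lattice of integral tangent vectors $\Lambda_\sigma$ put $R_\sigma=(A[Q]/I)[\Lambda_\sigma]$. A wall is a rational polyhedral subset $\mathfrak p\not\subset\partial B$ of dimension $n-1$ of a maximal cell $\sigma$, with $\operatorname{Int}\mathfrak p\cap\Delta=\emptyset$,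 together with a function $f_{\mathfrak p}$ in $A[Q][\Lambda_\sigma]$ whose exponents are tangent to $\mathfrak p$, do not point outward along $\partial B$, and have heights in $Q$ with respect to all maximal cells met by $\mathfrak p\setminus\Delta$; if $\mathfrak p$ meets $\operatorname{Int}\sigma$, then $f_{\mathfrak p}\equiv1$ mod $I_0$; otherwise $\mathfrak p$ lies in an interior $(n-1)$-cell $\rho$, is called a slab, and $f_{\mathfrak p}\equiv f_{\underline\rho}$ mod $I_0$, where the $f_{\underline\rho}\in(A[Q]/I)[\Lambda_\rho]$ are given functions with $z^{\kappa_{\underline\rho'}}f_{\underline\rho'}=z^{m_{\underline\rho'\underline\rho}}z^{\kappa_{\underline\rho}}f_{\underline\rho}$, $m_{\underline\rho'\underline\rho}$ being the monodromy vectors. A wall structure $\mathscr S$ on $(B,\mathcal P)$ is a set of walls, finitely many in each cell, that are the maximal cells of a polyhedral decomposition of a closed subset $|\mathscr S|\subset B$ (so interiors of walls meet no other wall), that cover all interior $(n-1)$-cells, and are such that the closure of each component of $B\setminus|\mathscr S|$ is a convex polyhedron meeting at most one boundary $(n-1)$-cell in dimension $n-1$. Its joints are the $(n-2)$-dimensional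 faces of walls; a joint has codimension two if it lies in an $(n-2)$-cell of $\mathcal P$. **Consistency.** Let $\mathfrak j$ be a joint of codimension two. Replacing the maximal cells and the walls that contain $\mathfrak j$ by their tangent wedges along $\mathfrak j$ gives the local model $(B_{\mathfrak j},\mathcal P_{\mathfrak j})$ with its wall structure $\mathscr S_{\mathfrak j}$; the chambers are the closures of the components of the complement of its walls. For a monomial $z^m$ with $m$ pointing back into the chamber $\mathfrak u$ that is left, define a change of chambers from $\mathfrak u$ to the adjacent chamber $\mathfrak u'$. Let $\nu$ be the primitive normal of the separating wall that is positive on $\mathfrak u$. For a wall of codimension zero, $z^m\mapsto f_{\mathfrak p}^{\langle\nu,m\rangle}z^m$; this formula defines an automorphism $\theta_{\mathfrak p}$ of $R_\sigma$. For a slab $\mathfrak b\subset\sigma\cap\sigma'$, $z^m\mapsto (f_{\mathfrak b}z^{\kappa})^{\langle\nu,m\rangle}z^m$, with $m$ transported to $\sigma'$ through $\mathfrak b$ and $\kappa$ the kink along $\mathfrak b$. A broken line is a proper continuous map $\beta:(-\infty,0]\to B_{\mathfrak j}$ avoiding $\mathfrak j$, with times $-\infty=t_0<\dots<t_r=0$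 and monomials $a_iz^{m_i}$, $0\ne a_i\in A[Q]/I$, such that $\beta$ maps $(t_{i-1},t_i)$ affinely, with derivative $-m_i\ne0$, into the interior of a chamber $\mathfrak u_i$, crosses a wall at $t_i$ for $i<r$, and $a_{i+1}z^{m_{i+1}}$ is a term of the image of $a_iz^{m_i}$ under the change of chambers. It is normalized if $a_1=1$; its asymptotic monomial is $m_1$, its type is $(\mathfrak u_i,m_i)_i$, and we write $a_\beta z^{m_\beta}=a_rz^{m_r}$. A point $p$ is general if it does not lie on the boundary of the set of endpoints of the broken lines of any given type. For an integral vector $m$ of $B_{\mathfrak j}$ and $p$ general put $\vartheta^{\mathfrak j}_m(p)=\sum_\beta a_\beta z^{m_\beta}$, the sum over normalized broken lines with asymptotic monomial $m$ and endpoint $\beta(0)=p$. $\mathscr S$ is consistent along $\mathfrak j$ if for all $m$ (a) $\vartheta^{\mathfrak j}_m(p)$ is the same for all general $p$ in a chamber $\mathfrak u$; write $\vartheta^{\mathfrak j}_m(\mathfrak u)$; and (b) for adjacent chambers $\mathfrak u,\mathfrak u'$ one has $\vartheta^{\mathfrak j}_m(\mathfrak u')=\theta_{\mathfrak p}(\vartheta^{\mathfrak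 j}_m(\mathfrak u))$ if they are separated by a wall $\mathfrak p$ of codimension zero, while, if they are separated by a slab $\mathfrak b\subset\rho$, the pair $(\vartheta^{\mathfrak j}_m(\mathfrak u),\vartheta^{\mathfrak j}_m(\mathfrak u'))$ is the image of an element of $R_{\mathfrak b}=(A[Q]/I)[\Lambda_\rho][Z_+,Z_-]/(Z_+Z_--f_{\mathfrak b}z^{\kappa})$ under the two localization maps to $R_\sigma$, $R_{\sigma'}$. **Convexity.** Let $\mathfrak j\subset\partial B$ be a joint of codimension two. Choose integral affine coordinates embedding $B_{\mathfrak j}/\Lambda_{\mathfrak j,\mathbb R}$ into $\mathbb R^2$ as the (not necessarily convex) closed cone that extends clockwise from $\mathbb R_{\ge0}(-1,0)$ through $\mathbb R_{>0}(0,1)$ to $\mathbb R_{\ge0}(a,b)$, $a>0$. Let $\mathbb R_{\ge0}(a_j,b_j)$, $j=0,\dots,r-1$, with $(a_j,b_j)$ primitive, be the images of the walls containing $\mathfrak j$, in clockwise order, with functions $f_j$, and let $\delta_j\in\mathbb Z$ be the largest integer such that a monomial with tangent vector $-\delta_j(a_j,b_j)$ (modulo $\Lambda_{\mathfrak j}$)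 occurs in $f_j$. Define $\lambda_0=0$ and $$\lambda_{j+1}=\frac{\lambda_j+(b_j-a_j\lambda_j)\delta_jb_j}{1+(b_j-a_j\lambda_j)\delta_ja_j}.$$ $\mathscr S$ is convex at $\mathfrak j$ if, for some choice of coordinates as above, all $\delta_j$ exist, all denominators $1+(b_j-a_j\lambda_j)\delta_ja_j$ are positive (so that $(1,\lambda_{j+1})$ is the direction of the maximally bent line after crossing the wall with index $j$), and $\mathbb R_{>0}(1,\lambda_r)\not\subset\operatorname{Int}(B_{\mathfrak j})$. **Proposition.** If a wall structure $\mathscr S$ is convex at a joint $\mathfrak j\subset\partial B$ of codimension two, then $\mathscr S$ is consistent along $\mathfrak j$. -/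

import Mathlib

noncomputable section

namespace ThetaFunctions

open Matrix

/-! ### Integral polyhedra in `ℝⁿ` with its lattice `ℤⁿ` -/

/-- An integral vector as a real vector. -/
def toReal {n : ℕ} (v : Fin n → ℤ) : Fin n → ℝ := fun i => (v i : ℝ)

/-- The real linear map given by an integral matrix. -/
def realMul {m n : ℕ} (M : Matrix (Fin m) (Fin n) ℤ) (x : Fin n → ℝ) : Fin m → ℝ :=
  (M.map (Int.cast : ℤ → ℝ)) *ᵥ x

/-- An integral covector evaluated at a real vector. -/
def pair {n : ℕ} (ν : Fin n → ℤ) (x : Fin n → ℝ) : ℝ := ∑ i, (ν i : ℝ) * x i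

/-- A convex polyhedron: the solution set of finitely many affine inequalities. -/
def IsPolyhedron {n : ℕ} (P : Set (Fin n → ℝ)) : Prop :=
  ∃ (k : ℕ) (a : Fin k → Fin n → ℝ) (b : Fin k → ℝ), P = {x | ∀ i, ∑ j, a i j * x j ≤ b i}

/-- A polyhedron given by affine inequalities with rational coefficients. -/
def IsRationalPolyhedron {n : ℕ} (P : Set (Fin n → ℝ)) : Prop :=
  ∃ (k : ℕ) (a : Fin k → Fin n → ℚ) (b : Fin k → ℚ),
    P = {x | ∀ i, ∑ j, (a i j : ℝ) * x j ≤ (b i : ℝ)}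

/-- Non-empty faces; the polyhedron is a face of itself. -/
def IsFace {n : ℕ} (P F : Set (Fin n → ℝ)) : Prop := F.Nonempty ∧ IsExposed ℝ P F

/-- A non-empty convex set of codimension `c` in `ℝⁿ`, that is, of dimension `n - c`. -/
def HasCodim {n : ℕ} (F : Set (Fin n → ℝ)) (c : ℕ) : Prop :=
  F.Nonempty ∧ Module.finrank ℝ (vectorSpan ℝ F) + c = n

/-- A rational polyhedron each of whose faces contains an integral point. -/
def IsIntegralPolyhedron {n : ℕ} (P : Set (Fin n → ℝ)) : Prop :=
  IsRationalPolyhedron P ∧ ∀ F, IsFace P F → ∃ v : Fin n → ℤ, toReal v ∈ F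

/-! ### Polyhedral affine pseudomanifolds -/

/-- The underlying complex `(B, 𝒫)`: a space glued from `n`-dimensional integral polyhedra, one for
each maximal cell, along integral affine identifications of faces. The cells of `𝒫` are the images
of the non-empty faces of these polyhedra. -/
structure PolyhedralComplex (n : ℕ) where
  /-- the points of `B` -/
  Pt : Type*
  [top : TopologicalSpace Pt]
  /-- the maximal cells -/
  MaxCell : Type*
  /-- a maximal cell as a polyhedron in an integral affine chart -/
  poly : MaxCell → Set (Fin n → ℝ)
  /-- the inclusion of a maximal cell into `B` (only its values on `poly σ` matter) -/
  toB : MaxCell → (Fin n → ℝ) → Pt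
  isIntegral : ∀ σ, IsIntegralPolyhedron (poly σ)
  full_dim : ∀ σ, (interior (poly σ)).Nonempty
  injOn : ∀ σ, Set.InjOn (toB σ) (poly σ)
  covers : ∀ p, ∃ σ, p ∈ toB σ '' poly σ
  /-- distinct maximal cells are distinct subsets of `B` -/
  cell_inj : ∀ σ σ', toB σ '' poly σ = toB σ' '' poly σ' → σ = σ'
  /-- `B` carries the direct limit topology -/
  isOpen_iff : ∀ U : Set Pt, IsOpen U ↔
    ∀ σ, ∃ V : Set (Fin n → ℝ), IsOpen V ∧ {x ∈ poly σ | toB σ x ∈ U} = V ∩ poly σ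
  /-- two maximal cells that meet, meet in a common face, by an integral affine identification -/
  inter_face : ∀ σ σ', (toB σ '' poly σ ∩ toB σ' '' poly σ').Nonempty →
    ∃ (F F' : Set (Fin n → ℝ)) (g : GL (Fin n) ℤ) (b : Fin n → ℤ),
      IsFace (poly σ) F ∧ IsFace (poly σ') F' ∧
      toB σ '' F = toB σ '' poly σ ∩ toB σ' '' poly σ' ∧
      toB σ' '' F' = toB σ '' poly σ ∩ toB σ' '' poly σ' ∧
      ∀ x ∈ F, realMul g.1 x + toReal b ∈ F' ∧ toB σ' (realMul g.1 x + toReal b) = toB σ x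
  /-- a cell of codimension one lies in one or two maximal cells -/
  facet_card : ∀ σ F, IsFace (poly σ) F → HasCodim F 1 →
    {σ' | toB σ '' F ⊆ toB σ' '' poly σ'}.ncard = 1 ∨
      {σ' | toB σ '' F ⊆ toB σ' '' poly σ'}.ncard = 2
  /-- the `S₂` condition at cells of codimension at least two -/
  sTwo : ∀ σ F c, IsFace (poly σ) F → HasCodim F c → 2 ≤ c →
    ∀ x ∈ toB σ '' intrinsicInterior ℝ F, ∀ U : Set Pt, IsOpen U → x ∈ U →
      ∃ V ⊆ U, IsOpen V ∧ x ∈ V ∧ IsConnected V ∧ IsConnected (V \ (toB σ '' F))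

attribute [instance] PolyhedralComplex.top

namespace PolyhedralComplex

variable {n : ℕ} (X : PolyhedralComplex n)

/-- A maximal cell as a subset of `B`. -/
def cellSet (σ : X.MaxCell) : Set X.Pt := X.toB σ '' X.poly σ

/-- `F` is a facet of the maximal cell `σ` lying on the boundary: no other maximal cell
contains it. -/
def IsBoundaryFacet (σ : X.MaxCell) (F : Set (Fin n → ℝ)) : Prop :=
  IsFace (X.poly σ) F ∧ HasCodim F 1 ∧ ∀ σ', X.toB σ '' F ⊆ X.cellSet σ' → σ' = σ

/-- The boundary `∂B`. -/
def boundary : Set X.Pt := {p | ∃ σ F, X.IsBoundaryFacet σ F ∧ p ∈ X.toB σ '' F}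

/-- `ν` is the primitive covector that vanishes on the facet of `σ` through `p` and is non-negative
on tangent vectors pointing into `σ` (for `p ∈ σ` in the relative interior of a facet). -/
def IsInwardNormal (σ : X.MaxCell) (p : X.Pt) (ν : Fin n → ℤ) : Prop :=
  (∃ v : Fin n → ℤ, ν ⬝ᵥ v = 1) ∧
    ∀ x ∈ X.poly σ, X.toB σ x = p → ∀ z ∈ X.poly σ, 0 ≤ pair ν (z - x)

end PolyhedralComplex

/-- A polyhedral affine pseudomanifold: the complex together with the discriminant locus `Δ` and an
integral affine structure on `B \ Δ`. The discriminant locus contains all cells of codimension at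
least two and subdivides the interior cells of codimension one into pieces, the connected components
of `(σ ∩ σ') \ Δ`. The affine structure is given by an identification of the tangent lattices of
`σ` and `σ'` for each of these pieces. -/
structure PolyhedralPseudomanifold (n : ℕ) extends PolyhedralComplex n where
  /-- the discriminant locus `Δ` -/
  disc : Set Pt
  disc_skeleton : ∀ σ F c, IsFace (poly σ) F → HasCodim F c → 2 ≤ c → toB σ '' F ⊆ disc
  disc_interior : ∀ σ, Disjoint (toB σ '' interior (poly σ)) disc
  disc_boundary : ∀ σ F, toPolyhedralComplex.IsBoundaryFacet σ F →
    Disjoint (toB σ '' intrinsicInterior ℝ F) disc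
  /-- `Δ` is polyhedral of codimension at least two -/
  disc_codim : ∀ σ, ∃ T : Set (Set (Fin n → ℝ)), T.Finite ∧
    (∀ P ∈ T, IsPolyhedron P ∧ ∃ c, 2 ≤ c ∧ HasCodim P c) ∧
    {x ∈ poly σ | toB σ x ∈ disc} = ⋃₀ T
  /-- parallel transport of integral tangent vectors from `σ` to `σ'` through a point of
  `(σ ∩ σ') \ Δ` (other values are irrelevant) -/
  glue : MaxCell → MaxCell → Pt → GL (Fin n) ℤ
  glue_locallyConstant : ∀ σ σ', σ ≠ σ' → IsLocallyConstant
    (fun p : ↥((toB σ '' poly σ ∩ toB σ' '' poly σ') \ disc) => glue σ σ' p)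
  glue_symm : ∀ σ σ', σ ≠ σ' → ∀ p ∈ (toB σ '' poly σ ∩ toB σ' '' poly σ') \ disc,
    glue σ' σ p = (glue σ σ' p)⁻¹
  /-- parallel transport is the identity on vectors tangent to `σ ∩ σ'` -/
  glue_tangent : ∀ σ σ', σ ≠ σ' → ∀ p ∈ (toB σ '' poly σ ∩ toB σ' '' poly σ') \ disc,
    ∀ x ∈ poly σ, ∀ y ∈ poly σ, ∀ x' ∈ poly σ', ∀ y' ∈ poly σ',
      toB σ x = toB σ' x' → toB σ y = toB σ' y' → realMul (glue σ σ' p).1 (y - x) = y' - x'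
  /-- in the resulting chart at `p` the two cells lie on opposite sides of `σ ∩ σ'` -/
  glue_opposite : ∀ σ σ', σ ≠ σ' → ∀ p ∈ (toB σ '' poly σ ∩ toB σ' '' poly σ') \ disc,
    ∀ x ∈ poly σ, ∀ x' ∈ poly σ', toB σ x = p → toB σ' x' = p →
      ∀ z ∈ interior (poly σ), ∀ z' ∈ interior (poly σ'),
        realMul (glue σ σ' p).1 (z - x) ≠ z' - x'

/-- `(σ ∩ σ') \ Δ`. For `σ ≠ σ'` it is non-empty only if `σ ∩ σ'` is an interior cell of codimension
one; its connected components are the pieces of this cell. -/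
def PolyhedralPseudomanifold.facetLocus {n : ℕ} (X : PolyhedralPseudomanifold n)
    (σ σ' : X.MaxCell) : Set X.Pt :=
  (X.cellSet σ ∩ X.cellSet σ') \ X.disc

/-- `Q` is a toric monoid with `Q^gp = L`. -/
structure IsToric {L : Type*} [AddCommGroup L] (Q : AddSubmonoid L) : Prop where
  free : Module.Free ℤ L
  fg : Q.FG
  closure_eq : AddSubgroup.closure (Q : Set L) = ⊤
  saturated : ∀ (x : L) (k : ℕ), 0 < k → k • x ∈ Q → x ∈ Q

/-- A convex `Q`-valued multivalued piecewise affine function, given by its kinks: an element of `Q`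
for each piece of an interior cell of codimension one. -/
structure ConvexMPA {n : ℕ} (X : PolyhedralPseudomanifold n) {L : Type*} [AddCommGroup L]
    (Q : AddSubmonoid L) where
  /-- the kink along the piece containing the given point -/
  kink : X.Pt → Q
  locallyConstant : ∀ σ σ', σ ≠ σ' →
    IsLocallyConstant (fun p : ↥(X.facetLocus σ σ') => kink p)

/-! ### Rings -/

section Rings

variable (A : Type*) [CommRing A] {L : Type*} [AddCommGroup L] (Q : AddSubmonoid L)

/-- The monoid ring `A[Q]`. -/
abbrev BaseRing : Type _ := AddMonoidAlgebra A Q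

variable {A Q} (I : Ideal (BaseRing A Q)) (n : ℕ)

/-- The ring `R_σ = (A[Q]/I)[Λ_σ]`, in a chart with `Λ_σ = ℤⁿ`. -/
abbrev CellRing : Type _ := AddMonoidAlgebra (BaseRing A Q ⧸ I) (Fin n → ℤ)

variable {n I}

/-- The class in `A[Q]/I` of the monomial `z^q`, `q ∈ Q`. -/
def zQ (I : Ideal (BaseRing A Q)) (q : Q) : BaseRing A Q ⧸ I :=
  Ideal.Quotient.mk I (AddMonoidAlgebra.single q 1)

/-- The monomial `z^m`, `m ∈ Λ_σ`. -/
def zM (I : Ideal (BaseRing A Q)) (m : Fin n → ℤ) : CellRing I n := AddMonoidAlgebra.single m 1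

/-- Constants in `R_σ`. -/
def const (a : BaseRing A Q ⧸ I) : CellRing I n := AddMonoidAlgebra.single 0 a

/-- Change of chart. -/
def changeChart (g : GL (Fin n) ℤ) (f : CellRing I n) : CellRing I n :=
  AddMonoidAlgebra.mapDomain (fun m => g.1 *ᵥ m) f

/-- Integral powers, of use for units. -/
def intPow {R : Type*} [CommRing R] (f : R) (k : ℤ) : R :=
  if 0 ≤ k then f ^ k.toNat else Ring.inverse f ^ (-k).toNat

/-- The wall crossing automorphism `z^m ↦ f^⟨ν, m⟩ z^m`. -/
def wallCrossing (f : CellRing I n) (ν : Fin n → ℤ) (h : CellRing I n) : CellRing I n :=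
  h.coeff.sum fun m c => AddMonoidAlgebra.single m c * intPow f (ν ⬝ᵥ m)

/-- The functions `f_ρ ∈ (A[Q]/I)[Λ_ρ]` attached to the pieces of the interior cells of codimension
one. `fn σ p` is the function of the piece containing `p`, written in the chart of `σ ∋ p`. -/
structure SlabFunctions {X : PolyhedralPseudomanifold n} (φ : ConvexMPA X Q)
    (I : Ideal (BaseRing A Q)) where
  fn : X.MaxCell → X.Pt → CellRing I n
  locallyConstant : ∀ σ σ', σ ≠ σ' → IsLocallyConstant (fun p : ↥(X.facetLocus σ σ') => fn σ p)
  chart : ∀ σ σ', σ ≠ σ' → ∀ p ∈ X.facetLocus σ σ', fn σ' p = changeChart (X.glue σ σ' p) (fn σ p)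
  /-- the exponents are tangent to the cell of codimension one -/
  tangent : ∀ σ σ', σ ≠ σ' → ∀ p ∈ X.facetLocus σ σ', ∀ ν, X.IsInwardNormal σ p ν →
    ∀ v ∈ (fn σ p).coeff.support, ν ⬝ᵥ v = 0
  /-- compatibility between the pieces through `p` and `p'` of the same cell: the functions
  `z^κ f` differ by the monomial given by the monodromy vector -/
  compat : ∀ σ σ', σ ≠ σ' → ∀ p ∈ X.facetLocus σ σ', ∀ p' ∈ X.facetLocus σ σ',
    ∀ ν, X.IsInwardNormal σ p ν → ∀ ξ : Fin n → ℤ, ν ⬝ᵥ ξ = 1 →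
      const (zQ I (φ.kink p')) * fn σ p' =
        zM I (((X.glue σ σ' p')⁻¹ * X.glue σ σ' p).1 *ᵥ ξ - ξ) *
          const (zQ I (φ.kink p)) * fn σ p

end Rings

/-! ### Walls and wall structures -/

section Walls

variable {n : ℕ} {X : PolyhedralPseudomanifold n} {A : Type*} [CommRing A] {L : Type*}
  [AddCommGroup L] {Q : AddSubmonoid L} {φ : ConvexMPA X Q} {I : Ideal (BaseRing A Q)}

/-- A wall: a rational polyhedral subset of codimension one of a maximal cell, not contained in
`∂B`, with interior disjoint from `Δ`, together with a function `f`. An exponent of `f` is a pair of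
a tangent vector `v` and a height `q ∈ Q`, both with respect to the chosen maximal cell. -/
structure Wall (F : SlabFunctions φ I) where
  cell : X.MaxCell
  supp : Set (Fin n → ℝ)
  fn : AddMonoidAlgebra (BaseRing A Q) (Fin n → ℤ)
  /-- a point of the relative interior of the wall -/
  base : Fin n → ℝ
  rational : IsRationalPolyhedron supp
  codim_one : HasCodim supp 1
  subset : supp ⊆ X.poly cell
  not_boundary : ¬ X.toB cell '' supp ⊆ X.boundary
  disjoint_disc : Disjoint (X.toB cell '' intrinsicInterior ℝ supp) X.disc
  base_mem : base ∈ intrinsicInterior ℝ supp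
  /-- exponents are tangent to the wall -/
  tangent : ∀ v ∈ fn.coeff.support, toReal v ∈ vectorSpan ℝ supp
  /-- on the boundary, exponents do not point outward -/
  exponent_boundary : ∀ v ∈ fn.coeff.support, ∀ y ∈ supp, X.toB cell y ∈ X.boundary \ X.disc →
    ∀ ν, X.IsInwardNormal cell (X.toB cell y) ν → 0 ≤ ν ⬝ᵥ v
  /-- where the wall meets another maximal cell, the height with respect to that cell also lies
  in `Q` -/
  exponent_interior : ∀ v ∈ fn.coeff.support, ∀ q ∈ (fn.coeff v).coeff.support, ∀ y ∈ supp,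
    ∀ σ', σ' ≠ cell → X.toB cell y ∈ X.facetLocus cell σ' →
      ∀ ν, X.IsInwardNormal cell (X.toB cell y) ν → ν ⬝ᵥ v < 0 →
        ∃ q' : Q, q = q' + (-(ν ⬝ᵥ v)).toNat • φ.kink (X.toB cell y)
  /-- walls of codimension zero: `f ≡ 1` modulo `√I` -/
  codim_zero_fn : (supp ∩ interior (X.poly cell)).Nonempty →
    ∀ v, (fn - 1).coeff v ∈ I.radical
  /-- slabs: `f ≡ f_ρ` modulo `√I` -/
  slab_fn : ∀ σ', σ' ≠ cell → X.toB cell '' supp ⊆ X.cellSet σ' →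
    ∀ v, Ideal.Quotient.mk I (fn.coeff v) - (F.fn cell (X.toB cell base)).coeff v ∈
      I.radical.map (Ideal.Quotient.mk I)

/-- The underlying subset of `B`. -/
def Wall.carrier {F : SlabFunctions φ I} (w : Wall F) : Set X.Pt := X.toB w.cell '' w.supp

/-- A wall structure. -/
structure WallStructure (F : SlabFunctions φ I) where
  ι : Type*
  wall : ι → Wall F
  finite : ∀ σ, {i | (wall i).carrier ⊆ X.cellSet σ}.Finite
  /-- the walls are the maximal cells of a polyhedral decomposition of a closed subset: distinct
  walls meet in common faces, and the interior of a wall meets no other wall -/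
  inter_face : ∀ i k, i ≠ k → ((wall i).carrier ∩ (wall k).carrier).Nonempty →
    ∃ G G', IsFace (wall i).supp G ∧ IsFace (wall k).supp G' ∧
      X.toB (wall i).cell '' G = (wall i).carrier ∩ (wall k).carrier ∧
      X.toB (wall k).cell '' G' = (wall i).carrier ∩ (wall k).carrier
  interior_disjoint : ∀ i k, i ≠ k →
    Disjoint (X.toB (wall i).cell '' intrinsicInterior ℝ (wall i).supp) (wall k).carrier
  closed : IsClosed (⋃ i, (wall i).carrier)
  /-- the interior cells of codimension one are covered by walls -/
  covers : ∀ σ σ', σ ≠ σ' → (X.facetLocus σ σ').Nonempty →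
    X.cellSet σ ∩ X.cellSet σ' ⊆ ⋃ i, (wall i).carrier
  /-- the closure of each connected component of the complement of the walls is a convex polyhedron
  that meets at most one boundary cell of codimension one in dimension `n - 1` -/
  chamber : ∀ p ∉ ⋃ i, (wall i).carrier, ∃ σ, ∃ u ⊆ X.poly σ, IsPolyhedron u ∧
    closure (connectedComponentIn (⋃ i, (wall i).carrier)ᶜ p) = X.toB σ '' u ∧
    ∀ G G', X.IsBoundaryFacet σ G → X.IsBoundaryFacet σ G' →
      HasCodim (u ∩ G) 1 → HasCodim (u ∩ G') 1 → G = G'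

end Walls

/-- The tangent wedge along `𝔧` of the part of `T` lying in the maximal cell `σ`, in the chart of
`σ`: the cone generated by the vectors pointing from `𝔧` to `T`. -/
def PolyhedralComplex.wedge {n : ℕ} (X : PolyhedralComplex n) (𝔧 T : Set X.Pt) (σ : X.MaxCell) :
    Set (Fin n → ℝ) :=
  {v | ∃ x ∈ X.poly σ, ∃ y ∈ X.poly σ, X.toB σ x ∈ 𝔧 ∧ X.toB σ y ∈ T ∧
    ∃ s : ℝ, 0 ≤ s ∧ v = s • (y - x)}

namespace WallStructure

open Classical

variable {n : ℕ} {X : PolyhedralPseudomanifold n} {A : Type*} [CommRing A] {L : Type*}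
  [AddCommGroup L] {Q : AddSubmonoid L} {φ : ConvexMPA X Q} {I : Ideal (BaseRing A Q)}
  {F : SlabFunctions φ I} (S : WallStructure F)

/-- The joints: the cells of codimension two of the polyhedral decomposition given by the walls. -/
def IsJoint (𝔧 : Set X.Pt) : Prop :=
  ∃ i G, IsFace (S.wall i).supp G ∧ HasCodim G 2 ∧ 𝔧 = X.toB (S.wall i).cell '' G

/-- A joint has codimension two if it lies in a cell of codimension two. -/
def IsCodimTwoJoint (𝔧 : Set X.Pt) : Prop :=
  S.IsJoint 𝔧 ∧ ∃ σ G, IsFace (X.poly σ) G ∧ HasCodim G 2 ∧ 𝔧 ⊆ X.toB σ '' G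

/-! ### The local model `(B_𝔧, 𝒫_𝔧)` and `𝒮_𝔧` at a joint

The maximal cells of `B_𝔧` are the tangent wedges along `𝔧` of the maximal cells containing `𝔧`, and
the walls of `𝒮_𝔧` are the tangent wedges of the walls containing `𝔧`. A point of `B_𝔧` is described
by a maximal cell `σ ⊇ 𝔧` and a vector of its wedge, in the chart of `σ`. -/

/-- The vectors `v`, `v'` in the wedges of `σ` and `σ'` represent the same point of `B_𝔧`. -/
def SamePoint (_S : WallStructure F) (𝔧 : Set X.Pt) (σ : X.MaxCell) (v : Fin n → ℝ)
    (σ' : X.MaxCell) (v' : Fin n → ℝ) : Prop :=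
  ∃ x ∈ X.poly σ, ∃ y ∈ X.poly σ, ∃ x' ∈ X.poly σ', ∃ y' ∈ X.poly σ',
    X.toB σ x ∈ 𝔧 ∧ X.toB σ x = X.toB σ' x' ∧ X.toB σ y = X.toB σ' y' ∧
      ∃ s : ℝ, 0 ≤ s ∧ v = s • (y - x) ∧ v' = s • (y' - x')

/-- The complement of the walls of `𝒮_𝔧` in the interior of the wedge of `σ`. -/
def complementAt (𝔧 : Set X.Pt) (σ : X.MaxCell) : Set (Fin n → ℝ) :=
  interior (X.wedge 𝔧 Set.univ σ) \
    ⋃ i, ⋃ (_ : 𝔧 ⊆ (S.wall i).carrier), X.wedge 𝔧 (S.wall i).carrier σ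

/-- `u` is the interior of a chamber of `𝒮_𝔧` in the wedge of `σ`. -/
def IsChamberAt (𝔧 : Set X.Pt) (σ : X.MaxCell) (u : Set (Fin n → ℝ)) : Prop :=
  𝔧 ⊆ X.cellSet σ ∧
    ∃ v ∈ S.complementAt 𝔧 σ, u = connectedComponentIn (S.complementAt 𝔧 σ) v

/-- The wall `i` contains `𝔧`, and crossing it leads from `σ` to `σ'`: either `σ = σ'` and the wall
has codimension zero, or `σ ≠ σ'` and it is a slab in `σ ∩ σ'`. -/
def Crosses (𝔧 : Set X.Pt) (i : S.ι) (σ σ' : X.MaxCell) : Prop :=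
  𝔧 ⊆ (S.wall i).carrier ∧ (S.wall i).carrier ⊆ X.cellSet σ ∩ X.cellSet σ' ∧
    (σ = σ' → ((S.wall i).supp ∩ interior (X.poly (S.wall i).cell)).Nonempty)

/-- The point of `B` in the interior of the wall `i`. -/
def basePt (i : S.ι) : X.Pt := X.toB (S.wall i).cell (S.wall i).base

/-- Parallel transport of tangent vectors from `σ` to `σ'` through the wall `i`. -/
def transfer (i : S.ι) (σ σ' : X.MaxCell) : GL (Fin n) ℤ :=
  if σ = σ' then 1 else X.glue σ σ' (S.basePt i)

/-- The function of the wall `i` modulo `I`, in the chart of `σ`. -/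
def fnIn (i : S.ι) (σ : X.MaxCell) : CellRing I n :=
  changeChart (S.transfer i (S.wall i).cell σ)
    (AddMonoidAlgebra.mapRingHom (Fin n → ℤ) (Ideal.Quotient.mk I) (S.wall i).fn)

/-- The factor `z^κ` for a slab, and `1` for a wall of codimension zero. -/
def kinkFactor (i : S.ι) (σ σ' : X.MaxCell) : BaseRing A Q ⧸ I :=
  if σ = σ' then 1 else zQ I (φ.kink (S.basePt i))

/-- `ν` is a primitive normal covector of the wall `i` in the chart of `σ`. -/
def IsWallNormal (𝔧 : Set X.Pt) (i : S.ι) (σ : X.MaxCell) (ν : Fin n → ℤ) : Prop :=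
  (∃ v : Fin n → ℤ, ν ⬝ᵥ v = 1) ∧ ∀ x ∈ X.wedge 𝔧 (S.wall i).carrier σ, pair ν x = 0

/-- The image of `z^m` under the change of chamber morphism across the wall `i` from `σ` to `σ'`,
for `m` pointing back into the chamber that is left; `N ≥ 0` is the pairing of `m` with the
primitive normal of the wall that is positive on that chamber. For a wall of codimension zero it is
`z^m f^N`. For a slab, write `m = m' + N ξ` with `m'` tangent to the slab, so that `z^m` lifts to
`z^m' Z_+^N`; the image is `z^m' (Z_-⁻¹ f z^κ)^N`. -/
def transport (i : S.ι) (σ σ' : X.MaxCell) (m : Fin n → ℤ) (N : ℕ) : CellRing I n :=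
  zM I ((S.transfer i σ σ').1 *ᵥ m) * (S.fnIn i σ' * const (S.kinkFactor i σ σ')) ^ N

/-- A broken line on `(B_𝔧, 𝒫_𝔧)` for `𝒮_𝔧` with endpoint `p` in the wedge of `σ`. It has linear
segments `0, …, r`, the segment `k` ending at time `time k` at the point `pos k`; in the chart of
`cell k` it is `t ↦ pos k + (time k - t) • exp k`. -/
structure BrokenLine (𝔧 : Set X.Pt) (σ : X.MaxCell) (p : Fin n → ℝ) where
  r : ℕ
  cell : Fin (r + 1) → X.MaxCell
  chamber : Fin (r + 1) → Set (Fin n → ℝ)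
  exp : Fin (r + 1) → Fin n → ℤ
  coeff : Fin (r + 1) → BaseRing A Q ⧸ I
  time : Fin (r + 1) → ℝ
  pos : Fin (r + 1) → Fin n → ℝ
  /-- the wall met at the end of each segment but the last -/
  wall : Fin r → S.ι
  time_strictMono : StrictMono time
  time_last : time (Fin.last r) = 0
  cell_last : cell (Fin.last r) = σ
  pos_last : pos (Fin.last r) = p
  isChamber : ∀ k, S.IsChamberAt 𝔧 (cell k) (chamber k)
  exp_ne : ∀ k, exp k ≠ 0
  coeff_ne : ∀ k, coeff k ≠ 0
  /-- the image is disjoint from the joint -/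
  pos_notMem : ∀ k, pos k ∉ X.wedge 𝔧 𝔧 (cell k)
  /-- the first segment is unbounded and lies in a chamber -/
  first : ∀ t < time 0, pos 0 + (time 0 - t) • toReal (exp 0) ∈ chamber 0
  segment : ∀ k : Fin r, ∀ t, time k.castSucc < t → t < time k.succ →
    pos k.succ + (time k.succ - t) • toReal (exp k.succ) ∈ chamber k.succ
  crosses : ∀ k : Fin r, S.Crosses 𝔧 (wall k) (cell k.castSucc) (cell k.succ)
  pos_wall : ∀ k : Fin r,
    pos k.castSucc ∈ X.wedge 𝔧 (S.wall (wall k)).carrier (cell k.castSucc)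
  continuous : ∀ k : Fin r,
    pos k.succ + (time k.succ - time k.castSucc) • toReal (exp k.succ) =
      realMul (S.transfer (wall k) (cell k.castSucc) (cell k.succ)).1 (pos k.castSucc)
  /-- each monomial is a result of transport of the preceding one -/
  result : ∀ k : Fin r, ∃ ν, S.IsWallNormal 𝔧 (wall k) (cell k.castSucc) ν ∧
    coeff k.succ = coeff k.castSucc *
      (S.transport (wall k) (cell k.castSucc) (cell k.succ) (exp k.castSucc)
        (ν ⬝ᵥ exp k.castSucc).natAbs).coeff (exp k.succ)

/-- The type of a broken line: the chambers visited and the exponents. -/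
def BrokenLine.type {S : WallStructure F} {𝔧 : Set X.Pt} {σ : X.MaxCell} {p : Fin n → ℝ}
    (β : S.BrokenLine 𝔧 σ p) :
    Σ r : ℕ, Fin (r + 1) → X.MaxCell × Set (Fin n → ℝ) × (Fin n → ℤ) :=
  ⟨β.r, fun k => (β.cell k, β.chamber k, β.exp k)⟩

/-- The endpoints in the wedge of `σ` of the broken lines of a given type not ending on a wall. -/
def endpoints (𝔧 : Set X.Pt) (σ : X.MaxCell)
    (T : Σ r : ℕ, Fin (r + 1) → X.MaxCell × Set (Fin n → ℝ) × (Fin n → ℤ)) :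
    Set (Fin n → ℝ) :=
  {q | ∃ β : S.BrokenLine 𝔧 σ q, β.type = T ∧ q ∈ β.chamber (Fin.last β.r)}

/-- `p` is general. For each type the endpoints form the interior of a convex polyhedron, and
general points avoid the boundaries of all these polyhedra. -/
def IsGeneral (𝔧 : Set X.Pt) (σ : X.MaxCell) (p : Fin n → ℝ) : Prop :=
  ∀ T, p ∉ frontier (S.endpoints 𝔧 σ T)

/-- An asymptotic monomial on `(B_𝔧, 𝒫_𝔧)`, given by its tangent vector: an integral vector in the
wedge of a maximal cell. -/
def IsAsymptotic (_S : WallStructure F) (𝔧 : Set X.Pt) (σ : X.MaxCell) (m : Fin n → ℤ) : Prop :=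
  𝔧 ⊆ X.cellSet σ ∧ toReal m ∈ X.wedge 𝔧 Set.univ σ

/-- `ϑ_m(p)`, the sum of the final monomials of the normalized broken lines with asymptotic monomial
`m` (in the wedge of `σ₀`) and endpoint `p` in the wedge of `σ`. -/
def theta (𝔧 : Set X.Pt) (σ₀ : X.MaxCell) (m : Fin n → ℤ) (σ : X.MaxCell) (p : Fin n → ℝ) :
    CellRing I n :=
  ∑ᶠ β : {β : S.BrokenLine 𝔧 σ p // β.coeff 0 = 1 ∧
      S.SamePoint 𝔧 σ₀ (toReal m) (β.cell 0) (toReal (β.exp 0))},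
    AddMonoidAlgebra.single (β.1.exp (Fin.last β.1.r)) (β.1.coeff (Fin.last β.1.r))

/-- For a slab `𝔟 = 𝔟_i` in `σ ∩ σ'`, the image in `R_σ × R_σ'` of the ring
`R_𝔟 = (A[Q]/I)[Λ_ρ][Z_+, Z_-] / (Z_+ Z_- - f_𝔟 z^κ)` under the (injective) pair of localization
homomorphisms `(χ_{𝔟,σ}, χ_{𝔟,σ'})`. It is generated by the images of `z^v`, `v ∈ Λ_ρ`, and of
`Z_+`, `Z_-`, where `Z_+` restricts to `z^ξ` on `σ` and `Z_-` to `z^{-ξ}` on `σ'`. -/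
def slabRing (i : S.ι) (σ σ' : X.MaxCell) :
    Subalgebra (BaseRing A Q ⧸ I) (CellRing I n × CellRing I n) :=
  Algebra.adjoin _
    ({h | ∃ ν v, X.IsInwardNormal σ (S.basePt i) ν ∧ ν ⬝ᵥ v = 0 ∧
        h = (zM I v, zM I ((S.transfer i σ σ').1 *ᵥ v))} ∪
     {h | ∃ ν ξ, X.IsInwardNormal σ (S.basePt i) ν ∧ ν ⬝ᵥ ξ = 1 ∧
        (h = (zM I ξ, zM I ((S.transfer i σ σ').1 *ᵥ ξ) *
            (S.fnIn i σ' * const (S.kinkFactor i σ σ'))) ∨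
         h = (zM I (-ξ) * (S.fnIn i σ * const (S.kinkFactor i σ σ')),
            zM I ((S.transfer i σ σ').1 *ᵥ (-ξ))))})

/-- Consistency along the joint `𝔧` of codimension two. -/
structure ConsistentAt (𝔧 : Set X.Pt) : Prop where
  /-- `ϑ_m(p)` is the same for all general points of a chamber -/
  indep : ∀ σ₀ m, S.IsAsymptotic 𝔧 σ₀ m → ∀ σ u, S.IsChamberAt 𝔧 σ u →
    ∀ p ∈ u, ∀ p' ∈ u, S.IsGeneral 𝔧 σ p → S.IsGeneral 𝔧 σ p' →
      S.theta 𝔧 σ₀ m σ p = S.theta 𝔧 σ₀ m σ p'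
  /-- compatibility with crossing a wall of codimension zero from `u` to `u'` -/
  compat_wall : ∀ σ₀ m, S.IsAsymptotic 𝔧 σ₀ m → ∀ i σ, S.Crosses 𝔧 i σ σ →
    ∀ u u', S.IsChamberAt 𝔧 σ u → S.IsChamberAt 𝔧 σ u' → u ≠ u' →
      X.wedge 𝔧 (S.wall i).carrier σ ⊆ closure u →
      X.wedge 𝔧 (S.wall i).carrier σ ⊆ closure u' →
      ∀ ν, S.IsWallNormal 𝔧 i σ ν → (∀ x ∈ u, 0 ≤ pair ν x) →
        ∀ p ∈ u, ∀ p' ∈ u', S.IsGeneral 𝔧 σ p → S.IsGeneral 𝔧 σ p' →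
          S.theta 𝔧 σ₀ m σ p' = wallCrossing (S.fnIn i σ) ν (S.theta 𝔧 σ₀ m σ p)
  /-- compatibility with crossing a slab from `u` to `u'`: both functions come from one element
  of `R_𝔟` -/
  compat_slab : ∀ σ₀ m, S.IsAsymptotic 𝔧 σ₀ m → ∀ i σ σ', σ ≠ σ' → S.Crosses 𝔧 i σ σ' →
    ∀ u u', S.IsChamberAt 𝔧 σ u → S.IsChamberAt 𝔧 σ' u' →
      X.wedge 𝔧 (S.wall i).carrier σ ⊆ closure u →
      X.wedge 𝔧 (S.wall i).carrier σ' ⊆ closure u' →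
      ∀ p ∈ u, ∀ p' ∈ u', S.IsGeneral 𝔧 σ p → S.IsGeneral 𝔧 σ' p' →
        (S.theta 𝔧 σ₀ m σ p, S.theta 𝔧 σ₀ m σ' p') ∈ S.slabRing i σ σ'

/-! ### Convexity at a boundary joint -/

/-- The argument in `(-π, π]` of a vector in the plane. -/
def planeArg (x : Fin 2 → ℝ) : ℝ := Complex.arg ⟨x 0, x 1⟩

/-- Integral affine coordinates on `B_𝔧` modulo the directions tangent to the boundary joint `𝔧`.
They embed the quotient into `ℝ²` as the closed cone that extends clockwise from
`ℝ_{≥0} (-1, 0)` to `ℝ_{≥0} (a, b)`, `a > 0`; in particular `ℝ_{>0} (0, 1)` lies in the interior.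
The walls containing `𝔧` become the rays generated by primitive vectors `ray j`, in clockwise
order. -/
structure PlaneChart (𝔧 : Set X.Pt) where
  /-- the linear map on the tangent wedge of `σ`, for `σ ⊇ 𝔧` -/
  dev : X.MaxCell → Matrix (Fin 2) (Fin n) ℤ
  a : ℤ
  b : ℤ
  a_pos : 0 < a
  r : ℕ
  /-- the walls containing `𝔧` -/
  wall : Fin r ≃ {i : S.ι // 𝔧 ⊆ (S.wall i).carrier}
  ray : Fin r → Fin 2 → ℤ
  surjective : ∀ σ, 𝔧 ⊆ X.cellSet σ → Function.Surjective fun v : Fin n → ℤ => dev σ *ᵥ v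
  joint : ∀ σ, 𝔧 ⊆ X.cellSet σ → ∀ v ∈ X.wedge 𝔧 𝔧 σ, realMul (dev σ) v = 0
  /-- compatibility with the affine structure -/
  compat : ∀ i σ σ', σ ≠ σ' → S.Crosses 𝔧 i σ σ' → dev σ' * (S.transfer i σ σ').1 = dev σ
  image : (⋃ σ, ⋃ (_ : 𝔧 ⊆ X.cellSet σ), realMul (dev σ) '' X.wedge 𝔧 Set.univ σ) =
    {x | x = 0 ∨ planeArg (toReal ![a, b]) ≤ planeArg x}
  disjoint : ∀ σ σ', 𝔧 ⊆ X.cellSet σ → 𝔧 ⊆ X.cellSet σ' → σ ≠ σ' →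
    Disjoint (realMul (dev σ) '' interior (X.wedge 𝔧 Set.univ σ))
      (realMul (dev σ') '' interior (X.wedge 𝔧 Set.univ σ'))
  primitive : ∀ j, IsCoprime (ray j 0) (ray j 1)
  ray_eq : ∀ j σ, (S.wall (wall j)).carrier ⊆ X.cellSet σ →
    realMul (dev σ) '' X.wedge 𝔧 (S.wall (wall j)).carrier σ =
      {x | ∃ s : ℝ, 0 ≤ s ∧ x = s • toReal (ray j)}
  clockwise : ∀ j k, j < k → planeArg (toReal (ray k)) < planeArg (toReal (ray j))
  ray_mem : ∀ j, planeArg (toReal ![a, b]) < planeArg (toReal (ray j)) ∧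
    planeArg (toReal (ray j)) < Real.pi

/-- The image of `B_𝔧` in the plane. -/
def PlaneChart.cone {S : WallStructure F} {𝔧 : Set X.Pt} (C : S.PlaneChart 𝔧) : Set (Fin 2 → ℝ) :=
  {x | x = 0 ∨ planeArg (toReal ![C.a, C.b]) ≤ planeArg x}

/-- `δ` is the largest integer such that a monomial with tangent vector `-δ (a_j, b_j)` occurs in
the function of the `j`-th wall. -/
def PlaneChart.IsMaxExponent {S : WallStructure F} {𝔧 : Set X.Pt} (C : S.PlaneChart 𝔧)
    (j : Fin C.r) (δ : ℤ) : Prop :=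
  IsGreatest {d : ℤ | ∃ v ∈ (S.wall (C.wall j)).fn.coeff.support,
    C.dev (S.wall (C.wall j)).cell *ᵥ v = -d • C.ray j} δ

/-- The recursion for the slopes `λ_j`. A broken line that approaches the `j`-th wall in direction
`(1, λ)` and is maximally bent away from the boundary leaves it in direction
`(1 + (b_j - a_j λ) δ_j a_j, λ + (b_j - a_j λ) δ_j b_j)`. The first coordinate has to be positive,
since only then this is the direction `(1, λ')` of a line with slope `λ'`. -/
def PlaneChart.IsSlopeSequence {S : WallStructure F} {𝔧 : Set X.Pt} (C : S.PlaneChart 𝔧)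
    (δ : Fin C.r → ℤ) (lam : Fin (C.r + 1) → ℚ) : Prop :=
  lam 0 = 0 ∧ ∀ j : Fin C.r,
    0 < 1 + ((C.ray j 1 : ℚ) - C.ray j 0 * lam j.castSucc) * δ j * C.ray j 0 ∧
    lam j.succ =
      (lam j.castSucc + ((C.ray j 1 : ℚ) - C.ray j 0 * lam j.castSucc) * δ j * C.ray j 1) /
        (1 + ((C.ray j 1 : ℚ) - C.ray j 0 * lam j.castSucc) * δ j * C.ray j 0)

/-- Convexity at the boundary joint `𝔧`: the vector `(1, λ_r)` does not lie in the interior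
of `B_𝔧`. -/
def ConvexAt (𝔧 : Set X.Pt) : Prop :=
  ∃ (C : S.PlaneChart 𝔧) (δ : Fin C.r → ℤ) (lam : Fin (C.r + 1) → ℚ),
    (∀ j, C.IsMaxExponent j (δ j)) ∧ C.IsSlopeSequence δ lam ∧
      ![1, (lam (Fin.last C.r) : ℝ)] ∉ interior C.cone

end WallStructure

end ThetaFunctions

end

noncomputable section

namespace ThetaFunctions

set_option autoImplicit false

open Matrix WallStructure

/-! ### Planar geometry -/

/-! Dividing by the directions tangent to the joint turns wedges into planar cones, walls into rays,
and chambers into the parts of the sectors between consecutive rays that lie in one cell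
(`PlaneChart.isChamberAt_iff`). Let `w k = (1, λ_k)` be the direction of the maximally bent line in
the sector with number `k`. A bend adds a multiple of the wall ray, and the denominators are
positive, so the line keeps its side of that ray. If some `w k` had not turned past the next ray,
all later ones would stay behind and the last would point into the interior of the cone. Convexity
excludes this, so the whole sector `k` lies strictly to the left of `w k`
(`IsConvexFan.det2_w_pos_of_mem`).

A broken line has velocity `-m`. Its first exponent lies in the closure of its chamber, hence weakly
to the left of `w k`. At a wall, an exponent with normal component `N` changes by `-d` times the ray
with `d ≤ N δ`, while `w` bends by exactly `δ`. So exponents stay weakly to the left of `w`,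
whichever way the wall is crossed (`LineState.IsStep.det2_w_nonneg`), and the normal component does
not change. Hence a line traced back from any endpoint in its last chamber meets the preceding wall
on its ray and not at the joint (`LineState.IsStep.exists_prev`): each admissible sequence of
chambers and monomials is realized by exactly one broken line with a given endpoint in the last
chamber. Lines never turn around, so there are finitely many sequences, and `theta_eq_sum` writes
the theta function as a finite sum without reference to the endpoint. This is condition (a).

For (b), the monomials on the two sides of a wall are sorted by the sign of their normal component.
Those about to cross produce, by transport, exactly those moving away on the other side; any other
origin contradicts the half-plane invariant (`Adjacent.exists_step`). Those parallel to the wall are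
unbent first segments and occur on both sides. So the pair of theta functions is a sum of pairs of a
monomial and its transport, in either direction (`Adjacent.sum_mem_closure`), and each such pair
satisfies the required compatibility. -/

/-- The determinant of two vectors of the plane. -/
def det2 (x y : Fin 2 → ℝ) : ℝ := x 0 * y 1 - x 1 * y 0

lemma det2_add_right (x y z : Fin 2 → ℝ) : det2 x (y + z) = det2 x y + det2 x z := by
  simp only [det2, Pi.add_apply]; ring

lemma det2_add_left (x y z : Fin 2 → ℝ) : det2 (x + y) z = det2 x z + det2 y z := by
  simp only [det2, Pi.add_apply]; ring

lemma det2_sub_right (x y z : Fin 2 → ℝ) : det2 x (y - z) = det2 x y - det2 x z := by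
  simp only [det2, Pi.sub_apply]; ring

lemma det2_smul_right (x y : Fin 2 → ℝ) (c : ℝ) : det2 x (c • y) = c * det2 x y := by
  simp only [det2, Pi.smul_apply, smul_eq_mul]; ring

lemma det2_smul_left (x y : Fin 2 → ℝ) (c : ℝ) : det2 (c • x) y = c * det2 x y := by
  simp only [det2, Pi.smul_apply, smul_eq_mul]; ring

@[simp] lemma det2_self (x : Fin 2 → ℝ) : det2 x x = 0 := by simp only [det2]; ring

@[simp] lemma det2_zero_right (x : Fin 2 → ℝ) : det2 x 0 = 0 := by simp [det2]

lemma det2_swap (x y : Fin 2 → ℝ) : det2 x y = -det2 y x := by simp only [det2]; ring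

/-- The three-term Plücker relation; in `IsConvexChart.escape` it turns half-plane conditions
relative to `w` and `e` into the sign of `det2 x g`. -/
lemma det2_pluecker (w e x g : Fin 2 → ℝ) :
    det2 w e * det2 x g = det2 w x * det2 e g - det2 w g * det2 e x := by
  simp only [det2]; ring

lemma continuous_det2 (x : Fin 2 → ℝ) : Continuous (det2 x) := by
  unfold det2; fun_prop

lemma exists_smul_of_det2_eq_zero {e x : Fin 2 → ℝ} (he : e ≠ 0) (h : det2 e x = 0) :
    ∃ t : ℝ, x = t • e := by
  by_cases h0 : e 0 = 0
  · have h1 : e 1 ≠ 0 := fun h1 => he (by ext i; fin_cases i <;> simp [h0, h1])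
    refine ⟨x 1 / e 1, ?_⟩
    simp only [det2, h0, zero_mul, zero_sub, neg_eq_zero, mul_eq_zero, h1, false_or] at h
    ext i; fin_cases i
    · simp [h, h0]
    · simp; field_simp
  · refine ⟨x 0 / e 0, ?_⟩
    simp only [det2] at h
    ext i; fin_cases i
    · simp; field_simp
    · simp; field_simp; linarith

/-- The length of a vector of the plane. -/
def planeNorm (x : Fin 2 → ℝ) : ℝ := ‖(⟨x 0, x 1⟩ : ℂ)‖

lemma planeNorm_pos {x : Fin 2 → ℝ} (hx : x ≠ 0) : 0 < planeNorm x := by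
  refine norm_pos_iff.2 fun h => hx ?_
  have h0 := congrArg Complex.re h
  have h1 := congrArg Complex.im h
  ext i; fin_cases i
  · exact h0
  · exact h1

lemma planeNorm_mul_cos (x : Fin 2 → ℝ) : planeNorm x * Real.cos (planeArg x) = x 0 :=
  Complex.norm_mul_cos_arg _

lemma planeNorm_mul_sin (x : Fin 2 → ℝ) : planeNorm x * Real.sin (planeArg x) = x 1 :=
  Complex.norm_mul_sin_arg _

/-! ### Signs of determinants in terms of arguments. -/

lemma det2_eq_sin (x y : Fin 2 → ℝ) :
    det2 x y = planeNorm x * planeNorm y * Real.sin (planeArg y - planeArg x) := by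
  rw [Real.sin_sub, det2, ← planeNorm_mul_cos x, ← planeNorm_mul_sin x, ← planeNorm_mul_cos y,
    ← planeNorm_mul_sin y]
  ring

lemma planeArg_le_pi (x : Fin 2 → ℝ) : planeArg x ≤ Real.pi := Complex.arg_le_pi _
lemma neg_pi_lt_planeArg (x : Fin 2 → ℝ) : -Real.pi < planeArg x := Complex.neg_pi_lt_arg _

lemma abs_planeArg_lt_of_pos {x : Fin 2 → ℝ} (hx : 0 < x 0) :
    -(Real.pi / 2) < planeArg x ∧ planeArg x < Real.pi / 2 := by
  have := Complex.abs_arg_lt_pi_div_two_iff (z := ⟨x 0, x 1⟩)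
  exact abs_lt.1 (this.2 (Or.inl hx))

lemma sin_pos_iff {t : ℝ} (h1 : -(2 * Real.pi) < t) (h2 : t < 2 * Real.pi) :
    0 < Real.sin t ↔ (0 < t ∧ t < Real.pi) ∨ t < -Real.pi := by
  have hpi := Real.pi_pos
  constructor
  · intro h
    by_contra hc
    push Not at hc
    obtain ⟨hc1, hc2⟩ := hc
    rcases le_or_gt t 0 with h0 | h0
    · exact absurd (Real.sin_nonpos_of_nonpos_of_neg_pi_le h0 hc2) (not_le.2 h)
    · have h3 := hc1 h0
      have : Real.sin (t - 2 * Real.pi) ≤ 0 :=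
        Real.sin_nonpos_of_nonpos_of_neg_pi_le (by linarith) (by linarith)
      rw [Real.sin_sub_two_pi] at this
      linarith
  · rintro (⟨h3, h4⟩ | h3)
    · exact Real.sin_pos_of_pos_of_lt_pi h3 h4
    · rw [← Real.sin_add_two_pi]
      exact Real.sin_pos_of_pos_of_lt_pi (by linarith) (by linarith)

/-- The second alternative is the wrap-around at the cut of the argument along the negative axis.
Most later arguments about angles consist in ruling it out. -/
lemma det2_pos_iff {x y : Fin 2 → ℝ} (hx : x ≠ 0) (hy : y ≠ 0) :
    0 < det2 x y ↔ (planeArg x < planeArg y ∧ planeArg y < planeArg x + Real.pi) ∨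
      planeArg y + Real.pi < planeArg x := by
  rw [det2_eq_sin, mul_pos_iff_of_pos_left (mul_pos (planeNorm_pos hx) (planeNorm_pos hy)),
    sin_pos_iff]
  · constructor
    · rintro (⟨h1, h2⟩ | h)
      · left; constructor <;> linarith
      · right; linarith
    · rintro (⟨h1, h2⟩ | h)
      · left; constructor <;> linarith
      · right; linarith
  · linarith [planeArg_le_pi x, neg_pi_lt_planeArg y]
  · linarith [planeArg_le_pi y, neg_pi_lt_planeArg x]

lemma det2_neg_iff {x y : Fin 2 → ℝ} (hx : x ≠ 0) (hy : y ≠ 0) :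
    det2 x y < 0 ↔ (planeArg y < planeArg x ∧ planeArg x < planeArg y + Real.pi) ∨
      planeArg x + Real.pi < planeArg y := by
  rw [det2_swap, neg_lt_zero, det2_pos_iff hy hx]

lemma exists_pos_smul_of_planeArg_eq {x y : Fin 2 → ℝ} (hx : x ≠ 0)
    (h : planeArg x = planeArg y) : ∃ s : ℝ, 0 ≤ s ∧ y = s • x := by
  have := planeNorm_pos hx
  refine ⟨planeNorm y / planeNorm x, div_nonneg (norm_nonneg _) this.le, ?_⟩
  ext i; fin_cases i
  · change y 0 = _ * x 0
    rw [← planeNorm_mul_cos x, ← planeNorm_mul_cos y, h]; field_simp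
  · change y 1 = _ * x 1
    rw [← planeNorm_mul_sin x, ← planeNorm_mul_sin y, h]; field_simp

/-- The open sector between consecutive rays of a fan. -/
def sector (e : ℕ → Fin 2 → ℝ) (k : ℕ) : Set (Fin 2 → ℝ) :=
  {x | det2 (e k) x < 0 ∧ 0 < det2 (e (k + 1)) x}

/-- Rays `e 0 = (-1, 0), …, e (r + 1)` in clockwise order, and directions `w 0, …, w r` of a line
that starts parallel to the first ray, is bent at each ray, and does not enter the interior of the
cone at the end. -/
structure IsConvexFan (r : ℕ) (e w : ℕ → Fin 2 → ℝ) (δ : ℕ → ℤ) (den : ℕ → ℝ) : Prop where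
  first : e 0 = ![-1, 0]
  ne_zero : ∀ i, e i ≠ 0
  lt : ∀ i ≤ r, planeArg (e (i + 1)) < planeArg (e i)
  last : 0 < e (r + 1) 0
  w_first : w 0 = ![1, 0]
  w_pos : ∀ k ≤ r, 0 < w k 0
  den_pos : ∀ k < r, 0 < den k
  bend : ∀ k < r, den k • w (k + 1) = w k + (det2 (w k) (e (k + 1)) * δ k) • e (k + 1)
  conv : planeArg (w r) ≤ planeArg (e (r + 1))

/-! ### The position of the maximally bent line relative to the fan. -/

namespace IsConvexFan

variable {r : ℕ} {e w : ℕ → Fin 2 → ℝ} {δ : ℕ → ℤ} {den : ℕ → ℝ} (h : IsConvexFan r e w δ den)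
include h

lemma planeArg_first : planeArg (e 0) = Real.pi := by
  rw [h.first]
  exact Complex.arg_eq_pi_iff.2 ⟨by simp, by simp⟩

lemma planeArg_w_first : planeArg (w 0) = 0 := by
  rw [h.w_first]
  exact Complex.arg_eq_zero_iff.2 ⟨by simp, by simp⟩

lemma lt_of_lt {i j : ℕ} (hij : i < j) (hj : j ≤ r + 1) : planeArg (e j) < planeArg (e i) := by
  induction j with
  | zero => omega
  | succ j ih =>
    rcases Nat.lt_succ_iff_lt_or_eq.1 hij with h1 | rfl
    · exact (h.lt j (by omega)).trans (ih h1 (by omega))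
    · exact h.lt i (by omega)

lemma le_of_le {i j : ℕ} (hij : i ≤ j) (hj : j ≤ r + 1) : planeArg (e j) ≤ planeArg (e i) := by
  rcases hij.eq_or_lt with rfl | h1
  · exact le_rfl
  · exact (h.lt_of_lt h1 hj).le

/-- Arguments decrease along the fan and the last ray points to the right. Together with the
positive first coordinate of `w k` this excludes the wrap-around when rays are compared with the
bent line. -/
lemma planeArg_gt {i : ℕ} (hi : i ≤ r + 1) : -(Real.pi / 2) < planeArg (e i) :=
  (abs_planeArg_lt_of_pos h.last).1.trans_le (h.le_of_le hi le_rfl)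

lemma w_ne {k : ℕ} (hk : k ≤ r) : w k ≠ 0 := fun h0 => by
  have := h.w_pos k hk
  simp [h0] at this

/-- The bend is a multiple of the ray, so up to the positive factor `den k` it does not affect the
determinant with the ray: the line stays on its side. -/
lemma det2_bend {k : ℕ} (hk : k < r) :
    det2 (e (k + 1)) (w k) = den k * det2 (e (k + 1)) (w (k + 1)) := by
  rw [← det2_smul_right, h.bend k hk, det2_add_right, det2_smul_right, det2_self, mul_zero,
    add_zero]

lemma planeArg_w_lt_aux {k : ℕ} (hk : k < r) (hle : planeArg (e (k + 1)) ≤ planeArg (w k)) :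
    planeArg (e (k + 1)) ≤ planeArg (w (k + 1)) := by
  have hw := abs_planeArg_lt_of_pos (h.w_pos k hk.le)
  have hw' := abs_planeArg_lt_of_pos (h.w_pos (k + 1) hk)
  have he := h.planeArg_gt (i := k + 1) (by omega)
  by_contra hc
  push Not at hc
  have h1 : det2 (e (k + 1)) (w (k + 1)) < 0 :=
    (det2_neg_iff (h.ne_zero _) (h.w_ne hk)).2 (Or.inl ⟨hc, by linarith⟩)
  have h2 := h.det2_bend hk
  have h3 : det2 (e (k + 1)) (w k) < 0 := by
    rw [h2]; exact mul_neg_of_pos_of_neg (h.den_pos k hk) h1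
  rcases (det2_neg_iff (h.ne_zero _) (h.w_ne hk.le)).1 h3 with h4 | h4 <;>
  linarith [Real.pi_pos]

/-- This is where convexity enters. A direction that has not turned past the next ray is still not
past it after the bend, and the rays only turn clockwise, so it would end in the interior of the
cone. -/
lemma planeArg_w_lt {k : ℕ} (hk : k < r) : planeArg (w k) < planeArg (e (k + 1)) := by
  by_contra hc
  push Not at hc
  -- The inequality becomes strict after one step because the rays are distinct; strictness is
  -- needed as `conv` allows `w r` to lie on the last ray.
  have key : ∀ j, k ≤ j → j ≤ r → planeArg (e (j + 1)) ≤ planeArg (w j) ∧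
      (k < j → planeArg (e (j + 1)) < planeArg (w j)) := by
    intro j hj
    induction j, hj using Nat.le_induction with
    | base => exact fun _ => ⟨hc, fun h => absurd h (lt_irrefl _)⟩
    | succ j hj ih =>
      intro hjr
      have h1 := h.planeArg_w_lt_aux (by omega) (ih (by omega)).1
      have h2 := h.lt (j + 1) (by omega)
      exact ⟨(h2.trans_le h1).le, fun _ => h2.trans_le h1⟩
  exact absurd h.conv (not_le.2 ((key r hk.le le_rfl).2 hk))

lemma planeArg_w_le {k : ℕ} (hk : k ≤ r) : planeArg (w k) ≤ planeArg (e (k + 1)) := by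
  rcases hk.eq_or_lt with rfl | h1
  · exact h.conv
  · exact (h.planeArg_w_lt h1).le

/-- The bound from the other side, by induction through the same invariance of sides. Equality holds
at `k = 0`, where `w 0` is opposite to the first boundary ray. -/
lemma planeArg_w_gt {k : ℕ} (hk : k ≤ r) :
    planeArg (e k) - Real.pi ≤ planeArg (w k) ∧
      (0 < k → planeArg (e k) - Real.pi < planeArg (w k)) := by
  induction k with
  | zero => simp [h.planeArg_first, h.planeArg_w_first]
  | succ k ih =>
    have h1 := (ih (by omega)).1
    have h2 := h.planeArg_w_lt (k := k) (by omega)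
    have h3 := h.lt k (by omega)
    have h4 : det2 (e (k + 1)) (w k) < 0 :=
      (det2_neg_iff (h.ne_zero _) (h.w_ne (by omega))).2 (Or.inl ⟨h2, by linarith⟩)
    rw [h.det2_bend (by omega)] at h4
    have h5 : det2 (e (k + 1)) (w (k + 1)) < 0 := by
      by_contra hc
      exact absurd (mul_nonneg (h.den_pos k (by omega)).le (not_lt.1 hc)) (not_le.2 h4)
    have hw' := abs_planeArg_lt_of_pos (h.w_pos (k + 1) hk)
    have he := h.planeArg_gt (i := k + 1) (by omega)
    have : planeArg (e (k + 1)) - Real.pi < planeArg (w (k + 1)) := by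
      rcases (det2_neg_iff (h.ne_zero _) (h.w_ne hk)).1 h5 with h6 | h6 <;>
      linarith
    exact ⟨this.le, fun _ => this⟩

lemma det2_w_pos {k : ℕ} (hk : k ≤ r) (h0 : 0 < k) : 0 < det2 (w k) (e k) := by
  refine (det2_pos_iff (h.w_ne hk) (h.ne_zero _)).2 (Or.inl ?_)
  have := (h.planeArg_w_gt hk).2 h0
  have h1 := h.planeArg_w_le hk
  have h2 := h.lt k hk
  constructor <;> linarith

lemma det2_w_succ_pos {k : ℕ} (hk : k < r) : 0 < det2 (w k) (e (k + 1)) := by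
  refine (det2_pos_iff (h.w_ne hk.le) (h.ne_zero _)).2 (Or.inl ?_)
  have := (h.planeArg_w_gt hk.le).1
  have h1 := h.planeArg_w_lt hk
  have h2 := h.lt k hk.le
  constructor <;> linarith

/-- The direction `w k` lies clockwise beyond the second ray and at an angle less than `π` from the
first, so two consecutive wall rays span an angle less than `π`. -/
lemma det2_neg_of_inner {k : ℕ} (h0 : 0 < k) (hk : k < r) : det2 (e k) (e (k + 1)) < 0 := by
  refine (det2_neg_iff (h.ne_zero _) (h.ne_zero _)).2 (Or.inl ?_)
  have h1 := (h.planeArg_w_gt hk.le).2 h0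
  have h2 := h.planeArg_w_lt hk
  have h3 := h.lt k hk.le
  constructor <;> linarith

/-- The two half-planes cut out the angular interval because `w k` bounds the opening of the sector
by `π`. -/
lemma mem_sector_iff {k : ℕ} (hk : k ≤ r) {x : Fin 2 → ℝ} (hx : x ≠ 0) :
    x ∈ sector e k ↔ planeArg (e (k + 1)) < planeArg x ∧ planeArg x < planeArg (e k) := by
  have h1 := (h.planeArg_w_gt hk).1
  have h2 := h.planeArg_w_le hk
  have h3 := h.lt k hk
  have hpi := Real.pi_pos
  rw [sector, Set.mem_ofPred_eq, det2_neg_iff (h.ne_zero _) hx, det2_pos_iff (h.ne_zero _) hx]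
  constructor
  · rintro ⟨h4 | h4, h5 | h5⟩ <;> constructor <;> linarith
  · rintro ⟨h4, h5⟩
    constructor
    · left; constructor <;> linarith
    · left; constructor <;> linarith

omit h in
lemma ne_zero_of_mem_sector {k : ℕ} {x : Fin 2 → ℝ} (hx : x ∈ sector e k) : x ≠ 0 := by
  rintro rfl
  simp [sector] at hx

/-- The geometric content of convexity: the sector lies between the argument of `w k` and that
argument plus `π`. -/
lemma det2_w_pos_of_mem {k : ℕ} (hk : k ≤ r) {x : Fin 2 → ℝ} (hx : x ∈ sector e k) :
    0 < det2 (w k) x := by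
  have hx0 := ne_zero_of_mem_sector hx
  rw [h.mem_sector_iff hk hx0] at hx
  refine (det2_pos_iff (h.w_ne hk) hx0).2 (Or.inl ?_)
  have h1 := (h.planeArg_w_gt hk).1
  have h2 := h.planeArg_w_le hk
  constructor <;> linarith

lemma det2_w_nonneg {k : ℕ} (hk : k ≤ r) {x : Fin 2 → ℝ} (hx : x ∈ closure (sector e k)) :
    0 ≤ det2 (w k) x := by
  have : closure (sector e k) ⊆ {x | 0 ≤ det2 (w k) x} :=
    closure_minimal (fun y hy => (h.det2_w_pos_of_mem hk hy).le)
      (isClosed_le continuous_const (continuous_det2 _))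
  exact this hx

lemma sector_disjoint {k k' : ℕ} (hk : k ≤ r) (hk' : k' ≤ r) {x : Fin 2 → ℝ}
    (hx : x ∈ sector e k) (hx' : x ∈ sector e k') : k = k' := by
  have hx0 := ne_zero_of_mem_sector hx
  rw [h.mem_sector_iff hk hx0] at hx
  rw [h.mem_sector_iff hk' hx0] at hx'
  by_contra hne
  rcases lt_or_gt_of_ne hne with h1 | h1
  · have := h.le_of_le (i := k + 1) (j := k') h1 (by omega)
    linarith
  · have := h.le_of_le (i := k' + 1) (j := k) h1 (by omega)
    linarith

omit h in
lemma det2_of_mem_closure {k : ℕ} {x : Fin 2 → ℝ} (hx : x ∈ closure (sector e k)) :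
    det2 (e k) x ≤ 0 ∧ 0 ≤ det2 (e (k + 1)) x := by
  have : closure (sector e k) ⊆ {x | det2 (e k) x ≤ 0} ∩ {x | 0 ≤ det2 (e (k + 1)) x} :=
    closure_minimal (fun y hy => ⟨hy.1.le, hy.2.le⟩)
      ((isClosed_le (continuous_det2 _) continuous_const).inter
        (isClosed_le continuous_const (continuous_det2 _)))
  exact this hx

/-- Any other ray would be at angle at least `π` from the nearer bounding ray and at most `π` from
the farther one. -/
lemma eq_or_eq_of_mem_closure {k i : ℕ} (hk : k ≤ r) (hi : i ≤ r)
    (hx : e i ∈ closure (sector e k)) : k = i ∨ k + 1 = i := by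
  obtain ⟨h1, h2⟩ := det2_of_mem_closure hx
  have hpi := Real.pi_pos
  have hlt := h.lt k hk
  have hi1 := h.planeArg_gt (i := i) (by omega)
  have hi2 := planeArg_le_pi (e i)
  have hk1 := h.planeArg_gt (i := k) (by omega)
  have hk2 := planeArg_le_pi (e k)
  have hk3 := h.planeArg_gt (i := k + 1) (by omega)
  by_contra hc
  push Not at hc
  rcases lt_or_gt_of_ne hc.1 with h3 | h3
  · have h4 := h.lt_of_lt (i := k + 1) (j := i) (by omega) (by omega)
    have h5 : ¬ det2 (e (k + 1)) (e i) < 0 := not_lt.2 h2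
    rw [det2_neg_iff (h.ne_zero _) (h.ne_zero _)] at h5
    have h6 : ¬ 0 < det2 (e k) (e i) := not_lt.2 h1
    rw [det2_pos_iff (h.ne_zero _) (h.ne_zero _)] at h6
    push Not at h5 h6
    have := h5.1 h4
    linarith [h6.2]
  · have h4 := h.lt_of_lt (i := i) (j := k) (by omega) (by omega)
    have h5 : ¬ det2 (e (k + 1)) (e i) < 0 := not_lt.2 h2
    rw [det2_neg_iff (h.ne_zero _) (h.ne_zero _)] at h5
    have h6 : ¬ 0 < det2 (e k) (e i) := not_lt.2 h1
    rw [det2_pos_iff (h.ne_zero _) (h.ne_zero _)] at h6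
    push Not at h5 h6
    have := h6.1 h4
    linarith [h5.2]

lemma exists_sector {x : Fin 2 → ℝ} (hx : x ≠ 0) (h1 : planeArg (e (r + 1)) < planeArg x)
    (h2 : planeArg x < Real.pi) :
    (∃ k ≤ r, x ∈ sector e k) ∨ ∃ i < r, planeArg (e (i + 1)) = planeArg x := by
  classical
  -- The least such `k` is the sector of `x`, unless minimality leaves `x` exactly on its first ray.
  have hex : ∃ k, planeArg (e (k + 1)) < planeArg x := ⟨r, h1⟩
  have hk := Nat.find_spec hex
  have hkr : Nat.find hex ≤ r := Nat.find_min' hex h1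
  have hmin := fun m (hm : m < Nat.find hex) => Nat.find_min hex hm
  generalize Nat.find hex = k at hk hkr hmin
  rcases k with _ | k
  · left
    exact ⟨0, by omega, (h.mem_sector_iff (by omega) hx).2 ⟨hk, by rwa [h.planeArg_first]⟩⟩
  · rcases (not_lt.1 (hmin k (by omega))).eq_or_lt with h3 | h3
    · right
      exact ⟨k, by omega, h3.symm⟩
    · left
      exact ⟨k + 1, hkr, (h.mem_sector_iff hkr hx).2 ⟨hk, h3⟩⟩

lemma of_mem_interior {x : Fin 2 → ℝ}
    (hx : x ∈ interior {x | x = 0 ∨ planeArg (e (r + 1)) ≤ planeArg x}) :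
    x ≠ 0 ∧ planeArg (e (r + 1)) < planeArg x ∧ planeArg x < Real.pi := by
  have hpi := Real.pi_pos
  have hα := h.planeArg_gt (i := r + 1) le_rfl
  have hx' := interior_subset hx
  -- An interior point survives a small push in direction `(0, -1)`. This push leaves the cone from
  -- the origin, from the negative axis and from the last ray.
  have hev : ∀ᶠ t : ℝ in nhds 0, x + t • ![0, -1] ∈
      {x | x = 0 ∨ planeArg (e (r + 1)) ≤ planeArg x} := by
    have hc : ContinuousAt (fun t : ℝ => x + t • (![0, -1] : Fin 2 → ℝ)) 0 := by fun_prop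
    exact hc.eventually_mem (by simpa using mem_interior_iff_mem_nhds.1 hx)
  obtain ⟨ε, hε, hball⟩ := Metric.eventually_nhds_iff.1 hev
  have hy := @hball (ε / 2) (by rw [Real.dist_eq, sub_zero, abs_of_pos] <;> linarith)
  set y : Fin 2 → ℝ := x + (ε / 2) • ![0, -1] with hydef
  have hy0 : y 0 = x 0 := by rw [hydef, Pi.add_apply, Pi.smul_apply]; simp
  have hy1 : y 1 = x 1 - ε / 2 := by
    rw [hydef, Pi.add_apply, Pi.smul_apply]; simp [sub_eq_add_neg]
  clear_value y
  have hlow : ∀ z : Fin 2 → ℝ, z 0 ≤ 0 → z 1 < 0 →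
      ¬ (z = 0 ∨ planeArg (e (r + 1)) ≤ planeArg z) := by
    rintro z h0 h1 (rfl | h2)
    · simp at h1
    · have h3 : -(Real.pi / 2) < Complex.arg ⟨z 0, z 1⟩ := lt_of_lt_of_le hα h2
      rcases h0.lt_or_eq with h0 | h0
      · rcases (Complex.neg_pi_div_two_le_arg_iff.1 h3.le) with h4 | h4
        · simp only at h4; linarith
        · simp only at h4; linarith
      · rw [h0] at h3
        have h4 := (Complex.arg_eq_neg_pi_div_two_iff (z := ⟨0, z 1⟩)).2 ⟨rfl, h1⟩
        rw [h4] at h3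
        linarith
  have hxne : x ≠ 0 := by
    rintro rfl
    exact hlow y (by simp [hy0]) (by simp [hy1, hε]) hy
  have hle : planeArg (e (r + 1)) ≤ planeArg x := hx'.resolve_left hxne
  refine ⟨hxne, lt_of_le_of_ne hle fun heq => ?_, lt_of_le_of_ne (planeArg_le_pi x) fun heq => ?_⟩
  · obtain ⟨s, hs, rfl⟩ := exists_pos_smul_of_planeArg_eq (h.ne_zero _) heq
    have hs' : 0 < s := hs.lt_of_ne (by rintro rfl; simp at hxne)
    have hypos : 0 < y 0 := by rw [hy0]; exact mul_pos hs' h.last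
    have hyne : y ≠ 0 := by rintro rfl; simp at hypos
    have h1 : det2 (e (r + 1)) y < 0 := by
      rw [det2, hy0, hy1]
      simp only [Pi.smul_apply, smul_eq_mul]
      nlinarith [h.last]
    have h2 := hy.resolve_left hyne
    have h3 := abs_planeArg_lt_of_pos hypos
    rcases (det2_neg_iff (h.ne_zero _) hyne).1 h1 with h4 | h4 <;> linarith
  · obtain ⟨h1, h2⟩ := Complex.arg_eq_pi_iff.1 heq
    simp only at h1 h2
    exact hlow y (by rw [hy0]; exact h1.le) (by rw [hy1, h2]; linarith) hy

end IsConvexFan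

/-! ### Open convex cones in the plane. -/

lemma isOpen_sector (e : ℕ → Fin 2 → ℝ) (k : ℕ) : IsOpen (sector e k) :=
  (isOpen_lt (continuous_det2 _) continuous_const).inter
    (isOpen_lt continuous_const (continuous_det2 _))

lemma convex_sector (e : ℕ → Fin 2 → ℝ) (k : ℕ) : Convex ℝ (sector e k) := by
  rw [convex_iff_forall_pos]
  rintro x ⟨hx1, hx2⟩ y ⟨hy1, hy2⟩ a b ha hb -
  constructor
  · rw [det2_add_right, det2_smul_right, det2_smul_right]; nlinarith
  · rw [det2_add_right, det2_smul_right, det2_smul_right]; nlinarith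

lemma smul_mem_sector {e : ℕ → Fin 2 → ℝ} {k : ℕ} {x : Fin 2 → ℝ} (hx : x ∈ sector e k) {c : ℝ}
    (hc : 0 < c) : c • x ∈ sector e k := by
  constructor
  · rw [det2_smul_right]; exact mul_neg_of_pos_of_neg hc hx.1
  · rw [det2_smul_right]; exact mul_pos hc hx.2

/-- An open convex cone without apex. -/
structure IsOpenCone (V : Set (Fin 2 → ℝ)) : Prop where
  isOpen : IsOpen V
  convex : Convex ℝ V
  smul_mem : ∀ x ∈ V, ∀ c : ℝ, 0 < c → c • x ∈ V

namespace IsOpenCone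

variable {V : Set (Fin 2 → ℝ)} (hV : IsOpenCone V)
include hV

lemma smul_mem_closure {x : Fin 2 → ℝ} (hx : x ∈ closure V) {c : ℝ} (hc : 0 < c) :
    c • x ∈ closure V := by
  have h1 : Set.MapsTo (fun y : Fin 2 → ℝ => c • y) V V := fun y hy => hV.smul_mem y hy c hc
  exact h1.closure (by fun_prop) hx

lemma add_mem {v x : Fin 2 → ℝ} (hv : v ∈ V) (hx : x ∈ closure V) : v + x ∈ V := by
  have h1 : openSegment ℝ v x ⊆ interior V :=
    hV.convex.openSegment_interior_closure_subset_interior (by rwa [hV.isOpen.interior_eq]) hx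
  have h2 : (1 / 2 : ℝ) • v + (1 / 2 : ℝ) • x ∈ V :=
    interior_subset (h1 ⟨1 / 2, 1 / 2, by norm_num, by norm_num, by norm_num, rfl⟩)
  have h3 := hV.smul_mem _ h2 2 (by norm_num)
  rwa [smul_add, smul_smul, smul_smul, show (2 : ℝ) * (1 / 2) = 1 by norm_num, one_smul,
    one_smul] at h3

lemma add_mem_closure {v x : Fin 2 → ℝ} (hv : v ∈ closure V) (hx : x ∈ closure V) :
    v + x ∈ closure V := by
  have h1 : Set.MapsTo (fun y : Fin 2 → ℝ => y + x) V V := fun y hy => hV.add_mem hy hx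
  exact h1.closure (by fun_prop) hv

/-- Expand some `v` in `V` in the basis `x`, `y`. A large multiple of `x + y` exceeds `v` by a
positive combination of `x` and `y`, so it lies in `V` by `add_mem`. -/
lemma add_mem_of_det2_ne_zero (hne : V.Nonempty) {x y : Fin 2 → ℝ} (hx : x ∈ closure V)
    (hy : y ∈ closure V) (hd : det2 x y ≠ 0) : x + y ∈ V := by
  obtain ⟨v, hv⟩ := hne
  set α := det2 v y / det2 x y with hα
  set β := det2 x v / det2 x y with hβ
  have hv' : v = α • x + β • y := by
    ext i
    simp only [Pi.add_apply, Pi.smul_apply, smul_eq_mul, hα, hβ]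
    rw [div_mul_eq_mul_div, div_mul_eq_mul_div, ← add_div, eq_div_iff hd]
    fin_cases i <;> simp only [det2] <;> simp <;> ring
  set M := 1 + |α| + |β| with hM
  have hM0 : 0 < M := by positivity
  have e1 : 0 < M - α := by
    have := le_abs_self α; have := abs_nonneg β; linarith
  have e2 : 0 < M - β := by
    have := le_abs_self β; have := abs_nonneg α; linarith
  have h3 := hV.add_mem hv
    (hV.add_mem_closure (hV.smul_mem_closure hx e1) (hV.smul_mem_closure hy e2))
  have h4 : v + ((M - α) • x + (M - β) • y) = M • (x + y) := by
    rw [hv']; module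
  rw [h4] at h3
  have := hV.smul_mem _ h3 M⁻¹ (by positivity)
  rwa [smul_smul, inv_mul_cancel₀ hM0.ne', one_smul] at this

end IsOpenCone

/-- Two open convex cones on the same side of a common boundary ray meet. -/
lemma IsOpenCone.inter_nonempty {V V' : Set (Fin 2 → ℝ)} (hV : IsOpenCone V) (hV' : IsOpenCone V')
    {e : Fin 2 → ℝ} (he0 : e ≠ 0) (he : e ∈ closure V) (he' : e ∈ closure V')
    {x x' : Fin 2 → ℝ} (hx : x ∈ V) (hx' : x' ∈ V') (hs : 0 < det2 e x * det2 e x') :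
    (V ∩ V').Nonempty := by
  have hne' : det2 e x' ≠ 0 := fun h => by simp [h] at hs
  -- This scaling gives `x` and `c • x'` the same determinant with `e`, so they differ by a multiple
  -- of `e`.
  set c := det2 e x / det2 e x' with hc
  have hc0 : 0 < c := by
    have : c = det2 e x * det2 e x' / (det2 e x' * det2 e x') := by rw [hc]; field_simp
    rw [this]; exact div_pos hs (mul_self_pos.2 hne')
  have h1 : det2 e (x - c • x') = 0 := by
    rw [det2_sub_right, det2_smul_right, hc]; field_simp; ring
  obtain ⟨t, ht⟩ := exists_smul_of_det2_eq_zero he0 h1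
  -- Slide both points along `e` to a common position; the shift is large enough for both
  -- coefficients of `e` to be positive.
  have h2 : x + (|t| + 1) • e ∈ V :=
    hV.add_mem hx (hV.smul_mem_closure he (by positivity))
  have h3 : c • x' + (t + |t| + 1) • e ∈ V' :=
    hV'.add_mem (hV'.smul_mem _ hx' c hc0)
      (hV'.smul_mem_closure he' (by linarith [neg_abs_le t]))
  refine ⟨_, h2, ?_⟩
  have : x + (|t| + 1) • e = c • x' + (t + |t| + 1) • e := by
    rw [sub_eq_iff_eq_add] at ht; rw [ht]; module
  rwa [this]

/-! ### Integral linear maps -/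

/-- The real linear map given by an integral matrix, as a continuous linear map. -/
def realMulL {m n : ℕ} (M : Matrix (Fin m) (Fin n) ℤ) : (Fin n → ℝ) →L[ℝ] (Fin m → ℝ) :=
  LinearMap.toContinuousLinearMap (M.map (Int.cast : ℤ → ℝ)).mulVecLin

lemma realMul_eq {m n : ℕ} (M : Matrix (Fin m) (Fin n) ℤ) (x : Fin n → ℝ) :
    realMul M x = realMulL M x := rfl

lemma realMul_mul {l m n : ℕ} (M : Matrix (Fin l) (Fin m) ℤ) (N : Matrix (Fin m) (Fin n) ℤ)
    (x : Fin n → ℝ) : realMul (M * N) x = realMul M (realMul N x) := by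
  have : (M * N).map (Int.cast : ℤ → ℝ) = M.map Int.cast * N.map Int.cast :=
    Matrix.map_mul (f := Int.castRingHom ℝ)
  rw [realMul, realMul, realMul, this, Matrix.mulVec_mulVec]; rfl

lemma realMul_one {n : ℕ} (x : Fin n → ℝ) : realMul (1 : Matrix (Fin n) (Fin n) ℤ) x = x := by
  rw [realMul, Matrix.map_one _ Int.cast_zero Int.cast_one, Matrix.one_mulVec]

lemma realMul_toReal {m n : ℕ} (M : Matrix (Fin m) (Fin n) ℤ) (v : Fin n → ℤ) :
    realMul M (toReal v) = toReal (M *ᵥ v) := by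
  ext i
  simp [realMul, toReal, Matrix.mulVec, dotProduct]

lemma toReal_sub {n : ℕ} (v w : Fin n → ℤ) : toReal (v - w) = toReal v - toReal w := by
  ext i; simp [toReal]

lemma toReal_smul {n : ℕ} (c : ℤ) (v : Fin n → ℤ) : toReal (c • v) = (c : ℝ) • toReal v := by
  ext i; simp [toReal]

lemma toReal_injective {n : ℕ} : Function.Injective (toReal (n := n)) := fun v w h => by
  ext i
  have := congrFun h i
  simpa [toReal] using this

lemma toReal_eq_zero {n : ℕ} {v : Fin n → ℤ} : toReal v = 0 ↔ v = 0 := by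
  rw [← toReal_injective.eq_iff]
  have : toReal (0 : Fin n → ℤ) = 0 := by ext i; simp [toReal]
  rw [this]

lemma realMul_inv_mul {n : ℕ} (g : GL (Fin n) ℤ) (x : Fin n → ℝ) :
    realMul (g⁻¹).1 (realMul g.1 x) = x := by
  rw [← realMul_mul]
  have : (g⁻¹).1 * g.1 = 1 := g.inv_mul
  rw [this, realMul_one]

lemma realMul_mul_inv {n : ℕ} (g : GL (Fin n) ℤ) (x : Fin n → ℝ) :
    realMul g.1 (realMul (g⁻¹).1 x) = x := by
  rw [← realMul_mul]
  have : g.1 * (g⁻¹).1 = 1 := g.mul_inv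
  rw [this, realMul_one]

lemma realMul_injective {n : ℕ} (g : GL (Fin n) ℤ) : Function.Injective (realMul g.1) :=
  Function.LeftInverse.injective (realMul_inv_mul g)

lemma realMul_surjective {n : ℕ} (g : GL (Fin n) ℤ) : Function.Surjective (realMulL g.1) :=
  fun x => ⟨_, realMul_mul_inv g x⟩

/-! ### Convexity -/

lemma IsRationalPolyhedron.convex {n : ℕ} {P : Set (Fin n → ℝ)} (h : IsRationalPolyhedron P) :
    Convex ℝ P := by
  obtain ⟨k, a, b, rfl⟩ := h
  rw [convex_iff_forall_pos]
  intro x hx y hy s t hs ht hst i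
  have h1 := hx i
  have h2 := hy i
  calc ∑ j, (a i j : ℝ) * (s • x + t • y) j
      = s * ∑ j, (a i j : ℝ) * x j + t * ∑ j, (a i j : ℝ) * y j := by
        rw [Finset.mul_sum, Finset.mul_sum, ← Finset.sum_add_distrib]
        refine Finset.sum_congr rfl fun j _ => ?_
        simp only [Pi.add_apply, Pi.smul_apply, smul_eq_mul]; ring
    _ ≤ s * b i + t * b i := by gcongr
    _ = b i := by rw [← add_mul, hst, one_mul]

/-- The cone generated by the differences of the points of two sets. -/
def coneDiff {E : Type*} [AddCommGroup E] [Module ℝ E] (J T : Set E) : Set E :=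
  {v | ∃ x ∈ J, ∃ y ∈ T, ∃ s : ℝ, 0 ≤ s ∧ v = s • (y - x)}

section coneDiff
variable {E : Type*} [AddCommGroup E] [Module ℝ E] {J T : Set E}

lemma coneDiff_smul {v : E} (hv : v ∈ coneDiff J T) {c : ℝ} (hc : 0 ≤ c) :
    c • v ∈ coneDiff J T := by
  obtain ⟨x, hx, y, hy, s, hs, rfl⟩ := hv
  exact ⟨x, hx, y, hy, c * s, mul_nonneg hc hs, by rw [smul_smul]⟩

lemma coneDiff_add (hJ : Convex ℝ J) (hT : Convex ℝ T) {v w : E} (hv : v ∈ coneDiff J T)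
    (hw : w ∈ coneDiff J T) : v + w ∈ coneDiff J T := by
  obtain ⟨x, hx, y, hy, s, hs, rfl⟩ := hv
  obtain ⟨x', hx', y', hy', s', hs', rfl⟩ := hw
  rcases (add_nonneg hs hs').eq_or_lt with h0 | h0
  · have h1 : s = 0 := by linarith
    have h2 : s' = 0 := by linarith
    exact ⟨x, hx, y, hy, 0, le_rfl, by simp [h1, h2]⟩
  · have h1 : s / (s + s') + s' / (s + s') = 1 := by field_simp
    refine ⟨(s / (s + s')) • x + (s' / (s + s')) • x',
      hJ hx hx' (by positivity) (by positivity) h1,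
      (s / (s + s')) • y + (s' / (s + s')) • y',
      hT hy hy' (by positivity) (by positivity) h1, s + s', h0.le, ?_⟩
    have e1 : (s + s') * (s / (s + s')) = s := by field_simp
    have e2 : (s + s') * (s' / (s + s')) = s' := by field_simp
    simp only [smul_sub, smul_add, smul_smul, e1, e2]
    abel

lemma convex_coneDiff (hJ : Convex ℝ J) (hT : Convex ℝ T) : Convex ℝ (coneDiff J T) := by
  intro v hv w hw a b ha hb _
  exact coneDiff_add hJ hT (coneDiff_smul hv ha) (coneDiff_smul hw hb)

/-- The cone of differences of a convex set with itself is symmetric, hence a linear subspace. -/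
lemma vectorSpan_subset_coneDiff (hJ : Convex ℝ J) (hne : J.Nonempty) :
    (vectorSpan ℝ J : Set E) ⊆ coneDiff J J := by
  obtain ⟨x₀, hx₀⟩ := hne
  have hneg : ∀ v ∈ coneDiff J J, -v ∈ coneDiff J J := by
    rintro v ⟨x, hx, y, hy, s, hs, rfl⟩
    exact ⟨y, hy, x, hx, s, hs, by rw [← smul_neg, neg_sub]⟩
  intro v hv
  refine Submodule.span_induction (p := fun v _ => v ∈ coneDiff J J) ?_ ?_ ?_ ?_ hv
  · rintro v ⟨y, hy, x, hx, rfl⟩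
    exact ⟨x, hx, y, hy, 1, zero_le_one, by rw [one_smul]; rfl⟩
  · exact ⟨x₀, hx₀, x₀, hx₀, 0, le_rfl, by simp⟩
  · exact fun x y _ _ hx hy => coneDiff_add hJ hJ hx hy
  · intro a x _ hx
    rcases le_total 0 a with ha | ha
    · exact coneDiff_smul hx ha
    · rw [← neg_neg a, neg_smul, ← smul_neg]
      exact coneDiff_smul (hneg _ hx) (by linarith)

/-- Invariance of a wedge under translations along the joint; it makes the wedge determined by its
image in the plane. -/
lemma coneDiff_add_vectorSpan (hJ : Convex ℝ J) (hT : Convex ℝ T) (hne : J.Nonempty) (hJT : J ⊆ T)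
    {v k : E} (hv : v ∈ coneDiff J T) (hk : k ∈ vectorSpan ℝ J) : v + k ∈ coneDiff J T := by
  refine coneDiff_add hJ hT hv ?_
  obtain ⟨x, hx, y, hy, h⟩ := vectorSpan_subset_coneDiff hJ hne hk
  exact ⟨x, hx, y, hJT hy, h⟩

end coneDiff

/-- A linear functional that is non-positive on a set and vanishes at an interior point is zero. -/
lemma eq_zero_of_nonpos_of_interior {E : Type*} [NormedAddCommGroup E] [NormedSpace ℝ E]
    {W : Set E} {l : E →L[ℝ] ℝ} (hl : ∀ w ∈ W, l w ≤ 0) {v : E} (hv : v ∈ interior W)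
    (h0 : 0 ≤ l v) : l = 0 := by
  have key : ∀ u, l u ≤ 0 := by
    intro u
    have hc : ContinuousAt (fun t : ℝ => v + t • u) 0 := by fun_prop
    have hev : ∀ᶠ t : ℝ in nhds 0, v + t • u ∈ W :=
      hc.eventually_mem (by simpa using mem_interior_iff_mem_nhds.1 hv)
    obtain ⟨ε, hε, hball⟩ := Metric.eventually_nhds_iff.1 hev
    have h1 := hl _ (@hball (ε / 2) (by rw [Real.dist_eq, sub_zero, abs_of_pos] <;> linarith))
    rw [map_add, map_smul, smul_eq_mul] at h1
    nlinarith
  ext u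
  have h1 := key u
  have h2 := key (-u)
  rw [map_neg] at h2
  simp only [_root_.zero_apply]
  linarith

/-- The exposing functional is constant on `F`, so it vanishes as soon as `F` has interior, and then
it exposes all of `P`. -/
lemma IsFace.eq_of_interior {n : ℕ} {P F : Set (Fin n → ℝ)} (h : IsFace P F)
    (hne : (interior F).Nonempty) : F = P := by
  obtain ⟨l, hl⟩ := h.2 h.1
  obtain ⟨x, hx⟩ := hne
  have hxF : x ∈ F := interior_subset hx
  have hmax : ∀ y ∈ P, l y ≤ l x := by rw [hl] at hxF; exact hxF.2
  have hl0 : l = 0 := by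
    have hx' : x - x ∈ interior ((fun y => y - x) '' F) := by
      have := (Homeomorph.subRight x).image_interior F
      simp only [Homeomorph.coe_subRight] at this
      rw [← this]
      exact ⟨x, hx, rfl⟩
    refine eq_zero_of_nonpos_of_interior ?_ hx' (by simp)
    rintro _ ⟨y, hy, rfl⟩
    have hyP : y ∈ P := by rw [hl] at hy; exact hy.1
    rw [map_sub]
    linarith [hmax y hyP]
  rw [hl, hl0]
  ext y
  simp

/-! ### The cells of a polyhedral complex -/

namespace PolyhedralComplex

variable {n : ℕ} (X : PolyhedralComplex n)

/-- The part of a subset of `B` in a maximal cell, in the chart of this cell. -/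
def part (σ : X.MaxCell) (T : Set X.Pt) : Set (Fin n → ℝ) := {x ∈ X.poly σ | X.toB σ x ∈ T}

lemma wedge_eq (𝔧 T : Set X.Pt) (σ : X.MaxCell) :
    X.wedge 𝔧 T σ = coneDiff (X.part σ 𝔧) (X.part σ T) := by
  ext v
  constructor
  · rintro ⟨x, hx, y, hy, hx', hy', s, hs, rfl⟩
    exact ⟨x, ⟨hx, hx'⟩, y, ⟨hy, hy'⟩, s, hs, rfl⟩
  · rintro ⟨x, hx, y, hy, s, hs, rfl⟩
    exact ⟨x, hx.1, y, hy.1, hx.2, hy.2, s, hs, rfl⟩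

lemma part_univ (σ : X.MaxCell) : X.part σ Set.univ = X.poly σ := by
  ext x; simp [part]

lemma part_image (σ : X.MaxCell) {P : Set (Fin n → ℝ)} (hP : P ⊆ X.poly σ) :
    X.part σ (X.toB σ '' P) = P := by
  ext x
  constructor
  · rintro ⟨hx, y, hy, hxy⟩
    rwa [← X.injOn σ (hP hy) hx hxy]
  · exact fun hx => ⟨hP hx, x, hx, rfl⟩

lemma convex_poly (σ : X.MaxCell) : Convex ℝ (X.poly σ) := (X.isIntegral σ).1.convex

/-- By injectivity of `toB` on each polyhedron, the faces provided by `inter_face` can only be the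
full parts of the intersection. -/
lemma exists_affine (σ σ' : X.MaxCell) (h : (X.cellSet σ ∩ X.cellSet σ').Nonempty) :
    IsFace (X.poly σ) (X.part σ (X.cellSet σ')) ∧ IsFace (X.poly σ') (X.part σ' (X.cellSet σ)) ∧
    ∃ (g : GL (Fin n) ℤ) (b : Fin n → ℤ), ∀ x ∈ X.part σ (X.cellSet σ'),
      realMul g.1 x + toReal b ∈ X.part σ' (X.cellSet σ) ∧
        X.toB σ' (realMul g.1 x + toReal b) = X.toB σ x := by
  obtain ⟨F, F', g, b, hF, hF', e, e', H⟩ := X.inter_face σ σ' h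
  have h1 : ∀ (τ τ' : X.MaxCell) (G : Set (Fin n → ℝ)), IsFace (X.poly τ) G →
      X.toB τ '' G = X.cellSet τ ∩ X.cellSet τ' → X.part τ (X.cellSet τ') = G := by
    intro τ τ' G hG hi
    rw [← X.part_image τ hG.2.subset, hi]
    ext x
    exact ⟨fun hx => ⟨hx.1, ⟨x, hx.1, rfl⟩, hx.2⟩, fun hx => ⟨hx.1, hx.2.2⟩⟩
  have h2 := h1 σ σ' F hF e
  have h3 := h1 σ' σ F' hF' (by rw [e', Set.inter_comm]; rfl)
  rw [h2, h3]
  exact ⟨hF, hF', g, b, H⟩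

lemma convex_part_cellSet (σ σ' : X.MaxCell) : Convex ℝ (X.part σ (X.cellSet σ')) := by
  by_cases h : (X.cellSet σ ∩ X.cellSet σ').Nonempty
  · exact (X.exists_affine σ σ' h).1.2.convex (X.convex_poly σ)
  · have : X.part σ (X.cellSet σ') = ∅ := by
      by_contra hne
      obtain ⟨x, hx⟩ := Set.nonempty_iff_ne_empty.2 hne
      exact h ⟨_, ⟨x, hx.1, rfl⟩, hx.2⟩
    rw [this]
    exact convex_empty

/-- Corresponding points of two maximal cells are related by an integral affine map. -/
lemma exists_transition (σ σ' : X.MaxCell) : ∃ (g : GL (Fin n) ℤ) (b : Fin n → ℤ),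
    ∀ x ∈ X.poly σ, ∀ x' ∈ X.poly σ', X.toB σ x = X.toB σ' x' → x' = realMul g.1 x + toReal b := by
  by_cases h : (X.cellSet σ ∩ X.cellSet σ').Nonempty
  · obtain ⟨-, -, g, b, H⟩ := X.exists_affine σ σ' h
    refine ⟨g, b, fun x hx x' hx' hxx' => ?_⟩
    obtain ⟨h1, h2⟩ := H x ⟨hx, x', hx', hxx'.symm⟩
    exact X.injOn σ' hx' h1.1 (by rw [h2, hxx'])
  · exact ⟨1, 0, fun x hx x' hx' hxx' => (h ⟨_, ⟨x, hx, rfl⟩, x', hx', hxx'.symm⟩).elim⟩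

/-- A subset of a maximal cell, seen in another one. -/
lemma part_eq_image {σ τ : X.MaxCell} {P : Set (Fin n → ℝ)} (hP : P ⊆ X.poly τ)
    (hσ : X.toB τ '' P ⊆ X.cellSet σ) : ∃ (g : GL (Fin n) ℤ) (b : Fin n → ℤ),
      X.part σ (X.toB τ '' P) = (fun x => realMul g.1 x + toReal b) '' P := by
  obtain ⟨g, b, H⟩ := X.exists_transition τ σ
  refine ⟨g, b, ?_⟩
  ext x'
  constructor
  · rintro ⟨hx', x, hx, hxx'⟩
    exact ⟨x, hx, (H x (hP hx) x' hx' hxx').symm⟩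
  · rintro ⟨x, hx, rfl⟩
    obtain ⟨x', hx', hxx'⟩ := hσ ⟨x, hx, rfl⟩
    have := H x (hP hx) x' hx' hxx'.symm
    simp only
    rw [← this]
    exact ⟨hx', x, hx, hxx'.symm⟩

/-- An integral affine map. -/
def affMap (g : GL (Fin n) ℤ) (b : Fin n → ℤ) : (Fin n → ℝ) →ᵃ[ℝ] (Fin n → ℝ) where
  toFun x := realMul g.1 x + toReal b
  linear := (realMulL g.1 : (Fin n → ℝ) →ₗ[ℝ] (Fin n → ℝ))
  map_vadd' p v := by
    simp only [vadd_eq_add, realMul_eq, map_add]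
    change _ = realMulL g.1 v + _
    abel

lemma convex_affine_image {P : Set (Fin n → ℝ)} (hP : Convex ℝ P) (g : GL (Fin n) ℤ)
    (b : Fin n → ℤ) : Convex ℝ ((fun x => realMul g.1 x + toReal b) '' P) :=
  hP.affine_image (affMap g b)

lemma finrank_vectorSpan_affine_image (P : Set (Fin n → ℝ)) (g : GL (Fin n) ℤ) (b : Fin n → ℤ) :
    Module.finrank ℝ (vectorSpan ℝ ((fun x => realMul g.1 x + toReal b) '' P)) =
      Module.finrank ℝ (vectorSpan ℝ P) := by
  have h1 : vectorSpan ℝ ((fun x => realMul g.1 x + toReal b) '' P) =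
      (vectorSpan ℝ P).map (affMap g b).linear := (affMap g b).map_vectorSpan.symm
  rw [h1]
  exact (LinearEquiv.finrank_eq (Submodule.equivMapOfInjective _ (realMul_injective g) _)).symm

/-- A maximal cell contained in another one is equal to it. -/
lemma eq_of_part_eq {σ τ : X.MaxCell} (h : X.part σ (X.cellSet τ) = X.poly σ) : σ = τ := by
  have hne : (X.poly σ).Nonempty := (X.full_dim σ).mono interior_subset
  have hsub : X.cellSet σ ⊆ X.cellSet τ := by
    rintro _ ⟨x, hx, rfl⟩
    rw [← h] at hx
    exact hx.2
  have hi : (X.cellSet σ ∩ X.cellSet τ).Nonempty := by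
    obtain ⟨x, hx⟩ := hne
    exact ⟨X.toB σ x, ⟨x, hx, rfl⟩, hsub ⟨x, hx, rfl⟩⟩
  obtain ⟨-, hF', g, b, H⟩ := X.exists_affine σ τ hi
  have hopen : IsOpen ((fun x => realMul g.1 x + toReal b) '' interior (X.poly σ)) := by
    have h1 : (fun x => realMul g.1 x + toReal b) '' interior (X.poly σ) =
        Homeomorph.addRight (toReal b) '' (realMulL g.1 '' interior (X.poly σ)) := by
      rw [Set.image_image]; rfl
    rw [h1]
    exact (Homeomorph.addRight _).isOpenMap _
      ((realMulL g.1).isOpenMap (realMul_surjective g) _ isOpen_interior)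
  -- The affine image of the interior of `σ` is open in the chart of `τ`, so the common face has
  -- interior in `τ` and is all of `τ`.
  have h2 : (interior (X.part τ (X.cellSet σ))).Nonempty := by
    obtain ⟨x, hx⟩ := X.full_dim σ
    refine ⟨_, interior_maximal ?_ hopen ⟨x, hx, rfl⟩⟩
    rintro _ ⟨y, hy, rfl⟩
    exact (H y (by rw [h]; exact interior_subset hy)).1
  have h3 := hF'.eq_of_interior h2
  refine X.cell_inj σ τ (Set.Subset.antisymm hsub ?_)
  rintro _ ⟨x, hx, rfl⟩
  rw [← h3] at hx
  exact hx.2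

end PolyhedralComplex

namespace WallStructure

variable {n : ℕ} {X : PolyhedralPseudomanifold n} {A : Type*} [CommRing A] {L : Type*}
  [AddCommGroup L] {Q : AddSubmonoid L} {φ : ConvexMPA X Q} {I : Ideal (BaseRing A Q)}
  {F : SlabFunctions φ I} {S : WallStructure F} {𝔧 : Set X.Pt}

/-! ### The fan of a plane chart -/

section Fan

variable (C : S.PlaneChart 𝔧)

/-- The rays of a plane chart, including the two boundary rays. -/
def PlaneChart.edge : ℕ → Fin 2 → ℝ
  | 0 => ![-1, 0]
  | i + 1 => if h : i < C.r then toReal (C.ray ⟨i, h⟩) else toReal ![C.a, C.b]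

lemma PlaneChart.edge_ray (j : Fin C.r) : C.edge (j + 1) = toReal (C.ray j) := by
  simp [PlaneChart.edge]

lemma PlaneChart.edge_last : C.edge (C.r + 1) = toReal ![C.a, C.b] := by
  simp [PlaneChart.edge]

lemma PlaneChart.ray_ne_zero (j : Fin C.r) : toReal (C.ray j) ≠ 0 := by
  rw [Ne, toReal_eq_zero]
  intro h
  have := C.primitive j
  rw [h] at this
  exact not_isCoprime_zero_zero this

lemma PlaneChart.last_ne_zero : toReal ![C.a, C.b] ≠ 0 := by
  rw [Ne, toReal_eq_zero]
  intro h
  have h1 := congrFun h 0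
  simp at h1
  exact C.a_pos.ne' h1

/-- The direction `(1, λ)` for each entry of a slope sequence. -/
def slopeVec {r : ℕ} (lam : Fin (r + 1) → ℚ) (k : ℕ) : Fin 2 → ℝ :=
  if h : k < r + 1 then ![1, (lam ⟨k, h⟩ : ℝ)] else 0

/-- A sequence extended by zero. -/
def extendFin {r : ℕ} {α : Type*} [Zero α] (f : Fin r → α) (k : ℕ) : α :=
  if h : k < r then f ⟨k, h⟩ else 0

variable {C}

/-- The recursion for the slopes is the bending rule divided by its first coordinate, `b_j - a_j
λ_j` being the determinant of `(1, λ_j)` and the ray. Wall `j` has edge number `j + 1`, because edge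
`0` is the boundary ray. -/
lemma PlaneChart.isConvexFan {δ : Fin C.r → ℤ} {lam : Fin (C.r + 1) → ℚ}
    (hs : C.IsSlopeSequence δ lam)
    (hc : ![1, (lam (Fin.last C.r) : ℝ)] ∉ interior C.cone) :
    IsConvexFan C.r C.edge (slopeVec lam) (extendFin δ)
      (extendFin fun j => ((1 + ((C.ray j 1 : ℚ) - C.ray j 0 * lam j.castSucc) * δ j * C.ray j 0 : ℚ) :
        ℝ)) where
  first := rfl
  ne_zero i := by
    rcases i with _ | i
    · intro h
      have := congrFun h 0
      simp [PlaneChart.edge] at this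
    · simp only [PlaneChart.edge]
      split_ifs with h
      · exact C.ray_ne_zero _
      · exact C.last_ne_zero
  lt i hi := by
    have hpi := Real.pi_pos
    have hab : planeArg (toReal ![C.a, C.b]) < Real.pi := by
      have := (abs_planeArg_lt_of_pos (x := toReal ![C.a, C.b])
        (by simp [toReal]; exact C.a_pos)).2
      linarith
    rcases i with _ | i
    · have h0 : planeArg (C.edge 0) = Real.pi := Complex.arg_eq_pi_iff.2
        ⟨by simp [PlaneChart.edge], by simp [PlaneChart.edge]⟩
      rw [h0]
      simp only [PlaneChart.edge]
      split_ifs with h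
      · exact (C.ray_mem _).2
      · exact hab
    · simp only [PlaneChart.edge]
      rw [dif_pos (show i < C.r by omega)]
      split_ifs with h
      · exact C.clockwise _ _ (by simp [Fin.lt_def])
      · exact (C.ray_mem _).1
  last := by
    rw [C.edge_last]
    simp [toReal]; exact C.a_pos
  w_first := by
    have := hs.1
    simp only [slopeVec, Nat.succ_pos', dif_pos]
    rw [show (⟨0, Nat.succ_pos'⟩ : Fin (C.r + 1)) = 0 from rfl, this]
    simp
  w_pos k hk := by
    simp [slopeVec, Nat.lt_succ_of_le hk]
  den_pos k hk := by
    simp only [extendFin, hk, dif_pos]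
    exact_mod_cast (hs.2 ⟨k, hk⟩).1
  bend k hk := by
    obtain ⟨h1, h2⟩ := hs.2 ⟨k, hk⟩
    have e1 : slopeVec lam (k + 1) = ![1, (lam (Fin.succ ⟨k, hk⟩) : ℝ)] := by
      simp [slopeVec, hk]
    have e2 : slopeVec lam k = ![1, (lam (Fin.castSucc ⟨k, hk⟩) : ℝ)] := by
      simp [slopeVec, show k < C.r + 1 by omega]
    have e3 : C.edge (k + 1) = toReal (C.ray ⟨k, hk⟩) := C.edge_ray ⟨k, hk⟩
    rw [e1, e2, e3]
    simp only [extendFin, hk, dif_pos]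
    generalize hj : (⟨k, hk⟩ : Fin C.r) = j at *
    rw [eq_div_iff h1.ne'] at h2
    have h3 : (lam j.succ : ℝ) * ((1 + ((C.ray j 1 : ℚ) - C.ray j 0 * lam j.castSucc) * δ j * C.ray j 0 : ℚ) : ℝ) = (lam j.castSucc + ((C.ray j 1 : ℚ) - C.ray j 0 * lam j.castSucc) * δ j * C.ray j 1 : ℚ) := by
      exact_mod_cast h2
    ext i
    fin_cases i
    · simp [det2, toReal]
      left; left; ring
    · simp [det2, toReal]
      push_cast at h3
      linarith
  conv := by
    -- Otherwise, by continuity of the argument, a whole neighbourhood of the final direction lies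
    -- in the cone.
    by_contra hlt
    push Not at hlt
    refine hc ?_
    have e2 : slopeVec lam C.r = ![1, (lam (Fin.last C.r) : ℝ)] := by
      simp [slopeVec, Fin.last]
    rw [e2, C.edge_last] at hlt
    rw [mem_interior_iff_mem_nhds]
    have hcont : ContinuousAt planeArg ![1, (lam (Fin.last C.r) : ℝ)] := by
      have h1 : ContinuousAt (fun x : Fin 2 → ℝ => (⟨x 0, x 1⟩ : ℂ))
          ![1, (lam (Fin.last C.r) : ℝ)] := by
        have : (fun x : Fin 2 → ℝ => (⟨x 0, x 1⟩ : ℂ)) =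
            fun x => Complex.equivRealProdCLM.symm (x 0, x 1) := rfl
        rw [this]
        fun_prop
      exact ContinuousAt.comp (g := Complex.arg)
        (Complex.continuousAt_arg (by simp [Complex.mem_slitPlane_iff])) h1
    filter_upwards [hcont.eventually_mem (Ioi_mem_nhds hlt)] with x hx
    exact Or.inr (le_of_lt hx)

end Fan

/-! ### The local model at a joint -/

/-- The joint is given as a face of one wall; integral affine transition maps carry convexity and
dimension to every cell containing it. -/
lemma IsJoint.part_props (hj : S.IsJoint 𝔧) {σ : X.MaxCell} (hσ : 𝔧 ⊆ X.cellSet σ) :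
    Convex ℝ (X.part σ 𝔧) ∧ (X.part σ 𝔧).Nonempty ∧
      Module.finrank ℝ (vectorSpan ℝ (X.part σ 𝔧)) + 2 = n := by
  obtain ⟨i, G, hG, hc, rfl⟩ := hj
  have hP : G ⊆ X.poly (S.wall i).cell := hG.2.subset.trans (S.wall i).subset
  obtain ⟨g, b, h⟩ := X.part_eq_image hP hσ
  rw [h]
  refine ⟨PolyhedralComplex.convex_affine_image (hG.2.convex (S.wall i).rational.convex) g b,
    hG.1.image _, ?_⟩
  rw [PolyhedralComplex.finrank_vectorSpan_affine_image]
  exact hc.2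

lemma convex_part_carrier (i : S.ι) {σ : X.MaxCell} (hσ : (S.wall i).carrier ⊆ X.cellSet σ) :
    Convex ℝ (X.part σ (S.wall i).carrier) := by
  obtain ⟨g, b, h⟩ := X.part_eq_image (S.wall i).subset hσ
  rw [Wall.carrier, h]
  exact PolyhedralComplex.convex_affine_image (S.wall i).rational.convex g b

variable (C : S.PlaneChart 𝔧)

/-- The linear map to the plane on the wedge of a maximal cell. -/
def PlaneChart.D (σ : X.MaxCell) : (Fin n → ℝ) →L[ℝ] (Fin 2 → ℝ) := realMulL (C.dev σ)

lemma PlaneChart.D_toReal (σ : X.MaxCell) (v : Fin n → ℤ) :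
    C.D σ (toReal v) = toReal (C.dev σ *ᵥ v) := realMul_toReal _ _

variable {C}

lemma PlaneChart.D_surjective {σ : X.MaxCell} (hσ : 𝔧 ⊆ X.cellSet σ) :
    Function.Surjective (C.D σ) := by
  intro y
  obtain ⟨v, hv⟩ := C.surjective σ hσ ![1, 0]
  obtain ⟨w, hw⟩ := C.surjective σ hσ ![0, 1]
  refine ⟨y 0 • toReal v + y 1 • toReal w, ?_⟩
  simp only at hv hw
  rw [map_add, map_smul, map_smul, C.D_toReal, C.D_toReal, hv, hw]
  ext i
  fin_cases i <;> simp [toReal]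

/-- The chart kills the directions of the joint, and both spaces have dimension `n - 2` since the
chart is surjective. -/
lemma PlaneChart.ker_D (hj : S.IsJoint 𝔧) {σ : X.MaxCell} (hσ : 𝔧 ⊆ X.cellSet σ) :
    vectorSpan ℝ (X.part σ 𝔧) = LinearMap.ker (C.D σ : (Fin n → ℝ) →ₗ[ℝ] (Fin 2 → ℝ)) := by
  obtain ⟨-, -, hr⟩ := hj.part_props hσ
  refine Submodule.eq_of_le_of_finrank_eq ?_ ?_
  · refine Submodule.span_le.2 ?_
    rintro v ⟨y, hy, x, hx, rfl⟩
    refine C.joint σ hσ _ ?_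
    rw [X.wedge_eq]
    exact ⟨x, hx, y, hy, 1, zero_le_one, by rw [one_smul]; rfl⟩
  · have h1 := LinearMap.finrank_range_add_finrank_ker
      (C.D σ : (Fin n → ℝ) →ₗ[ℝ] (Fin 2 → ℝ))
    rw [LinearMap.range_eq_top.2 (PlaneChart.D_surjective hσ), finrank_top] at h1
    simp at h1
    omega

lemma PlaneChart.mem_wedge_joint_iff (hj : S.IsJoint 𝔧) {σ : X.MaxCell} (hσ : 𝔧 ⊆ X.cellSet σ)
    {v : Fin n → ℝ} : v ∈ X.wedge 𝔧 𝔧 σ ↔ C.D σ v = 0 := by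
  constructor
  · exact C.joint σ hσ v
  · intro h
    obtain ⟨h1, h2, -⟩ := hj.part_props hσ
    rw [X.wedge_eq]
    refine vectorSpan_subset_coneDiff h1 h2 ?_
    rw [PlaneChart.ker_D hj hσ]
    exact h

/-- The cone is a union of fibres of `D`, being stable under translation by the kernel. Membership
in wedges can therefore be tested in the plane. -/
lemma PlaneChart.mem_coneDiff_iff (hj : S.IsJoint 𝔧) {σ : X.MaxCell} (hσ : 𝔧 ⊆ X.cellSet σ)
    {T : Set (Fin n → ℝ)} (hT : Convex ℝ T) (hJT : X.part σ 𝔧 ⊆ T) {v : Fin n → ℝ} :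
    v ∈ coneDiff (X.part σ 𝔧) T ↔ C.D σ v ∈ C.D σ '' coneDiff (X.part σ 𝔧) T := by
  refine ⟨fun h => ⟨v, h, rfl⟩, ?_⟩
  rintro ⟨w, hw, hwv⟩
  obtain ⟨h1, h2, -⟩ := hj.part_props hσ
  have hk : v - w ∈ vectorSpan ℝ (X.part σ 𝔧) := by
    rw [PlaneChart.ker_D (C := C) hj hσ, LinearMap.mem_ker]
    change C.D σ (v - w) = 0
    rw [map_sub, hwv, sub_self]
  have := coneDiff_add_vectorSpan h1 hT h2 hJT hw hk
  rwa [add_sub_cancel] at this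

lemma PlaneChart.mem_wedge_univ_iff (hj : S.IsJoint 𝔧) {σ : X.MaxCell} (hσ : 𝔧 ⊆ X.cellSet σ)
    {v : Fin n → ℝ} : v ∈ X.wedge 𝔧 Set.univ σ ↔ C.D σ v ∈ C.D σ '' X.wedge 𝔧 Set.univ σ := by
  rw [X.wedge_eq]
  refine PlaneChart.mem_coneDiff_iff (T := X.part σ Set.univ) hj hσ ?_ (fun x hx => ⟨hx.1, trivial⟩)
  rw [X.part_univ]
  exact X.convex_poly σ

lemma convex_wedge_univ (hj : S.IsJoint 𝔧) {σ : X.MaxCell} (hσ : 𝔧 ⊆ X.cellSet σ) :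
    Convex ℝ (X.wedge 𝔧 Set.univ σ) := by
  rw [X.wedge_eq, X.part_univ]
  exact convex_coneDiff (hj.part_props hσ).1 (X.convex_poly σ)

lemma interior_wedge_nonempty (hj : S.IsJoint 𝔧) {σ : X.MaxCell} (hσ : 𝔧 ⊆ X.cellSet σ) :
    (interior (X.wedge 𝔧 Set.univ σ)).Nonempty := by
  obtain ⟨x, hx⟩ := (hj.part_props hσ).2.1
  obtain ⟨y, hy⟩ := X.full_dim σ
  have hopen : IsOpen (Homeomorph.subRight x '' interior (X.poly σ)) :=
    (Homeomorph.subRight x).isOpenMap _ isOpen_interior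
  refine ⟨_, interior_maximal ?_ hopen ⟨y, hy, rfl⟩⟩
  rintro _ ⟨z, hz, rfl⟩
  exact ⟨x, hx.1, z, interior_subset hz, hx.2, trivial, 1, zero_le_one, by simp⟩

lemma PlaneChart.ray_subset (C : S.PlaneChart 𝔧) (j : Fin C.r) : 𝔧 ⊆ (S.wall (C.wall j)).carrier :=
  (C.wall j).2

lemma PlaneChart.mem_wedge_wall_iff (hj : S.IsJoint 𝔧) {σ : X.MaxCell} (hσ : 𝔧 ⊆ X.cellSet σ)
    {j : Fin C.r} (hjσ : (S.wall (C.wall j)).carrier ⊆ X.cellSet σ) {v : Fin n → ℝ} :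
    v ∈ X.wedge 𝔧 (S.wall (C.wall j)).carrier σ ↔
      ∃ s : ℝ, 0 ≤ s ∧ C.D σ v = s • toReal (C.ray j) := by
  have h1 := C.ray_eq j σ hjσ
  have h2 := PlaneChart.mem_coneDiff_iff (C := C) hj hσ (convex_part_carrier (C.wall j).1 hjσ)
    (fun x hx => ⟨hx.1, C.ray_subset j hx.2⟩) (v := v)
  rw [X.wedge_eq] at h1 ⊢
  rw [h2]
  change C.D σ v ∈ realMul (C.dev σ) '' _ ↔ _
  rw [h1]
  rfl

/-- A wall that meets the interior of the wedge of a maximal cell is contained in this cell. -/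
lemma carrier_subset_of_mem_interior (hj : S.IsJoint 𝔧) {σ : X.MaxCell} (hσ : 𝔧 ⊆ X.cellSet σ)
    {i : S.ι} (hi : 𝔧 ⊆ (S.wall i).carrier) {v : Fin n → ℝ}
    (hv : v ∈ interior (X.wedge 𝔧 Set.univ σ)) (hvi : v ∈ X.wedge 𝔧 (S.wall i).carrier σ) :
    (S.wall i).carrier ⊆ X.cellSet σ := by
  set τ := (S.wall i).cell with hτ
  have hcar : (S.wall i).carrier ⊆ X.cellSet τ := by
    rintro _ ⟨x, hx, rfl⟩
    exact ⟨x, (S.wall i).subset hx, rfl⟩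
  obtain ⟨x₀, hx₀⟩ := (hj.part_props hσ).2.1
  have hmeet : (X.cellSet σ ∩ X.cellSet τ).Nonempty :=
    ⟨X.toB σ x₀, ⟨x₀, hx₀.1, rfl⟩, hcar (hi hx₀.2)⟩
  obtain ⟨hF, -, -⟩ := X.exists_affine σ τ hmeet
  -- The functional exposing `σ ∩ τ` is non-positive on the wedge of `σ` and non-negative at `v`,
  -- because the wall lies in `τ`. As `v` is interior, it vanishes and the face is all of `σ`.
  obtain ⟨l, hl⟩ := hF.2 hF.1
  have hJF : X.part σ 𝔧 ⊆ X.part σ (X.cellSet τ) := fun x hx => ⟨hx.1, hcar (hi hx.2)⟩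
  have hmax : ∀ x ∈ X.part σ (X.cellSet τ), ∀ y ∈ X.poly σ, l y ≤ l x := by
    intro x hx; rw [hl] at hx; exact hx.2
  have hl0 : l = 0 := by
    refine eq_zero_of_nonpos_of_interior (W := X.wedge 𝔧 Set.univ σ) ?_ hv ?_
    · rintro _ ⟨x, hx, y, hy, hx', -, s, hs, rfl⟩
      rw [map_smul, map_sub, smul_eq_mul]
      exact mul_nonpos_of_nonneg_of_nonpos hs (by linarith [hmax x (hJF ⟨hx, hx'⟩) y hy])
    · obtain ⟨x, hx, y, hy, hx', hy', s, hs, rfl⟩ := hvi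
      rw [map_smul, map_sub, smul_eq_mul]
      exact mul_nonneg hs (by linarith [hmax y ⟨hy, hcar hy'⟩ x hx])
  have hpart : X.part σ (X.cellSet τ) = X.poly σ := by
    rw [hl, hl0]; ext y; simp
  rw [X.eq_of_part_eq hpart]
  exact hcar

lemma PlaneChart.isOpenMap_D {σ : X.MaxCell} (hσ : 𝔧 ⊆ X.cellSet σ) : IsOpenMap (C.D σ) :=
  (C.D σ).isOpenMap (PlaneChart.D_surjective hσ)

lemma PlaneChart.preimage_interior (hj : S.IsJoint 𝔧) {σ : X.MaxCell} (hσ : 𝔧 ⊆ X.cellSet σ) :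
    interior (X.wedge 𝔧 Set.univ σ) =
      C.D σ ⁻¹' interior (C.D σ '' X.wedge 𝔧 Set.univ σ) := by
  rw [(PlaneChart.isOpenMap_D hσ).preimage_interior_eq_interior_preimage (C.D σ).continuous]
  congr 1
  ext v
  exact PlaneChart.mem_wedge_univ_iff hj hσ

lemma PlaneChart.image_interior (hj : S.IsJoint 𝔧) {σ : X.MaxCell} (hσ : 𝔧 ⊆ X.cellSet σ) :
    C.D σ '' interior (X.wedge 𝔧 Set.univ σ) = interior (C.D σ '' X.wedge 𝔧 Set.univ σ) := by
  rw [PlaneChart.preimage_interior (C := C) hj hσ,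
    Set.image_preimage_eq _ (PlaneChart.D_surjective hσ)]

/-- Wedges of distinct cells do not overlap. -/
lemma PlaneChart.disjoint_interior (hj : S.IsJoint 𝔧) {σ σ' : X.MaxCell} (hσ : 𝔧 ⊆ X.cellSet σ)
    (hσ' : 𝔧 ⊆ X.cellSet σ') {x : Fin 2 → ℝ} (hx : x ∈ interior (C.D σ '' X.wedge 𝔧 Set.univ σ))
    (hx' : x ∈ interior (C.D σ' '' X.wedge 𝔧 Set.univ σ')) : σ = σ' := by
  by_contra hne
  rw [← PlaneChart.image_interior hj hσ] at hx
  rw [← PlaneChart.image_interior hj hσ'] at hx'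
  exact Set.disjoint_left.1 (C.disjoint σ σ' hσ hσ' hne) hx hx'

/-- A wall whose ray meets the interior of the wedge of a maximal cell lies in this cell. -/
lemma PlaneChart.carrier_subset_of_ray_mem (hj : S.IsJoint 𝔧) {σ : X.MaxCell}
    (hσ : 𝔧 ⊆ X.cellSet σ) {j : Fin C.r} {s : ℝ} (hs : 0 ≤ s)
    (hx : s • toReal (C.ray j) ∈ interior (C.D σ '' X.wedge 𝔧 Set.univ σ)) :
    (S.wall (C.wall j)).carrier ⊆ X.cellSet σ := by
  set τ := (S.wall (C.wall j)).cell with hτ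
  have hcar : (S.wall (C.wall j)).carrier ⊆ X.cellSet τ := by
    rintro _ ⟨x, hx, rfl⟩
    exact ⟨x, (S.wall (C.wall j)).subset hx, rfl⟩
  have hjτ : 𝔧 ⊆ X.cellSet τ := (C.ray_subset j).trans hcar
  have h1 : s • toReal (C.ray j) ∈ C.D τ '' X.wedge 𝔧 Set.univ τ := by
    have h2 : s • toReal (C.ray j) ∈ C.D τ '' X.wedge 𝔧 (S.wall (C.wall j)).carrier τ := by
      change _ ∈ realMul (C.dev τ) '' _
      rw [C.ray_eq j τ hcar]
      exact ⟨s, hs, rfl⟩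
    obtain ⟨v, ⟨x, hx, y, hy, hx', hy', h⟩, hv⟩ := h2
    exact ⟨v, ⟨x, hx, y, hy, hx', trivial, h⟩, hv⟩
  have hconv : Convex ℝ (C.D τ '' X.wedge 𝔧 Set.univ τ) :=
    (convex_wedge_univ hj hjτ).linear_image (C.D τ : (Fin n → ℝ) →ₗ[ℝ] (Fin 2 → ℝ))
  have hne : (interior (C.D τ '' X.wedge 𝔧 Set.univ τ)).Nonempty := by
    rw [← PlaneChart.image_interior hj hjτ]
    exact (interior_wedge_nonempty hj hjτ).image _
  -- A convex set with interior lies in the closure of its interior, so near the given point the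
  -- interiors of both wedges meet, and the two cells agree.
  have h3 : s • toReal (C.ray j) ∈ closure (interior (C.D τ '' X.wedge 𝔧 Set.univ τ)) := by
    rw [hconv.closure_interior_eq_closure_of_nonempty_interior hne]
    exact subset_closure h1
  obtain ⟨y, hy1, hy2⟩ := mem_closure_iff.1 h3 _ isOpen_interior hx
  rw [PlaneChart.disjoint_interior hj hσ hjτ hy1 hy2]
  exact hcar

end WallStructure

/-- The ray with number `j` bounds the sector with number `k`, which lies on the side of sign `ε`
of this ray. -/
def Side (j k : ℕ) (ε : ℤ) : Prop := (k = j ∧ ε = 1) ∨ (k = j + 1 ∧ ε = -1)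

lemma Side.det2_pos {j k : ℕ} {ε : ℤ} (h : Side j k ε) {e : ℕ → Fin 2 → ℝ} {x : Fin 2 → ℝ}
    (hx : x ∈ sector e k) : 0 < ε * det2 (e (j + 1)) x := by
  rcases h with ⟨rfl, rfl⟩ | ⟨rfl, rfl⟩
  · simpa using hx.2
  · have := hx.1
    push_cast
    linarith

lemma Side.sign_eq {j k : ℕ} {ε ε' : ℤ} (h : Side j k ε) (h' : Side j k ε') : ε = ε' := by
  rcases h with ⟨h1, rfl⟩ | ⟨h1, rfl⟩ <;> rcases h' with ⟨h2, rfl⟩ | ⟨h2, rfl⟩ <;> omega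

lemma Side.index_eq {j k k' : ℕ} {ε : ℤ} (h : Side j k ε) (h' : Side j k' ε) : k = k' := by
  rcases h with ⟨h1, rfl⟩ | ⟨h1, rfl⟩ <;> rcases h' with ⟨h2, h3⟩ | ⟨h2, h3⟩ <;> omega

lemma Side.ray_eq {j j' k : ℕ} {ε : ℤ} (h : Side j k ε) (h' : Side j' k ε) : j = j' := by
  rcases h with ⟨h1, rfl⟩ | ⟨h1, rfl⟩ <;> rcases h' with ⟨h2, h3⟩ | ⟨h2, h3⟩ <;> omega

lemma Side.sq {j k : ℕ} {ε : ℤ} (h : Side j k ε) : ε * ε = 1 := by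
  rcases h with ⟨-, rfl⟩ | ⟨-, rfl⟩ <;> rfl

namespace WallStructure

variable {n : ℕ} {X : PolyhedralPseudomanifold n} {A : Type*} [CommRing A] {L : Type*}
  [AddCommGroup L] {Q : AddSubmonoid L} {φ : ConvexMPA X Q} {I : Ideal (BaseRing A Q)}
  {F : SlabFunctions φ I} {S : WallStructure F} {𝔧 : Set X.Pt} (C : S.PlaneChart 𝔧)

/-! ### The chambers of the local model -/

/-- The image in the plane of the interior of a chamber. -/
def PlaneChart.V (σ : X.MaxCell) (k : ℕ) : Set (Fin 2 → ℝ) :=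
  interior (C.D σ '' X.wedge 𝔧 Set.univ σ) ∩ sector C.edge k

/-- The interior of a chamber. -/
def PlaneChart.Ch (σ : X.MaxCell) (k : ℕ) : Set (Fin n → ℝ) := C.D σ ⁻¹' C.V σ k

variable {C}
variable {w : ℕ → Fin 2 → ℝ} {δ : ℕ → ℤ} {den : ℕ → ℝ}

open scoped Pointwise in
lemma PlaneChart.interior_isOpenCone (hj : S.IsJoint 𝔧) {σ : X.MaxCell} (hσ : 𝔧 ⊆ X.cellSet σ) :
    IsOpenCone (interior (C.D σ '' X.wedge 𝔧 Set.univ σ)) where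
  isOpen := isOpen_interior
  convex := ((convex_wedge_univ hj hσ).linear_image
    (C.D σ : (Fin n → ℝ) →ₗ[ℝ] (Fin 2 → ℝ))).interior
  smul_mem x h1 c hc := by
    rw [← PlaneChart.image_interior hj hσ] at h1 ⊢
    obtain ⟨v, hv, rfl⟩ := h1
    refine ⟨c • v, ?_, map_smul _ _ _⟩
    have hsub : c • interior (X.wedge 𝔧 Set.univ σ) ⊆ X.wedge 𝔧 Set.univ σ := by
      rintro _ ⟨v, hv, rfl⟩
      have := interior_subset hv
      rw [X.wedge_eq] at this ⊢
      exact coneDiff_smul this hc.le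
    exact interior_maximal hsub (isOpen_interior.smul₀ hc.ne') ⟨v, hv, rfl⟩

lemma PlaneChart.V_isOpenCone (hj : S.IsJoint 𝔧) {σ : X.MaxCell} (hσ : 𝔧 ⊆ X.cellSet σ) (k : ℕ) :
    IsOpenCone (C.V σ k) where
  isOpen := isOpen_interior.inter (isOpen_sector _ _)
  convex := (PlaneChart.interior_isOpenCone hj hσ).convex.inter (convex_sector _ _)
  smul_mem x hx c hc :=
    ⟨(PlaneChart.interior_isOpenCone hj hσ).smul_mem x hx.1 c hc, smul_mem_sector hx.2 hc⟩

section

variable (hj : S.IsJoint 𝔧) (hF : IsConvexFan C.r C.edge w δ den)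
include hF

lemma PlaneChart.smul_ray_notMem_sector {j : Fin C.r} {k : ℕ} (hk : k ≤ C.r) {s : ℝ} (hs : 0 ≤ s) :
    s • toReal (C.ray j) ∉ sector C.edge k := by
  intro h
  have hs' : 0 < s := by
    refine hs.lt_of_ne ?_
    rintro rfl
    exact IsConvexFan.ne_zero_of_mem_sector h (zero_smul _ _)
  have h1 := smul_mem_sector h (inv_pos.2 hs')
  rw [smul_smul, inv_mul_cancel₀ hs'.ne', one_smul, ← C.edge_ray] at h1
  rcases hF.eq_or_eq_of_mem_closure hk (by omega) (subset_closure h1) with h2 | h2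
  · rw [h2] at h1; simp [sector] at h1
  · rw [← h2] at h1; simp [sector] at h1

lemma PlaneChart.exists_side {σ : X.MaxCell} {j : Fin C.r} {k : ℕ} (hk : k ≤ C.r)
    (h : toReal (C.ray j) ∈ closure (C.V σ k)) : ∃ ε, Side j k ε := by
  rw [← C.edge_ray] at h
  rcases hF.eq_or_eq_of_mem_closure hk (by omega)
    (closure_mono Set.inter_subset_right h) with h1 | h1
  · exact ⟨-1, Or.inr ⟨h1, rfl⟩⟩
  · exact ⟨1, Or.inl ⟨by omega, rfl⟩⟩

include hj

lemma PlaneChart.of_mem_interior {σ : X.MaxCell} (hσ : 𝔧 ⊆ X.cellSet σ) {x : Fin 2 → ℝ}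
    (hx : x ∈ interior (C.D σ '' X.wedge 𝔧 Set.univ σ))
    (hr : ∀ (j : Fin C.r) (s : ℝ), 0 ≤ s → (S.wall (C.wall j)).carrier ⊆ X.cellSet σ →
      x ≠ s • toReal (C.ray j)) : ∃ k ≤ C.r, x ∈ C.V σ k := by
  have hsub : C.D σ '' X.wedge 𝔧 Set.univ σ ⊆
      {x | x = 0 ∨ planeArg (C.edge (C.r + 1)) ≤ planeArg x} := by
    rw [C.edge_last, ← C.image]
    exact Set.subset_iUnion₂_of_subset σ hσ subset_rfl
  obtain ⟨h1, h2, h3⟩ := hF.of_mem_interior (interior_mono hsub hx)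
  rcases hF.exists_sector h1 h2 h3 with ⟨k, hk, h4⟩ | ⟨i, hi, h4⟩
  · exact ⟨k, hk, hx, h4⟩
  · exfalso
    obtain ⟨s, hs, h5⟩ := exists_pos_smul_of_planeArg_eq (hF.ne_zero _) h4
    have h6 : x = s • toReal (C.ray ⟨i, hi⟩) := by rw [h5, ← C.edge_ray]
    refine hr ⟨i, hi⟩ s hs ?_ h6
    rw [h6] at hx
    exact PlaneChart.carrier_subset_of_ray_mem hj hσ hs hx

/-- Walls not contained in `σ` do not reach the interior of its wedge, and the walls in `σ` project
to the rays separating the sectors. -/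
lemma PlaneChart.complementAt_eq {σ : X.MaxCell} (hσ : 𝔧 ⊆ X.cellSet σ) :
    S.complementAt 𝔧 σ = ⋃ k ∈ Set.Iic C.r, C.Ch σ k := by
  ext v
  simp only [complementAt, Set.mem_sdiff, Set.mem_iUnion, Set.mem_Iic, exists_prop, not_exists,
    not_and]
  constructor
  · rintro ⟨h1, h2⟩
    rw [PlaneChart.preimage_interior (C := C) hj hσ] at h1
    refine PlaneChart.of_mem_interior hj hF hσ h1 ?_
    intro j s hs hsub heq
    exact h2 _ (C.ray_subset j) ((PlaneChart.mem_wedge_wall_iff hj hσ hsub).2 ⟨s, hs, heq⟩)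
  · rintro ⟨k, hk, hv⟩
    have hv1 : v ∈ interior (X.wedge 𝔧 Set.univ σ) := by
      rw [PlaneChart.preimage_interior (C := C) hj hσ]; exact hv.1
    refine ⟨hv1, fun i hi hvi => ?_⟩
    have hsub := carrier_subset_of_mem_interior hj hσ hi hv1 hvi
    obtain ⟨j, hj'⟩ := C.wall.surjective ⟨i, hi⟩
    have hij : (C.wall j).1 = i := by rw [hj']
    subst hij
    obtain ⟨s, hs, h3⟩ := (PlaneChart.mem_wedge_wall_iff hj hσ hsub).1 hvi
    have h4 := hv.2
    rw [h3] at h4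
    exact PlaneChart.smul_ray_notMem_sector hF hk hs h4

/-- The pieces are convex, open and pairwise disjoint, so they are the connected components. -/
lemma PlaneChart.component_eq {σ : X.MaxCell} (hσ : 𝔧 ⊆ X.cellSet σ) {k : ℕ} (hk : k ≤ C.r)
    {v : Fin n → ℝ} (hv : v ∈ C.Ch σ k) :
    connectedComponentIn (S.complementAt 𝔧 σ) v = C.Ch σ k := by
  have hopen : ∀ k, IsOpen (C.Ch σ k) := fun k =>
    (PlaneChart.V_isOpenCone hj hσ k).isOpen.preimage (C.D σ).continuous
  have hsub : C.Ch σ k ⊆ S.complementAt 𝔧 σ := by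
    rw [PlaneChart.complementAt_eq hj hF hσ]
    exact Set.subset_biUnion_of_mem (u := fun k => C.Ch σ k) hk
  refine Set.Subset.antisymm ?_ ?_
  · refine IsPreconnected.subset_left_of_subset_union (hopen k)
      (isOpen_biUnion (s := {k' | k' ≤ C.r ∧ k' ≠ k}) fun k' _ => hopen k') ?_ ?_
      ⟨v, mem_connectedComponentIn (hsub hv), hv⟩ isPreconnected_connectedComponentIn
    · rw [Set.disjoint_iUnion₂_right]
      rintro k' ⟨hk', hne⟩
      rw [Set.disjoint_left]
      intro x hx hx'
      exact hne (hF.sector_disjoint hk' hk hx'.2 hx.2)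
    · refine (connectedComponentIn_subset _ _).trans ?_
      rw [PlaneChart.complementAt_eq hj hF hσ]
      intro x hx
      obtain ⟨k', hk', hx'⟩ := Set.mem_iUnion₂.1 hx
      by_cases hkk : k' = k
      · left; rwa [← hkk]
      · right; exact Set.mem_iUnion₂.2 ⟨k', ⟨hk', hkk⟩, hx'⟩
  · refine IsPreconnected.subset_connectedComponentIn ?_ hv hsub
    exact ((PlaneChart.V_isOpenCone hj hσ k).convex.linear_preimage
      (C.D σ : (Fin n → ℝ) →ₗ[ℝ] (Fin 2 → ℝ))).isPreconnected

lemma PlaneChart.isChamberAt_iff {σ : X.MaxCell} {u : Set (Fin n → ℝ)} :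
    S.IsChamberAt 𝔧 σ u ↔
      𝔧 ⊆ X.cellSet σ ∧ ∃ k ≤ C.r, (C.V σ k).Nonempty ∧ u = C.Ch σ k := by
  constructor
  · rintro ⟨hσ, v, hv, rfl⟩
    refine ⟨hσ, ?_⟩
    have hv' := hv
    rw [PlaneChart.complementAt_eq hj hF hσ] at hv'
    obtain ⟨k, hk, hvk⟩ := Set.mem_iUnion₂.1 hv'
    exact ⟨k, hk, ⟨_, hvk⟩, PlaneChart.component_eq hj hF hσ hk hvk⟩
  · rintro ⟨hσ, k, hk, ⟨x, hx⟩, rfl⟩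
    refine ⟨hσ, ?_⟩
    obtain ⟨v, rfl⟩ := PlaneChart.D_surjective (C := C) hσ x
    refine ⟨v, ?_, (PlaneChart.component_eq hj hF hσ hk hx).symm⟩
    rw [PlaneChart.complementAt_eq hj hF hσ]
    exact Set.mem_iUnion₂.2 ⟨k, hk, hx⟩

omit hj in
lemma PlaneChart.index_eq_of_Ch_eq {σ : X.MaxCell} (hσ : 𝔧 ⊆ X.cellSet σ) {k k' : ℕ}
    (hk : k ≤ C.r) (hk' : k' ≤ C.r) (hne : (C.V σ k).Nonempty) (h : C.Ch σ k = C.Ch σ k') :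
    k = k' := by
  obtain ⟨x, hx⟩ := hne
  obtain ⟨v, rfl⟩ := PlaneChart.D_surjective (C := C) hσ x
  have h1 : v ∈ C.Ch σ k' := by rw [← h]; exact hx
  exact hF.sector_disjoint hk hk' hx.2 h1.2

omit hF in
/-- Two chambers on the same side of a common ray agree. -/
lemma PlaneChart.cell_eq_of_side {σ σ' : X.MaxCell} (hσ : 𝔧 ⊆ X.cellSet σ)
    (hσ' : 𝔧 ⊆ X.cellSet σ') {j : Fin C.r} {k : ℕ} {ε : ℤ} (hs : Side j k ε)
    (hne : (C.V σ k).Nonempty) (hne' : (C.V σ' k).Nonempty)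
    (h : toReal (C.ray j) ∈ closure (C.V σ k)) (h' : toReal (C.ray j) ∈ closure (C.V σ' k)) :
    σ = σ' := by
  obtain ⟨x, hx⟩ := hne
  obtain ⟨x', hx'⟩ := hne'
  have h1 := hs.det2_pos hx.2
  have h2 := hs.det2_pos hx'.2
  rw [C.edge_ray] at h1 h2
  have h3 : 0 < det2 (toReal (C.ray j)) x * det2 (toReal (C.ray j)) x' := by
    have h4 : (ε : ℝ) * ε = 1 := by exact_mod_cast hs.sq
    have := mul_pos h1 h2
    linear_combination this + (det2 (toReal (C.ray j)) x * det2 (toReal (C.ray j)) x') * h4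
  obtain ⟨y, hy, hy'⟩ := (PlaneChart.V_isOpenCone hj hσ k).inter_nonempty
    (PlaneChart.V_isOpenCone hj hσ' k) (C.ray_ne_zero j) h h' hx hx' h3
  exact PlaneChart.disjoint_interior hj hσ hσ' hy.1 hy'.1

end

/-! ### Points of the local model in different charts -/

/-- The translation parts of the transition map cancel in differences, so one linear map serves all
vectors. -/
lemma SamePoint.exists_eq (S : WallStructure F) (𝔧 : Set X.Pt) (σ σ' : X.MaxCell) :
    ∃ g : GL (Fin n) ℤ, ∀ v v', S.SamePoint 𝔧 σ v σ' v' → v' = realMul g.1 v := by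
  obtain ⟨g, b, H⟩ := X.exists_transition σ σ'
  refine ⟨g, ?_⟩
  rintro v v' ⟨x, hx, y, hy, x', hx', y', hy', -, h1, h2, s, -, rfl, rfl⟩
  rw [H x hx x' hx' h1, H y hy y' hy' h2]
  simp only [realMul_eq, map_smul, map_sub, add_sub_add_right_eq_sub]

lemma SamePoint.unique {σ σ' : X.MaxCell} {v v₁ v₂ : Fin n → ℝ} (h₁ : S.SamePoint 𝔧 σ v σ' v₁)
    (h₂ : S.SamePoint 𝔧 σ v σ' v₂) : v₁ = v₂ := by
  obtain ⟨g, H⟩ := SamePoint.exists_eq S 𝔧 σ σ'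
  rw [H _ _ h₁, H _ _ h₂]

/-- The two identifications may use different base points on the joint and different scales.
Averaging the base points and shortening the vector gives a representative visible in all three
cells. -/
lemma SamePoint.trans (hj : S.IsJoint 𝔧) {σ₀ σ σ' : X.MaxCell} (h₀ : 𝔧 ⊆ X.cellSet σ₀)
    (hσ : 𝔧 ⊆ X.cellSet σ) (h' : 𝔧 ⊆ X.cellSet σ') {m e e' : Fin n → ℝ} (he : e ≠ 0)
    (h₁ : S.SamePoint 𝔧 σ₀ m σ e) (h₂ : S.SamePoint 𝔧 σ e σ' e') : S.SamePoint 𝔧 σ₀ m σ' e' := by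
  obtain ⟨x₀, hx₀, y₀, hy₀, x₁, hx₁, y₁, hy₁, hj₁, hx₀₁, hy₀₁, s, hs, rfl, he₁⟩ := h₁
  obtain ⟨x₂, hx₂, y₂, hy₂, x₃, hx₃, y₃, hy₃, hj₂, hx₂₃, hy₂₃, t, ht, he₂, rfl⟩ := h₂
  have hs' : 0 < s := hs.lt_of_ne (by rintro rfl; simp at he₁; exact he he₁)
  have ht' : 0 < t := ht.lt_of_ne (by rintro rfl; simp at he₂; exact he he₂)
  obtain ⟨g, b, H⟩ := X.exists_transition σ₀ σ
  obtain ⟨g', b', H'⟩ := X.exists_transition σ σ'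
  -- a common representative
  set q := min s⁻¹ t⁻¹ with hq
  have hq0 : 0 < q := lt_min (inv_pos.2 hs') (inv_pos.2 ht')
  have ey₁ : y₁ = x₁ + s⁻¹ • e := by rw [he₁, smul_smul, inv_mul_cancel₀ hs'.ne']; module
  have ey₂ : y₂ = x₂ + t⁻¹ • e := by rw [he₂, smul_smul, inv_mul_cancel₀ ht'.ne']; module
  have hx₁J : x₁ ∈ X.part σ 𝔧 := ⟨hx₁, by rw [← hx₀₁]; exact hj₁⟩
  have hx₂J : x₂ ∈ X.part σ 𝔧 := ⟨hx₂, hj₂⟩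
  have hsub : ∀ τ, 𝔧 ⊆ X.cellSet τ → X.part σ 𝔧 ⊆ X.part σ (X.cellSet τ) :=
    fun τ hτ x hx => ⟨hx.1, hτ hx.2⟩
  set x := (1 / 2 : ℝ) • x₁ + (1 / 2 : ℝ) • x₂ with hxdef
  have hxJ : x ∈ X.part σ 𝔧 :=
    (hj.part_props hσ).1 hx₁J hx₂J (by norm_num) (by norm_num) (by norm_num)
  have hseg : ∀ (T : Set (Fin n → ℝ)) (z : Fin n → ℝ) (a : ℝ), Convex ℝ T → z ∈ T → 0 < a →
      z + a⁻¹ • e ∈ T → q ≤ a⁻¹ → z + q • e ∈ T := by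
    intro T z a hT hz ha hza hqa
    have h1 := hT hz hza (a := 1 - q * a) (b := q * a)
      (by rw [sub_nonneg]; calc q * a ≤ a⁻¹ * a := by gcongr
            _ = 1 := inv_mul_cancel₀ ha.ne') (by positivity) (by ring)
    have h2 : (1 - q * a) • z + (q * a) • (z + a⁻¹ • e) = z + q • e := by
      rw [smul_add, smul_smul, mul_assoc, mul_inv_cancel₀ ha.ne']; module
    rwa [h2] at h1
  -- The midpoint of `x₁ + q • e` and `x₂`, and also of `x₁` and `x₂ + q • e`; these two
  -- descriptions put it in `σ₀` and in `σ'`.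
  set y := x + (q / 2) • e with hydef
  have hy0 : y ∈ X.part σ (X.cellSet σ₀) := by
    have h1 : x₁ + q • e ∈ X.part σ (X.cellSet σ₀) :=
      hseg _ _ s (X.convex_part_cellSet σ σ₀) (hsub _ h₀ hx₁J) hs'
        (by rw [← ey₁]; exact ⟨hy₁, y₀, hy₀, hy₀₁⟩) (min_le_left _ _)
    have h2 := X.convex_part_cellSet σ σ₀ h1 (hsub _ h₀ hx₂J) (a := 1 / 2) (b := 1 / 2)
      (by norm_num) (by norm_num) (by norm_num)
    have h3 : (1 / 2 : ℝ) • (x₁ + q • e) + (1 / 2 : ℝ) • x₂ = y := by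
      rw [hydef, hxdef]; module
    rwa [h3] at h2
  have hy' : y ∈ X.part σ (X.cellSet σ') := by
    have h1 : x₂ + q • e ∈ X.part σ (X.cellSet σ') :=
      hseg _ _ t (X.convex_part_cellSet σ σ') (hsub _ h' hx₂J) ht'
        (by rw [← ey₂]; exact ⟨hy₂, y₃, hy₃, hy₂₃.symm⟩) (min_le_right _ _)
    have h2 := X.convex_part_cellSet σ σ' (hsub _ h' hx₁J) h1 (a := 1 / 2) (b := 1 / 2)
      (by norm_num) (by norm_num) (by norm_num)
    have h3 : (1 / 2 : ℝ) • x₁ + (1 / 2 : ℝ) • (x₂ + q • e) = y := by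
      rw [hydef, hxdef]; module
    rwa [h3] at h2
  obtain ⟨x', hx', hxx'⟩ := h₀ hxJ.2
  obtain ⟨y', hy'0, hyy'⟩ := hy0.2
  obtain ⟨x'', hx'', hxx''⟩ := h' hxJ.2
  obtain ⟨y'', hy'', hyy''⟩ := hy'.2
  refine ⟨x', hx', y', hy'0, x'', hx'', y'', hy'', by rw [hxx']; exact hxJ.2, by rw [hxx', hxx''],
    by rw [hyy', hyy''], 2 / q, by positivity, ?_, ?_⟩
  · have e1 := H x' hx' x hxJ.1 hxx'
    have e2 := H y' hy'0 y hy0.1 hyy'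
    have e3 := H x₀ hx₀ x₁ hx₁ hx₀₁
    have e4 := H y₀ hy₀ y₁ hy₁ hy₀₁
    apply realMul_injective g
    have e5 : realMul g.1 (s • (y₀ - x₀)) = e := by
      rw [he₁, e3, e4]
      simp only [realMul_eq, map_smul, map_sub, add_sub_add_right_eq_sub]
    have e6 : realMul g.1 ((2 / q) • (y' - x')) = (2 / q) • (y - x) := by
      rw [e1, e2]
      simp only [realMul_eq, map_smul, map_sub, add_sub_add_right_eq_sub]
    rw [e5, e6, hydef, add_sub_cancel_left, smul_smul]
    rw [show 2 / q * (q / 2) = 1 by field_simp, one_smul]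
  · rw [H' x hxJ.1 x'' hx'' hxx''.symm, H' y hy'.1 y'' hy'' hyy''.symm,
      H' x₂ hx₂ x₃ hx₃ hx₂₃, H' y₂ hy₂ y₃ hy₃ hy₂₃, add_sub_add_right_eq_sub,
      add_sub_add_right_eq_sub]
    simp only [realMul_eq, ← map_sub, ← map_smul]
    congr 1
    rw [← he₂, hydef, add_sub_cancel_left, smul_smul,
      show 2 / q * (q / 2) = 1 by field_simp, one_smul]

/-! ### Crossing walls -/

lemma Crosses.symm {i : S.ι} {σ σ' : X.MaxCell} (h : S.Crosses 𝔧 i σ σ') :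
    S.Crosses 𝔧 i σ' σ :=
  ⟨h.1, by rw [Set.inter_comm]; exact h.2.1, fun e => h.2.2 e.symm⟩

lemma Crosses.left {i : S.ι} {σ σ' : X.MaxCell} (h : S.Crosses 𝔧 i σ σ') : 𝔧 ⊆ X.cellSet σ :=
  fun _ hx => (h.2.1 (h.1 hx)).1

lemma Crosses.carrier_left {i : S.ι} {σ σ' : X.MaxCell} (h : S.Crosses 𝔧 i σ σ') :
    (S.wall i).carrier ⊆ X.cellSet σ := fun _ hx => (h.2.1 hx).1

lemma Crosses.basePt_mem {i : S.ι} {σ σ' : X.MaxCell} (h : S.Crosses 𝔧 i σ σ') :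
    S.basePt i ∈ X.facetLocus σ σ' := by
  have h1 := (S.wall i).base_mem
  exact ⟨h.2.1 ⟨_, intrinsicInterior_subset h1, rfl⟩, fun hd =>
    Set.disjoint_left.1 (S.wall i).disjoint_disc ⟨_, h1, rfl⟩ hd⟩

lemma transfer_self (i : S.ι) (σ : X.MaxCell) : S.transfer i σ σ = 1 := by
  simp [transfer]

lemma Crosses.transfer_symm {i : S.ι} {σ σ' : X.MaxCell} (h : S.Crosses 𝔧 i σ σ') :
    S.transfer i σ' σ = (S.transfer i σ σ')⁻¹ := by
  by_cases hne : σ = σ'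
  · subst hne; simp [transfer_self]
  · rw [transfer, transfer, if_neg hne, if_neg (Ne.symm hne)]
    exact X.glue_symm σ σ' hne _ h.basePt_mem

lemma kinkFactor_symm (i : S.ι) (σ σ' : X.MaxCell) :
    S.kinkFactor i σ' σ = S.kinkFactor i σ σ' := by
  by_cases h : σ = σ'
  · rw [h]
  · rw [kinkFactor, kinkFactor, if_neg h, if_neg (Ne.symm h)]

lemma Crosses.eq_transfer {i : S.ι} {σ σ' : X.MaxCell} (h : S.Crosses 𝔧 i σ σ')
    {v v' : Fin n → ℝ} (hv : S.SamePoint 𝔧 σ v σ' v') :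
    v' = realMul (S.transfer i σ σ').1 v := by
  obtain ⟨x, hx, y, hy, x', hx', y', hy', -, h1, h2, s, -, rfl, rfl⟩ := hv
  by_cases hne : σ = σ'
  · subst hne
    rw [transfer_self, X.injOn σ hx hx' h1, X.injOn σ hy hy' h2]
    exact (realMul_one _).symm
  · rw [transfer, if_neg hne]
    have := X.glue_tangent σ σ' hne _ h.basePt_mem x hx y hy x' hx' y' hy' h1 h2
    rw [← this]
    simp only [realMul_eq, map_smul]

lemma Crosses.samePoint {i : S.ι} {σ σ' : X.MaxCell} (h : S.Crosses 𝔧 i σ σ')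
    {v : Fin n → ℝ} (hv : v ∈ X.wedge 𝔧 (S.wall i).carrier σ) :
    S.SamePoint 𝔧 σ v σ' (realMul (S.transfer i σ σ').1 v) := by
  obtain ⟨x, hx, y, hy, hxj, hyi, s, hs, rfl⟩ := hv
  obtain ⟨x', hx', hxx'⟩ := h.symm.left hxj
  obtain ⟨y', hy', hyy'⟩ := h.symm.carrier_left hyi
  have h1 : S.SamePoint 𝔧 σ (s • (y - x)) σ' (s • (y' - x')) :=
    ⟨x, hx, y, hy, x', hx', y', hy', hxj, hxx'.symm, hyy'.symm, s, hs, rfl, rfl⟩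
  rw [← h.eq_transfer h1]
  exact h1

lemma Crosses.dev_transfer {i : S.ι} {σ σ' : X.MaxCell} (h : S.Crosses 𝔧 i σ σ') :
    C.dev σ' * (S.transfer i σ σ').1 = C.dev σ := by
  by_cases hne : σ = σ'
  · subst hne; rw [transfer_self]; exact Matrix.mul_one _
  · exact C.compat i σ σ' hne h

lemma Crosses.D_transfer {i : S.ι} {σ σ' : X.MaxCell} (h : S.Crosses 𝔧 i σ σ') (v : Fin n → ℝ) :
    C.D σ' (realMul (S.transfer i σ σ').1 v) = C.D σ v := by
  change realMul _ _ = realMul _ _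
  rw [← realMul_mul, h.dev_transfer (C := C)]

/-! ### Wall normals -/

variable (C)

/-- The primitive normal of a wall, given by the determinant with its ray. -/
def PlaneChart.normal (j : Fin C.r) (σ : X.MaxCell) : Fin n → ℤ :=
  fun i => C.ray j 0 * C.dev σ 1 i - C.ray j 1 * C.dev σ 0 i

lemma PlaneChart.normal_dotProduct (j : Fin C.r) (σ : X.MaxCell) (v : Fin n → ℤ) :
    C.normal j σ ⬝ᵥ v = C.ray j 0 * (C.dev σ *ᵥ v) 1 - C.ray j 1 * (C.dev σ *ᵥ v) 0 := by
  simp only [PlaneChart.normal, dotProduct, Matrix.mulVec, Finset.mul_sum, ← Finset.sum_sub_distrib]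
  refine Finset.sum_congr rfl fun i _ => ?_
  ring

lemma PlaneChart.pair_normal (j : Fin C.r) (σ : X.MaxCell) (x : Fin n → ℝ) :
    pair (C.normal j σ) x = det2 (toReal (C.ray j)) (C.D σ x) := by
  change _ = _ * realMul (C.dev σ) x 1 - _ * realMul (C.dev σ) x 0
  simp only [pair, PlaneChart.normal, realMul, dotProduct, Matrix.mulVec, Finset.mul_sum,
    ← Finset.sum_sub_distrib, Matrix.map_apply]
  refine Finset.sum_congr rfl fun i _ => ?_
  simp only [toReal]
  push_cast
  ring

lemma pair_toReal (ν v : Fin n → ℤ) : pair ν (toReal v) = ((ν ⬝ᵥ v : ℤ) : ℝ) := by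
  simp [pair, toReal, dotProduct]

lemma pair_neg (ν : Fin n → ℤ) (x : Fin n → ℝ) : pair (-ν) x = -pair ν x := by
  simp [pair]

lemma PlaneChart.cast_normal (j : Fin C.r) (σ : X.MaxCell) (v : Fin n → ℤ) :
    ((C.normal j σ ⬝ᵥ v : ℤ) : ℝ) = det2 (toReal (C.ray j)) (C.D σ (toReal v)) := by
  rw [← pair_toReal, C.pair_normal]

lemma PlaneChart.exists_normal_eq_one (j : Fin C.r) {σ : X.MaxCell} (hσ : 𝔧 ⊆ X.cellSet σ) :
    ∃ v, C.normal j σ ⬝ᵥ v = 1 := by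
  obtain ⟨p, q, hpq⟩ := C.primitive j
  obtain ⟨v, hv⟩ := C.surjective σ hσ ![-q, p]
  simp only at hv
  refine ⟨v, ?_⟩
  rw [C.normal_dotProduct, hv]
  simp
  linarith

variable {C}

lemma Crosses.normal_transfer {j : Fin C.r} {σ σ' : X.MaxCell}
    (h : S.Crosses 𝔧 (C.wall j) σ σ') (v : Fin n → ℤ) :
    C.normal j σ' ⬝ᵥ ((S.transfer (C.wall j) σ σ').1 *ᵥ v) = C.normal j σ ⬝ᵥ v := by
  rw [C.normal_dotProduct, C.normal_dotProduct, Matrix.mulVec_mulVec, h.dev_transfer (C := C)]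

lemma PlaneChart.isWallNormal_normal (hj : S.IsJoint 𝔧) {σ : X.MaxCell} {j : Fin C.r}
    (hσ : 𝔧 ⊆ X.cellSet σ) (hjσ : (S.wall (C.wall j)).carrier ⊆ X.cellSet σ) :
    S.IsWallNormal 𝔧 (C.wall j) σ (C.normal j σ) := by
  refine ⟨C.exists_normal_eq_one j hσ, fun x hx => ?_⟩
  obtain ⟨s, -, h⟩ := (PlaneChart.mem_wedge_wall_iff hj hσ hjσ).1 hx
  rw [C.pair_normal, h, det2_smul_right, det2_self, mul_zero]

/-- The kernel of the determinant covector is spanned by the wedge of the wall, so every wall normal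
is an integral multiple of this covector. Primitivity leaves only the signs. -/
lemma PlaneChart.eq_normal_or_eq_neg (hj : S.IsJoint 𝔧) {σ : X.MaxCell} {j : Fin C.r}
    (hσ : 𝔧 ⊆ X.cellSet σ) (hjσ : (S.wall (C.wall j)).carrier ⊆ X.cellSet σ)
    {ν : Fin n → ℤ} (hν : S.IsWallNormal 𝔧 (C.wall j) σ ν) :
    ν = C.normal j σ ∨ ν = -C.normal j σ := by
  have hker : ∀ v, C.normal j σ ⬝ᵥ v = 0 → ν ⬝ᵥ v = 0 := by
    intro v hv
    have h1 : det2 (toReal (C.ray j)) (C.D σ (toReal v)) = 0 := by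
      rw [← C.cast_normal, hv, Int.cast_zero]
    obtain ⟨t, ht⟩ := exists_smul_of_det2_eq_zero (C.ray_ne_zero j) h1
    have h2 : pair ν (toReal v) = 0 := by
      rcases le_total 0 t with h0 | h0
      · exact hν.2 _ ((PlaneChart.mem_wedge_wall_iff hj hσ hjσ).2 ⟨t, h0, ht⟩)
      · have := hν.2 (-toReal v) ((PlaneChart.mem_wedge_wall_iff hj hσ hjσ).2
          ⟨-t, by linarith, by rw [map_neg, ht, neg_smul]⟩)
        simpa [pair] using this
    rw [pair_toReal] at h2
    exact_mod_cast h2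
  obtain ⟨ξ, hξ⟩ := C.exists_normal_eq_one j hσ
  have hall : ∀ v, ν ⬝ᵥ v = (C.normal j σ ⬝ᵥ v) * (ν ⬝ᵥ ξ) := by
    intro v
    have h1 := hker (v - (C.normal j σ ⬝ᵥ v) • ξ) (by
      rw [dotProduct_sub, dotProduct_smul, hξ]; simp)
    rw [dotProduct_sub, dotProduct_smul, smul_eq_mul, sub_eq_zero] at h1
    exact h1
  obtain ⟨v₁, hv₁⟩ := hν.1
  have h2 : ν = (ν ⬝ᵥ ξ) • C.normal j σ := by
    ext i
    have := hall (Pi.single i 1)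
    simp only [dotProduct_single, mul_one] at this
    rw [this, Pi.smul_apply, smul_eq_mul, mul_comm]
  have h3 := hall v₁
  rw [hv₁] at h3
  rcases Int.mul_eq_one_iff_eq_one_or_neg_one.1 h3.symm with ⟨-, h4⟩ | ⟨-, h4⟩
  · left; rw [h2, h4, one_smul]
  · right; rw [h2, h4, neg_smul, one_smul]

end WallStructure

namespace WallStructure

variable {n : ℕ} {X : PolyhedralPseudomanifold n} {A : Type*} [CommRing A] {L : Type*}
  [AddCommGroup L] {Q : AddSubmonoid L} {φ : ConvexMPA X Q} {I : Ideal (BaseRing A Q)}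
  {F : SlabFunctions φ I} {S : WallStructure F} {𝔧 : Set X.Pt} {C : S.PlaneChart 𝔧}

/-! ### Exponents of transported monomials -/

/-- A Bézout relation for the primitive ray shows that the real factor is an integer. -/
lemma PlaneChart.exists_int_smul_ray {j : Fin C.r} {v : Fin 2 → ℤ} {t : ℝ}
    (h : toReal v = t • toReal (C.ray j)) : ∃ d : ℤ, v = -d • C.ray j := by
  obtain ⟨p, q, hpq⟩ := C.primitive j
  refine ⟨-(p * v 0 + q * v 1), ?_⟩
  have h0 : (v 0 : ℝ) = t * C.ray j 0 := congrFun h 0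
  have h1 : (v 1 : ℝ) = t * C.ray j 1 := congrFun h 1
  have hpq' : (p : ℝ) * C.ray j 0 + q * C.ray j 1 = 1 := by exact_mod_cast hpq
  have ht : t = (p : ℝ) * v 0 + q * v 1 := by
    rw [h0, h1]; linear_combination -t * hpq'
  apply toReal_injective
  rw [toReal_smul, h, ht]
  push_cast
  ring_nf

/-- Exponents are tangent to the wall, hence project to the line of its ray; maximality of `δ` then
bounds the multiple. -/
lemma PlaneChart.dev_of_mem_support (hj : S.IsJoint 𝔧) {j : Fin C.r} {δ : ℤ}
    (hδ : C.IsMaxExponent j δ) {v : Fin n → ℤ}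
    (hv : v ∈ (S.wall (C.wall j)).fn.coeff.support) :
    ∃ d ≤ δ, C.dev (S.wall (C.wall j)).cell *ᵥ v = -d • C.ray j := by
  set τ := (S.wall (C.wall j)).cell with hτ
  have hcar : (S.wall (C.wall j)).carrier ⊆ X.cellSet τ := by
    rintro _ ⟨x, hx, rfl⟩
    exact ⟨x, (S.wall (C.wall j)).subset hx, rfl⟩
  have hjτ : 𝔧 ⊆ X.cellSet τ := (C.ray_subset j).trans hcar
  obtain ⟨x, hx⟩ := (hj.part_props hjτ).2.1
  have h1 : ∀ y ∈ (S.wall (C.wall j)).supp, det2 (toReal (C.ray j)) (C.D τ (y - x)) = 0 := by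
    intro y hy
    obtain ⟨s, -, hs⟩ := (PlaneChart.mem_wedge_wall_iff hj hjτ hcar).1
      ⟨x, hx.1, y, (S.wall (C.wall j)).subset hy, hx.2, ⟨y, hy, rfl⟩, 1, zero_le_one,
        (one_smul _ _).symm⟩
    rw [hs, det2_smul_right, det2_self, mul_zero]
  have h2 : det2 (toReal (C.ray j)) (C.D τ (toReal v)) = 0 := by
    refine Submodule.span_induction (p := fun u _ => det2 (toReal (C.ray j)) (C.D τ u) = 0)
      ?_ ?_ ?_ ?_ ((S.wall (C.wall j)).tangent v hv)
    · rintro _ ⟨y, hy, y', hy', rfl⟩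
      have : y -ᵥ y' = (y - x) - (y' - x) := by simp
      simp only [this]
      rw [map_sub, det2_sub_right, h1 y hy, h1 y' hy', sub_zero]
    · simp
    · intro u u' _ _ hu hu'
      rw [map_add, det2_add_right, hu, hu', add_zero]
    · intro a u _ hu
      rw [map_smul, det2_smul_right, hu, mul_zero]
  obtain ⟨t, ht⟩ := exists_smul_of_det2_eq_zero (C.ray_ne_zero j) h2
  rw [C.D_toReal] at ht
  obtain ⟨d, hd⟩ := PlaneChart.exists_int_smul_ray ht
  exact ⟨d, hδ.2 ⟨v, hv, hd⟩, hd⟩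

lemma Crosses.dev_of_mem_support_fnIn (hj : S.IsJoint 𝔧) {j : Fin C.r} {δ : ℤ}
    (hδ : C.IsMaxExponent j δ) {σ σ' : X.MaxCell} (h : S.Crosses 𝔧 (C.wall j) σ σ')
    {v : Fin n → ℤ} (hv : v ∈ (S.fnIn (C.wall j) σ').coeff.support) :
    ∃ d ≤ δ, C.dev σ' *ᵥ v = -d • C.ray j := by
  classical
  have h1 := Finsupp.mapDomain_support (f := fun m => (S.transfer (C.wall j)
    (S.wall (C.wall j)).cell σ').1 *ᵥ m) hv
  obtain ⟨u, hu, rfl⟩ := Finset.mem_image.1 h1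
  have hu' : u ∈ (S.wall (C.wall j)).fn.coeff.support := by
    rw [Finsupp.mem_support_iff] at hu ⊢
    intro h0
    apply hu
    rw [AddMonoidAlgebra.coeff_mapRingHom, h0, map_zero]
  obtain ⟨d, hd, h2⟩ := PlaneChart.dev_of_mem_support hj hδ hu'
  refine ⟨d, hd, ?_⟩
  rw [← h2, Matrix.mulVec_mulVec]
  by_cases hc : (S.wall (C.wall j)).cell = σ'
  · rw [← hc, transfer_self]
    congr 1
    exact Matrix.mul_one _
  · have hcr : S.Crosses 𝔧 (C.wall j) (S.wall (C.wall j)).cell σ' := by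
      refine ⟨h.1, fun x hx => ⟨?_, (h.2.1 hx).2⟩, fun e => absurd e hc⟩
      obtain ⟨y, hy, rfl⟩ := hx
      exact ⟨y, (S.wall (C.wall j)).subset hy, rfl⟩
    rw [hcr.dev_transfer (C := C)]

lemma Crosses.dev_of_mem_support_mul (hj : S.IsJoint 𝔧) {j : Fin C.r} {δ : ℤ}
    (hδ : C.IsMaxExponent j δ) {σ σ' : X.MaxCell} (h : S.Crosses 𝔧 (C.wall j) σ σ')
    (a : BaseRing A Q ⧸ I) {v : Fin n → ℤ}
    (hv : v ∈ (S.fnIn (C.wall j) σ' * const a).coeff.support) :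
    ∃ d ≤ δ, C.dev σ' *ᵥ v = -d • C.ray j := by
  classical
  have h1 := AddMonoidAlgebra.support_coeff_mul_subset _ _ hv
  obtain ⟨u, hu, z, hz, rfl⟩ := Finset.mem_add.1 h1
  have hz0 : z = 0 := by
    have := Finsupp.support_single_subset hz
    simpa using this
  rw [hz0, add_zero]
  exact h.dev_of_mem_support_fnIn hj hδ hu

lemma Crosses.dev_of_mem_support_pow (hj : S.IsJoint 𝔧) {j : Fin C.r} {δ : ℤ}
    (hδ : C.IsMaxExponent j δ) {σ σ' : X.MaxCell} (h : S.Crosses 𝔧 (C.wall j) σ σ')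
    (a : BaseRing A Q ⧸ I) (N : ℕ) : ∀ {v : Fin n → ℤ},
    v ∈ ((S.fnIn (C.wall j) σ' * const a) ^ N).coeff.support →
    ∃ d ≤ N * δ, C.dev σ' *ᵥ v = -d • C.ray j := by
  classical
  induction N with
  | zero =>
    intro v hv
    rw [pow_zero] at hv
    have := AddMonoidAlgebra.support_coeff_one_subset hv
    rw [Finset.mem_zero] at this
    exact ⟨0, by simp, by simp [this]⟩
  | succ N ih =>
    intro v hv
    rw [pow_succ] at hv
    obtain ⟨u, hu, z, hz, rfl⟩ := Finset.mem_add.1 (AddMonoidAlgebra.support_coeff_mul_subset _ _ hv)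
    obtain ⟨d, hd, h1⟩ := ih hu
    obtain ⟨d', hd', h2⟩ := h.dev_of_mem_support_mul hj hδ a hz
    refine ⟨d + d', ?_, ?_⟩
    · push_cast
      linarith
    · rw [Matrix.mulVec_add, h1, h2, ← add_smul]
      congr 1
      ring

/-- The control on bending used throughout: `N` factors of the wall function contribute at most `N *
δ`, and the change along the ray leaves the normal component alone. -/
lemma Crosses.dev_of_mem_support_transport (hj : S.IsJoint 𝔧) {j : Fin C.r} {δ : ℤ}
    (hδ : C.IsMaxExponent j δ) {σ σ' : X.MaxCell} (h : S.Crosses 𝔧 (C.wall j) σ σ')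
    {m v : Fin n → ℤ} {N : ℕ}
    (hv : v ∈ (S.transport (C.wall j) σ σ' m N).coeff.support) :
    ∃ d ≤ N * δ, C.dev σ' *ᵥ v = C.dev σ *ᵥ m - d • C.ray j := by
  classical
  obtain ⟨u, hu, z, hz, rfl⟩ := Finset.mem_add.1 (AddMonoidAlgebra.support_coeff_mul_subset _ _ hv)
  have hu0 : u = (S.transfer (C.wall j) σ σ').1 *ᵥ m := by
    have := Finsupp.support_single_subset hu
    simpa using this
  obtain ⟨d, hd, h1⟩ := h.dev_of_mem_support_pow hj hδ _ N hz
  refine ⟨d, hd, ?_⟩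
  rw [Matrix.mulVec_add, h1, hu0, Matrix.mulVec_mulVec, h.dev_transfer (C := C), neg_smul,
    sub_eq_add_neg]

/-! ### Sequences of monomials along broken lines -/

variable (C)

/-- The hypotheses of the proposition on the plane chart at a joint. -/
structure IsConvexChart (δ : Fin C.r → ℤ) (w : ℕ → Fin 2 → ℝ) (den : ℕ → ℝ) : Prop where
  joint : S.IsJoint 𝔧
  max : ∀ j, C.IsMaxExponent j (δ j)
  fan : IsConvexFan C.r C.edge w (extendFin δ) den

/-- A linear segment of a broken line, up to its position. -/
@[ext] structure LineState (_S : WallStructure F) where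
  cell : X.MaxCell
  chamber : Set (Fin n → ℝ)
  exp : Fin n → ℤ
  coeff : BaseRing A Q ⧸ I

variable {C}

variable (C) in
/-- `s` lies in the chamber in the sector with number `k`. -/
structure LineState.InSector (s : S.LineState) (k : ℕ) : Prop where
  joint_subset : 𝔧 ⊆ X.cellSet s.cell
  le : k ≤ C.r
  nonempty : (C.V s.cell k).Nonempty
  chamber_eq : s.chamber = C.Ch s.cell k
  coeff_ne : s.coeff ≠ 0
  exp_ne : s.exp ≠ 0

variable (C) in
/-- `s` is the first segment of a normalized broken line. -/
structure LineState.IsStart (σ₀ : X.MaxCell) (m : Fin n → ℤ) (s : S.LineState) (k : ℕ) : Prop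
    extends s.InSector C k where
  samePoint : S.SamePoint 𝔧 σ₀ (toReal m) s.cell (toReal s.exp)
  mem_closure : C.D s.cell (toReal s.exp) ∈ closure (C.V s.cell k)
  coeff_eq : s.coeff = 1

variable (C) in
/-- `s'` can follow `s` on a broken line that crosses the ray with number `j` in the direction
given by the sign `ε`. -/
structure LineState.IsStep (s s' : S.LineState) (j : Fin C.r) (k k' : ℕ) (ε : ℤ) : Prop where
  left : s.InSector C k
  right : s'.InSector C k'
  side : Side j k ε
  side' : Side j k' (-ε)
  touch : toReal (C.ray j) ∈ closure (C.V s.cell k)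
  touch' : toReal (C.ray j) ∈ closure (C.V s'.cell k')
  crosses : S.Crosses 𝔧 (C.wall j) s.cell s'.cell
  pos : 0 < ε * (C.normal j s.cell ⬝ᵥ s.exp)
  coeff_eq : s'.coeff = s.coeff * (S.transport (C.wall j) s.cell s'.cell s.exp
    (C.normal j s.cell ⬝ᵥ s.exp).natAbs).coeff s'.exp

variable (C) in
/-- The segments of a normalized broken line with asymptotic monomial `m`, the last one first. -/
inductive IsLineChain (σ₀ : X.MaxCell) (m : Fin n → ℤ) : List S.LineState → Prop
  | start {s k} : s.IsStart C σ₀ m k → IsLineChain σ₀ m [s]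
  | step {s s' l j k k' ε} : IsLineChain σ₀ m (s :: l) → s.IsStep C s' j k k' ε →
      IsLineChain σ₀ m (s' :: s :: l)

/-! ### The half-plane invariant and the monotonicity of chains. -/

section

variable {δ : Fin C.r → ℤ} {w : ℕ → Fin 2 → ℝ} {den : ℕ → ℝ} (hC : IsConvexChart C δ w den)
include hC

lemma LineState.InSector.unique {s : S.LineState} {k k' : ℕ} (h : s.InSector C k)
    (h' : s.InSector C k') : k = k' :=
  PlaneChart.index_eq_of_Ch_eq hC.fan h.joint_subset h.le h'.le h.nonempty
    (by rw [← h.chamber_eq, ← h'.chamber_eq])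

lemma LineState.IsStep.dev_eq {s s' : S.LineState} {j : Fin C.r} {k k' : ℕ} {ε : ℤ}
    (h : s.IsStep C s' j k k' ε) :
    ∃ d : ℤ, d ≤ ε * (C.normal j s.cell ⬝ᵥ s.exp) * δ j ∧
      C.dev s'.cell *ᵥ s'.exp = C.dev s.cell *ᵥ s.exp - d • C.ray j := by
  -- The sign `ε` makes the normal positive on the chamber that is left.
  have hN : ((C.normal j s.cell ⬝ᵥ s.exp).natAbs : ℤ) = ε * (C.normal j s.cell ⬝ᵥ s.exp) := by
    have h1 := h.pos
    rcases h.side with ⟨-, h2⟩ | ⟨-, h2⟩ <;> rw [h2] at h1 ⊢ <;> omega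
  rw [← hN]
  refine h.crosses.dev_of_mem_support_transport hC.joint (hC.max j) ?_
  rw [Finsupp.mem_support_iff]
  intro h0
  apply h.right.coeff_ne
  rw [h.coeff_eq, h0, mul_zero]

lemma LineState.IsStep.normal_eq {s s' : S.LineState} {j : Fin C.r} {k k' : ℕ} {ε : ℤ}
    (h : s.IsStep C s' j k k' ε) :
    C.normal j s'.cell ⬝ᵥ s'.exp = C.normal j s.cell ⬝ᵥ s.exp := by
  obtain ⟨d, -, hd⟩ := h.dev_eq hC
  rw [C.normal_dotProduct, C.normal_dotProduct, hd]
  simp only [Pi.sub_apply, Pi.smul_apply, smul_eq_mul]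
  ring

lemma IsConvexChart.det2_w_ray {j : Fin C.r} {k : ℕ} {ε : ℤ} (h : Side j k ε) :
    0 < det2 (w k) (toReal (C.ray j)) := by
  rw [← C.edge_ray]
  have := j.2
  rcases h with ⟨rfl, -⟩ | ⟨rfl, -⟩
  · exact hC.fan.det2_w_succ_pos j.2
  · exact hC.fan.det2_w_pos j.2 (Nat.succ_pos _)

/-- Bending does not lead out of the half-planes given by the maximally bent line. -/
lemma LineState.IsStep.det2_w_nonneg {s s' : S.LineState} {j : Fin C.r} {k k' : ℕ} {ε : ℤ}
    (h : s.IsStep C s' j k k' ε) (h0 : 0 ≤ det2 (w k) (C.D s.cell (toReal s.exp))) :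
    0 ≤ det2 (w k') (C.D s'.cell (toReal s'.exp)) := by
  obtain ⟨d, hd, hdev⟩ := h.dev_eq hC
  set g := C.D s.cell (toReal s.exp) with hg
  set e := toReal (C.ray j) with he
  have hg' : C.D s'.cell (toReal s'.exp) = g - (d : ℝ) • e := by
    rw [C.D_toReal, hdev, hg, C.D_toReal, toReal_sub, toReal_smul]
  have hd' : (d : ℝ) ≤ ε * det2 e g * δ j := by
    rw [← C.cast_normal]; exact_mod_cast hd
  have hbend := hC.fan.bend j j.2
  have hden := hC.fan.den_pos j j.2
  have hδ : extendFin δ (j : ℕ) = δ j := by simp [extendFin]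
  rw [hδ, C.edge_ray] at hbend
  have hw1 : 0 < det2 (w j) e := hC.det2_w_ray (k := j) (ε := 1) (Or.inl ⟨rfl, rfl⟩)
  have hb : ∀ y, den j * det2 (w (j + 1)) y = det2 (w j) y + det2 (w j) e * δ j * det2 e y := by
    intro y
    rw [← det2_smul_left, hbend, det2_add_left, det2_smul_left]
  rw [hg']
  rcases h.side with ⟨hk, hε⟩ | ⟨hk, hε⟩
  -- Clockwise crossing: the maximal bend of `w` adds `det2 (w j) e * δ j * det2 e g`, which
  -- outweighs the loss `d * det2 (w j) e` of the exponent.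
  · have hk' : k' = j + 1 := by
      rcases h.side' with ⟨-, h2⟩ | ⟨h1, -⟩
      · rw [hε] at h2; omega
      · exact h1
    rw [hk] at h0
    rw [hk']
    rw [hε, Int.cast_one, one_mul] at hd'
    have h3 : det2 e (g - (d : ℝ) • e) = det2 e g := by
      rw [det2_sub_right, det2_smul_right, det2_self, mul_zero, sub_zero]
    have h1 := hb (g - (d : ℝ) • e)
    rw [h3, det2_sub_right (w j), det2_smul_right] at h1
    have h2 : 0 ≤ den j * det2 (w (j + 1)) (g - (d : ℝ) • e) := by
      rw [h1]
      nlinarith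
    exact nonneg_of_mul_nonneg_right h2 hden
  -- Counterclockwise crossing: the same identity is read backwards, from `w (j + 1)` to `w j`, and
  -- the bound on `d` has the matching sign.
  · have hk' : k' = j := by
      rcases h.side' with ⟨h1, -⟩ | ⟨-, h2⟩
      · exact h1
      · rw [hε] at h2; omega
    rw [hk] at h0
    rw [hk', det2_sub_right, det2_smul_right]
    rw [hε, Int.cast_neg, Int.cast_one] at hd'
    have h1 := hb g
    have h2 := mul_nonneg hden.le h0
    rw [h1] at h2
    nlinarith

/-- A broken line that has crossed a wall does not turn back. -/
lemma IsConvexChart.escape {j : Fin C.r} {k : ℕ} {ε : ℤ} (hs : Side j k (-ε)) {g x : Fin 2 → ℝ}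
    (h1 : 0 < ε * det2 (toReal (C.ray j)) g) (h2 : 0 ≤ det2 (w k) g) (h3 : 0 < det2 (w k) x)
    (h4 : ε * det2 (toReal (C.ray j)) x ≤ 0) : 0 < ε * det2 x g := by
  have h5 := hC.det2_w_ray hs
  -- Both terms on the right have the right sign: the position and the exponent lie to the left of
  -- `w k`, and they are on opposite sides of the ray.
  have h6 := det2_pluecker (w k) (toReal (C.ray j)) x g
  have h7 : 0 < det2 (w k) (toReal (C.ray j)) * (ε * det2 x g) := by
    have : det2 (w k) (toReal (C.ray j)) * (ε * det2 x g) =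
        det2 (w k) x * (ε * det2 (toReal (C.ray j)) g) -
          det2 (w k) g * (ε * det2 (toReal (C.ray j)) x) := by
      linear_combination (ε : ℝ) * h6
    rw [this]
    have := mul_pos h3 h1
    nlinarith
  exact pos_of_mul_pos_right h7 h5.le

variable (C w) in
omit hC in
/-- What is known about the last segment of a chain. -/
structure ChainInv (σ₀ : X.MaxCell) (m : Fin n → ℤ) (s : S.LineState) (l : List S.LineState)
    (k : ℕ) : Prop where
  inSector : s.InSector C k
  nonneg : 0 ≤ det2 (w k) (C.D s.cell (toReal s.exp))
  cases : (l = [] ∧ s.IsStart C σ₀ m k) ∨ ∃ (j : Fin C.r) (ε : ℤ), Side j k (-ε) ∧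
    toReal (C.ray j) ∈ closure (C.V s.cell k) ∧ 0 < ε * (C.normal j s.cell ⬝ᵥ s.exp) ∧
    l.length ≤ if ε = 1 then k else C.r - k

lemma IsLineChain.inv_aux {σ₀ : X.MaxCell} {m : Fin n → ℤ} {l₀ : List S.LineState}
    (h : IsLineChain C σ₀ m l₀) : ∀ s l, l₀ = s :: l → ∃ k, ChainInv C w σ₀ m s l k := by
  induction h with
  | @start s k hs =>
    intro s' l hl
    obtain ⟨rfl, rfl⟩ := List.cons.inj hl
    refine ⟨k, hs.toInSector, ?_, Or.inl ⟨rfl, hs⟩⟩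
    exact hC.fan.det2_w_nonneg hs.le (closure_mono Set.inter_subset_right hs.mem_closure)
  | @step s s' l j k k' ε _ hst ih =>
    intro s'' l' hl
    obtain ⟨rfl, rfl⟩ := List.cons.inj hl
    obtain ⟨k₁, h1, h2, h3⟩ := ih s l rfl
    have hk : k₁ = k := h1.unique hC hst.left
    subst hk
    refine ⟨k', hst.right, hst.det2_w_nonneg hC h2, Or.inr ⟨j, ε, hst.side', hst.touch', ?_, ?_⟩⟩
    · rw [hst.normal_eq hC]; exact hst.pos
    · have hle := h1.le
      have hle' := hst.right.le
      have key : l.length ≤ if ε = 1 then k₁ else C.r - k₁ := by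
        rcases h3 with ⟨rfl, -⟩ | ⟨j', ε', hs, -, hp, hlen⟩
        · simp
        -- If the direction of crossing changed, the line would leave through the ray it has just
        -- crossed, but the normal component at that ray has kept its sign.
        · have : ε' = ε := by
            by_contra hne
            have hε : -ε' = ε := by
              rcases hs with ⟨-, a⟩ | ⟨-, a⟩ <;> rcases hst.side with ⟨-, b⟩ | ⟨-, b⟩ <;> omega
            rw [hε] at hs
            have hjj : j' = j := Fin.ext (hs.ray_eq hst.side)
            rw [hjj] at hp
            have := hst.pos
            rw [← hε, neg_mul] at this
            omega
          rwa [this] at hlen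
      rw [List.length_cons]
      -- Each clockwise crossing raises the sector number by one and each counterclockwise crossing
      -- lowers it, so the number of crossings is bounded.
      rcases hst.side with ⟨a, rfl⟩ | ⟨a, rfl⟩ <;> rcases hst.side' with ⟨b, c⟩ | ⟨b, c⟩ <;>
        simp at key c ⊢ <;> omega

lemma IsLineChain.inv {σ₀ : X.MaxCell} {m : Fin n → ℤ} {s : S.LineState} {l : List S.LineState}
    (h : IsLineChain C σ₀ m (s :: l)) : ∃ k, ChainInv C w σ₀ m s l k :=
  h.inv_aux hC s l rfl

end

end WallStructure

namespace WallStructure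

variable {n : ℕ} {X : PolyhedralPseudomanifold n} {A : Type*} [CommRing A] {L : Type*}
  [AddCommGroup L] {Q : AddSubmonoid L} {φ : ConvexMPA X Q} {I : Ideal (BaseRing A Q)}
  {F : SlabFunctions φ I} {S : WallStructure F} {𝔧 : Set X.Pt} {C : S.PlaneChart 𝔧}

/-! ### Broken lines and chains -/

namespace BrokenLine

variable {σ : X.MaxCell} {p : Fin n → ℝ}

/-- The `k`-th segment of a broken line, without its position. -/
def state (β : S.BrokenLine 𝔧 σ p) (k : Fin (β.r + 1)) : S.LineState :=
  ⟨β.cell k, β.chamber k, β.exp k, β.coeff k⟩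

/-- The segments of a broken line, the last one first. -/
def states (β : S.BrokenLine 𝔧 σ p) : List S.LineState := (List.ofFn β.state).reverse

/-- A broken line with one more segment. -/
def snoc {q : Fin n → ℝ} (β : S.BrokenLine 𝔧 σ q) (s : S.LineState) (p : Fin n → ℝ) (i : S.ι)
    (τ : ℝ) (hτ : 0 < τ) (hch : S.IsChamberAt 𝔧 s.cell s.chamber) (hexp : s.exp ≠ 0)
    (hcoeff : s.coeff ≠ 0) (hp : p ∉ X.wedge 𝔧 𝔧 s.cell)
    (hseg : ∀ u, 0 < u → u < τ → p + u • toReal s.exp ∈ s.chamber)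
    (hcr : S.Crosses 𝔧 i (β.cell (Fin.last β.r)) s.cell)
    (hq : β.pos (Fin.last β.r) ∈ X.wedge 𝔧 (S.wall i).carrier (β.cell (Fin.last β.r)))
    (hcont : p + τ • toReal s.exp =
      realMul (S.transfer i (β.cell (Fin.last β.r)) s.cell).1 (β.pos (Fin.last β.r)))
    (hres : ∃ ν, S.IsWallNormal 𝔧 i (β.cell (Fin.last β.r)) ν ∧
      s.coeff = β.coeff (Fin.last β.r) *
        (S.transport i (β.cell (Fin.last β.r)) s.cell (β.exp (Fin.last β.r))
          (ν ⬝ᵥ β.exp (Fin.last β.r)).natAbs).coeff s.exp) :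
    S.BrokenLine 𝔧 s.cell p where
  r := β.r + 1
  cell := Fin.snoc (α := fun _ => X.MaxCell) β.cell s.cell
  chamber := Fin.snoc (α := fun _ => Set (Fin n → ℝ)) β.chamber s.chamber
  exp := Fin.snoc (α := fun _ => Fin n → ℤ) β.exp s.exp
  coeff := Fin.snoc (α := fun _ => BaseRing A Q ⧸ I) β.coeff s.coeff
  -- Earlier times are shifted back by `τ` so that the longer line again ends at time `0`.
  time := Fin.snoc (α := fun _ => ℝ) (fun k => β.time k - τ) 0
  pos := Fin.snoc (α := fun _ => Fin n → ℝ) β.pos p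
  wall := Fin.snoc (α := fun _ => S.ι) β.wall i
  time_strictMono := by
    rw [Fin.strictMono_iff_lt_succ]
    intro k
    refine Fin.lastCases ?_ (fun k => ?_) k
    · rw [Fin.succ_last, Fin.snoc_last, Fin.snoc_castSucc, β.time_last]
      linarith
    · rw [Fin.succ_castSucc, Fin.snoc_castSucc, Fin.snoc_castSucc]
      have := β.time_strictMono (Fin.castSucc_lt_succ (i := k))
      linarith
  time_last := Fin.snoc_last _ _
  cell_last := Fin.snoc_last _ _
  pos_last := Fin.snoc_last _ _
  isChamber k := by
    refine Fin.lastCases ?_ (fun k => ?_) k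
    · simpa only [Fin.snoc_last] using hch
    · simpa only [Fin.snoc_castSucc] using β.isChamber k
  exp_ne k := by
    refine Fin.lastCases ?_ (fun k => ?_) k
    · simpa only [Fin.snoc_last] using hexp
    · simpa only [Fin.snoc_castSucc] using β.exp_ne k
  coeff_ne k := by
    refine Fin.lastCases ?_ (fun k => ?_) k
    · simpa only [Fin.snoc_last] using hcoeff
    · simpa only [Fin.snoc_castSucc] using β.coeff_ne k
  pos_notMem k := by
    refine Fin.lastCases ?_ (fun k => ?_) k
    · simpa only [Fin.snoc_last] using hp
    · simpa only [Fin.snoc_castSucc] using β.pos_notMem k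
  first t ht := by
    rw [← Fin.castSucc_zero] at ht ⊢
    simp only [Fin.snoc_castSucc] at ht ⊢
    have := β.first (t + τ) (by linarith)
    rwa [sub_add_eq_sub_sub_swap] at this
  segment k t := by
    refine Fin.lastCases ?_ (fun k => ?_) k
    · rw [Fin.succ_last]
      simp only [Fin.snoc_last, Fin.snoc_castSucc]
      intro h1 h2
      rw [β.time_last] at h1
      exact hseg _ (by linarith) (by linarith)
    · rw [Fin.succ_castSucc]
      simp only [Fin.snoc_castSucc]
      intro h1 h2
      have := β.segment k (t + τ) (by linarith) (by linarith)
      rwa [sub_add_eq_sub_sub_swap] at this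
  crosses k := by
    refine Fin.lastCases ?_ (fun k => ?_) k
    · rw [Fin.succ_last]
      simp only [Fin.snoc_last, Fin.snoc_castSucc]
      exact hcr
    · rw [Fin.succ_castSucc]
      simpa only [Fin.snoc_castSucc] using β.crosses k
  pos_wall k := by
    refine Fin.lastCases ?_ (fun k => ?_) k
    · simp only [Fin.snoc_last, Fin.snoc_castSucc]
      exact hq
    · simpa only [Fin.snoc_castSucc] using β.pos_wall k
  continuous k := by
    refine Fin.lastCases ?_ (fun k => ?_) k
    · rw [Fin.succ_last]
      simp only [Fin.snoc_last, Fin.snoc_castSucc]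
      rw [← hcont, β.time_last, zero_sub, zero_sub, neg_neg]
    · rw [Fin.succ_castSucc]
      simp only [Fin.snoc_castSucc, sub_sub_sub_cancel_right]
      exact β.continuous k
  result k := by
    refine Fin.lastCases ?_ (fun k => ?_) k
    · rw [Fin.succ_last]
      simp only [Fin.snoc_last, Fin.snoc_castSucc]
      exact hres
    · rw [Fin.succ_castSucc]
      simp only [Fin.snoc_castSucc]
      exact β.result k

lemma states_eq_cons (β : S.BrokenLine 𝔧 σ p) :
    ∃ l, β.states = β.state (Fin.last β.r) :: l := by
  refine ⟨(List.ofFn fun i : Fin β.r => β.state i.castSucc).reverse, ?_⟩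
  rw [states, List.ofFn_succ', List.concat_eq_append, List.reverse_append]
  rfl

/-- Just before it ends, a segment lies in the interior of its chamber. -/
lemma exists_near (β : S.BrokenLine 𝔧 σ p) (k : Fin (β.r + 1)) :
    ∃ ε > (0 : ℝ), ∀ τ : ℝ, 0 < τ → τ < ε → β.pos k + τ • toReal (β.exp k) ∈ β.chamber k := by
  refine Fin.cases ?_ (fun k => ?_) k
  · refine ⟨1, one_pos, fun τ h1 _ => ?_⟩
    have := β.first (β.time 0 - τ) (by linarith)
    rwa [sub_sub_cancel] at this
  · refine ⟨β.time k.succ - β.time k.castSucc,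
      sub_pos.2 (β.time_strictMono Fin.castSucc_lt_succ), fun τ h1 h2 => ?_⟩
    have := β.segment k (β.time k.succ - τ) (by linarith) (by linarith)
    rwa [sub_sub_cancel] at this

end BrokenLine

/-! ### From broken lines to chains. -/

section

variable {δ : Fin C.r → ℤ} {w : ℕ → Fin 2 → ℝ} {den : ℕ → ℝ} (hC : IsConvexChart C δ w den)
include hC

omit hC in
lemma PlaneChart.mem_closure_V {σ : X.MaxCell} {k : ℕ} {q v : Fin n → ℝ} {ε : ℝ} (hε : 0 < ε)
    (h : ∀ τ : ℝ, 0 < τ → τ < ε → q + τ • v ∈ C.Ch σ k) : C.D σ q ∈ closure (C.V σ k) := by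
  have hc : Filter.Tendsto (fun τ : ℝ => C.D σ (q + τ • v)) (nhdsWithin 0 (Set.Ioi 0))
      (nhds (C.D σ q)) := by
    have : ContinuousAt (fun τ : ℝ => C.D σ (q + τ • v)) 0 := by fun_prop
    have h2 := this.tendsto
    simp only [zero_smul, add_zero] at h2
    exact h2.mono_left nhdsWithin_le_nhds
  refine mem_closure_of_tendsto hc ?_
  filter_upwards [Ioo_mem_nhdsGT hε] with τ hτ
  exact h τ hτ.1 hτ.2

lemma BrokenLine.inSector {σ : X.MaxCell} {p : Fin n → ℝ} (β : S.BrokenLine 𝔧 σ p)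
    (k : Fin (β.r + 1)) : ∃ a, (β.state k).InSector C a := by
  obtain ⟨h1, a, h2, h3, h4⟩ := (PlaneChart.isChamberAt_iff hC.joint hC.fan).1 (β.isChamber k)
  exact ⟨a, h1, h2, h3, h4, β.coeff_ne k, β.exp_ne k⟩

lemma BrokenLine.isStart {σ₀ : X.MaxCell} {m : Fin n → ℤ} {σ : X.MaxCell} {p : Fin n → ℝ}
    (β : S.BrokenLine 𝔧 σ p) (h1 : β.coeff 0 = 1)
    (h2 : S.SamePoint 𝔧 σ₀ (toReal m) (β.cell 0) (toReal (β.exp 0))) :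
    ∃ a, (β.state 0).IsStart C σ₀ m a := by
  obtain ⟨a, ha⟩ := β.inSector hC 0
  refine ⟨a, ha, h2, ?_, h1⟩
  refine PlaneChart.mem_closure_V (v := β.pos 0) one_pos fun τ h3 _ => ?_
  -- Points far out on the unbounded segment, rescaled by `τ`, stay in the cone and tend to the
  -- exponent as `τ` tends to `0`.
  have h4 := β.first (β.time 0 - τ⁻¹) (by have := inv_pos.2 h3; linarith)
  rw [sub_sub_cancel] at h4
  have h5 : β.pos 0 + τ⁻¹ • toReal (β.exp 0) ∈ C.Ch (β.cell 0) a := by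
    rw [show β.chamber 0 = C.Ch (β.cell 0) a from ha.chamber_eq] at h4
    exact h4
  have h6 := (PlaneChart.V_isOpenCone (C := C) hC.joint ha.joint_subset a).smul_mem _ h5 τ h3
  rw [← map_smul, smul_add, smul_smul, mul_inv_cancel₀ h3.ne', one_smul,
    add_comm (τ • β.pos 0)] at h6
  exact h6

/-- The factor is positive because a broken line avoids the joint. -/
lemma BrokenLine.exists_ray {σ : X.MaxCell} {p : Fin n → ℝ} (β : S.BrokenLine 𝔧 σ p)
    (k : Fin β.r) : ∃ (j : Fin C.r) (s : ℝ), β.wall k = C.wall j ∧ 0 < s ∧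
      C.D (β.cell k.castSucc) (β.pos k.castSucc) = s • toReal (C.ray j) := by
  have hcr := β.crosses k
  obtain ⟨j, hj⟩ := C.wall.surjective ⟨β.wall k, hcr.1⟩
  have hj' : β.wall k = C.wall j := by rw [hj]
  have h1 := β.pos_wall k
  rw [hj'] at hcr h1
  obtain ⟨s, hs, h2⟩ := (PlaneChart.mem_wedge_wall_iff hC.joint hcr.left hcr.carrier_left).1 h1
  refine ⟨j, s, hj', hs.lt_of_ne ?_, h2⟩
  rintro rfl
  rw [zero_smul] at h2
  exact β.pos_notMem k.castSucc ((PlaneChart.mem_wedge_joint_iff hC.joint hcr.left).2 h2)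

/-- The sides of the wall are read off from points just before and just after the crossing. The
normal in `result` is fixed only up to sign, which its absolute value ignores. -/
lemma BrokenLine.isStep {σ : X.MaxCell} {p : Fin n → ℝ} (β : S.BrokenLine 𝔧 σ p)
    (k : Fin β.r) : ∃ (j : Fin C.r) (a b : ℕ) (ε : ℤ), β.wall k = C.wall j ∧
      (β.state k.castSucc).IsStep C (β.state k.succ) j a b ε := by
  obtain ⟨a, ha⟩ := β.inSector hC k.castSucc
  obtain ⟨b, hb⟩ := β.inSector hC k.succ
  obtain ⟨j, s, hj, hs, hq⟩ := β.exists_ray hC k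
  have hcr := β.crosses k
  have hcont := β.continuous k
  obtain ⟨ν, hν, hres⟩ := β.result k
  rw [hj] at hcr hcont hν hres
  have hV := PlaneChart.V_isOpenCone (C := C) hC.joint ha.joint_subset a
  have hV' := PlaneChart.V_isOpenCone (C := C) hC.joint hb.joint_subset b
  obtain ⟨t, ht, hnear⟩ := β.exists_near k.castSucc
  have hcha : β.chamber k.castSucc = C.Ch (β.cell k.castSucc) a := ha.chamber_eq
  have hchb : β.chamber k.succ = C.Ch (β.cell k.succ) b := hb.chamber_eq
  rw [hcha] at hnear
  have hscale : ∀ {σ : X.MaxCell} {c : ℕ}, IsOpenCone (C.V σ c) →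
      s • toReal (C.ray j) ∈ closure (C.V σ c) → toReal (C.ray j) ∈ closure (C.V σ c) := by
    intro σ c hc hmem
    have := hc.smul_mem_closure hmem (inv_pos.2 hs)
    rwa [smul_smul, inv_mul_cancel₀ hs.ne', one_smul] at this
  have htouch : toReal (C.ray j) ∈ closure (C.V (β.cell k.castSucc) a) := by
    refine hscale hV ?_
    rw [← hq]
    exact PlaneChart.mem_closure_V ht hnear
  obtain ⟨ε, hε⟩ := PlaneChart.exists_side hC.fan ha.le htouch
  have hpos : 0 < ε * (C.normal j (β.cell k.castSucc) ⬝ᵥ β.exp k.castSucc) := by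
    have h1 := hε.det2_pos (hnear (t / 2) (by linarith) (by linarith)).2
    rw [C.edge_ray, map_add, hq, map_smul, det2_add_right, det2_smul_right, det2_self, mul_zero,
      zero_add, det2_smul_right, ← C.cast_normal] at h1
    have h2 : (0 : ℝ) < ε * ((C.normal j (β.cell k.castSucc) ⬝ᵥ β.exp k.castSucc : ℤ) : ℝ) := by
      have h3 : (ε : ℝ) * (t / 2 * ((C.normal j (β.cell k.castSucc) ⬝ᵥ β.exp k.castSucc : ℤ) : ℝ))
        = t / 2 * (ε * ((C.normal j (β.cell k.castSucc) ⬝ᵥ β.exp k.castSucc : ℤ) : ℝ)) := by ring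
      rw [h3] at h1
      exact pos_of_mul_pos_right h1 (by linarith)
    exact_mod_cast h2
  have hcoeff : β.coeff k.succ = β.coeff k.castSucc * (S.transport (C.wall j) (β.cell k.castSucc)
      (β.cell k.succ) (β.exp k.castSucc)
      (C.normal j (β.cell k.castSucc) ⬝ᵥ β.exp k.castSucc).natAbs).coeff (β.exp k.succ) := by
    rcases PlaneChart.eq_normal_or_eq_neg hC.joint hcr.left hcr.carrier_left hν with h | h
    · rw [h] at hres; exact hres
    · rw [h, neg_dotProduct, Int.natAbs_neg] at hres; exact hres
  have hdet : det2 (toReal (C.ray j)) (C.D (β.cell k.succ) (toReal (β.exp k.succ))) =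
      ((C.normal j (β.cell k.castSucc) ⬝ᵥ β.exp k.castSucc : ℤ) : ℝ) := by
    obtain ⟨d, -, hd⟩ := hcr.dev_of_mem_support_transport hC.joint (hC.max j)
      (m := β.exp k.castSucc) (v := β.exp k.succ) (Finsupp.mem_support_iff.2 fun h0 =>
        β.coeff_ne k.succ (by rw [hcoeff, h0, mul_zero]))
    rw [C.D_toReal, hd, toReal_sub, toReal_smul, det2_sub_right, det2_smul_right, det2_self,
      mul_zero, sub_zero, C.cast_normal, C.D_toReal]
  set Δ := β.time k.succ - β.time k.castSucc with hΔ
  have hΔ0 : 0 < Δ := sub_pos.2 (β.time_strictMono Fin.castSucc_lt_succ)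
  set q' := realMul (S.transfer (C.wall j) (β.cell k.castSucc) (β.cell k.succ)).1
    (β.pos k.castSucc) with hq'
  have hDq' : C.D (β.cell k.succ) q' = s • toReal (C.ray j) := by
    rw [hq', hcr.D_transfer (C := C), hq]
  have hnear' : ∀ τ : ℝ, 0 < τ → τ < Δ →
      q' + τ • -toReal (β.exp k.succ) ∈ C.Ch (β.cell k.succ) b := by
    intro τ h1 h2
    have := β.segment k (β.time k.castSucc + τ) (by linarith) (by linarith)
    rw [hchb] at this
    convert this using 1
    rw [← hcont, sub_add_eq_sub_sub, sub_smul _ τ]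
    module
  have htouch' : toReal (C.ray j) ∈ closure (C.V (β.cell k.succ) b) := by
    refine hscale hV' ?_
    rw [← hDq']
    exact PlaneChart.mem_closure_V hΔ0 hnear'
  obtain ⟨ε', hε'⟩ := PlaneChart.exists_side hC.fan hb.le htouch'
  -- The determinant of the exponent with the ray survives the bend and the velocity is minus the
  -- exponent, so the line comes out on the other side.
  have hεε : ε' = -ε := by
    have h1 := hε'.det2_pos (hnear' (Δ / 2) (by linarith) (by linarith)).2
    rw [C.edge_ray, map_add, hDq', map_smul, map_neg, det2_add_right, det2_smul_right, det2_self,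
      mul_zero, zero_add, det2_smul_right, ← neg_one_smul ℝ, det2_smul_right, hdet] at h1
    have h4 : (0 : ℝ) < ε * ((C.normal j (β.cell k.castSucc) ⬝ᵥ β.exp k.castSucc : ℤ) : ℝ) := by
      exact_mod_cast hpos
    rcases hε with ⟨-, e1⟩ | ⟨-, e1⟩ <;> rcases hε' with ⟨-, e2⟩ | ⟨-, e2⟩ <;>
      rw [e1] at h4 ⊢ <;> rw [e2] at h1 ⊢ <;> push_cast at h1 h4
    · nlinarith
    · norm_num
    · nlinarith
  rw [hεε] at hε'
  exact ⟨j, a, b, ε, hj, ha, hb, hε, hε', htouch, htouch', hcr, hpos, hcoeff⟩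

omit hC in
lemma isLineChain_ofFn {σ₀ : X.MaxCell} {m : Fin n → ℤ} {r : ℕ} (st : Fin (r + 1) → S.LineState)
    {a : ℕ} (h0 : (st 0).IsStart C σ₀ m a)
    (h : ∀ k : Fin r, ∃ j a b ε, (st k.castSucc).IsStep C (st k.succ) j a b ε) :
    ∃ l, (List.ofFn st).reverse = st (Fin.last r) :: l ∧
      IsLineChain C σ₀ m (st (Fin.last r) :: l) := by
  induction r with
  | zero => exact ⟨[], by simp, .start h0⟩
  | succ r ih =>
    obtain ⟨l, h1, h2⟩ := ih (fun i => st i.castSucc) h0 fun k => h k.castSucc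
    obtain ⟨j, a, b, ε, h3⟩ := h (Fin.last r)
    refine ⟨st (Fin.last r).castSucc :: l, ?_, ?_⟩
    · rw [List.ofFn_succ', List.concat_eq_append, List.reverse_append, h1]
      rfl
    · rw [Fin.succ_last] at h3
      exact .step h2 h3

lemma BrokenLine.isLineChain_states {σ₀ : X.MaxCell} {m : Fin n → ℤ} {σ : X.MaxCell}
    {p : Fin n → ℝ} (β : S.BrokenLine 𝔧 σ p) (h1 : β.coeff 0 = 1)
    (h2 : S.SamePoint 𝔧 σ₀ (toReal m) (β.cell 0) (toReal (β.exp 0))) :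
    IsLineChain C σ₀ m β.states := by
  obtain ⟨a, ha⟩ := β.isStart hC h1 h2
  obtain ⟨l, h3, h4⟩ := isLineChain_ofFn (C := C) β.state ha fun k => by
    obtain ⟨j, a, b, ε, -, h⟩ := β.isStep hC k
    exact ⟨j, a, b, ε, h⟩
  rw [BrokenLine.states, h3]
  exact h4

end

end WallStructure

namespace WallStructure

variable {n : ℕ} {X : PolyhedralPseudomanifold n} {A : Type*} [CommRing A] {L : Type*}
  [AddCommGroup L] {Q : AddSubmonoid L} {φ : ConvexMPA X Q} {I : Ideal (BaseRing A Q)}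
  {F : SlabFunctions φ I} {S : WallStructure F} {𝔧 : Set X.Pt} {C : S.PlaneChart 𝔧}

/-! ### Broken lines are determined by their segments and endpoints -/

lemma BrokenLine.ext_of_cast {σ : X.MaxCell} {p : Fin n → ℝ} {β β' : S.BrokenLine 𝔧 σ p}
    (hr : β.r = β'.r) (hst : ∀ k, β.state k = β'.state (Fin.cast (by rw [hr]) k))
    (ht : ∀ k, β.time k = β'.time (Fin.cast (by rw [hr]) k))
    (hp : ∀ k, β.pos k = β'.pos (Fin.cast (by rw [hr]) k))
    (hw : ∀ k, β.wall k = β'.wall (Fin.cast hr k)) : β = β' := by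
  cases β
  cases β'
  dsimp only at hr
  subst hr
  simp only [BrokenLine.state, Fin.cast_eq_self, LineState.mk.injEq] at hst ht hp hw
  congr
  · exact funext fun k => (hst k).1
  · exact funext fun k => (hst k).2.1
  · exact funext fun k => (hst k).2.2.1
  · exact funext fun k => (hst k).2.2.2
  · exact funext ht
  · exact funext hp
  · exact funext hw

lemma BrokenLine.state_eq_of_states {σ : X.MaxCell} {p : Fin n → ℝ} {β β' : S.BrokenLine 𝔧 σ p}
    (h : β.states = β'.states) :
    ∃ hr : β.r = β'.r, ∀ k, β.state k = β'.state (Fin.cast (by rw [hr]) k) := by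
  rw [states, states, List.reverse_inj] at h
  have hr : β.r = β'.r := by
    have := congrArg List.length h
    simpa using this
  refine ⟨hr, fun k => ?_⟩
  have h1 : (List.ofFn β.state)[(k : ℕ)]? = (List.ofFn β'.state)[(k : ℕ)]? := by rw [h]
  rw [List.getElem?_ofFn, List.getElem?_ofFn, dif_pos k.2, dif_pos (by rw [← hr]; exact k.2)] at h1
  exact Option.some.inj h1

section

variable {δ : Fin C.r → ℤ} {w : ℕ → Fin 2 → ℝ} {den : ℕ → ℝ} (hC : IsConvexChart C δ w den)
include hC

lemma LineState.IsStep.unique {s s' : S.LineState} {j j' : Fin C.r} {a b a' b' : ℕ} {ε ε' : ℤ}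
    (h : s.IsStep C s' j a b ε) (h' : s.IsStep C s' j' a' b' ε') : j = j' ∧ ε = ε' := by
  have ha : a = a' := h.left.unique hC h'.left
  have hb : b = b' := h.right.unique hC h'.right
  subst ha hb
  have key : (j : ℕ) = j' ∧ ε = ε' := by
    rcases h.side with ⟨h1, h2⟩ | ⟨h1, h2⟩ <;> rcases h.side' with ⟨h3, h4⟩ | ⟨h3, h4⟩ <;>
      rcases h'.side with ⟨h5, h6⟩ | ⟨h5, h6⟩ <;> rcases h'.side' with ⟨h7, h8⟩ | ⟨h7, h8⟩ <;>
      constructor <;> omega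
  exact ⟨Fin.ext key.1, key.2⟩

/-- Positions and times are recovered backwards from the common endpoint: each segment is transverse
to the ray where it began, so that ray fixes its duration. -/
lemma BrokenLine.eq_of_states {σ : X.MaxCell} {p : Fin n → ℝ} {β β' : S.BrokenLine 𝔧 σ p}
    (h : β.states = β'.states) : β = β' := by
  obtain ⟨hr, hst⟩ := BrokenLine.state_eq_of_states h
  have hcell : ∀ k, β.cell k = β'.cell (Fin.cast (by rw [hr]) k) := fun k =>
    congrArg LineState.cell (hst k)
  have hexp : ∀ k, β.exp k = β'.exp (Fin.cast (by rw [hr]) k) := fun k =>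
    congrArg LineState.exp (hst k)
  have hstep : ∀ k : Fin β.r, ∃ (j : Fin C.r) (a b : ℕ) (ε : ℤ), β.wall k = C.wall j ∧
      β'.wall (Fin.cast hr k) = C.wall j ∧
      (β.state k.castSucc).IsStep C (β.state k.succ) j a b ε := by
    intro k
    obtain ⟨j, a, b, ε, h1, h2⟩ := β.isStep hC k
    obtain ⟨j', a', b', ε', h1', h2'⟩ := β'.isStep hC (Fin.cast hr k)
    have h3 : (β.state k.castSucc).IsStep C (β.state k.succ) j' a' b' ε' := by
      rw [hst, hst]; exact h2'
    rw [← (h2.unique hC h3).1] at h1'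
    exact ⟨j, a, b, ε, h1, h1', h2⟩
  have hpos : ∀ k, β.time k = β'.time (Fin.cast (by rw [hr]) k) ∧
      β.pos k = β'.pos (Fin.cast (by rw [hr]) k) := by
    intro k
    induction k using Fin.reverseInduction with
    | last =>
      have : Fin.cast (by rw [hr]) (Fin.last β.r) = Fin.last β'.r := Fin.ext hr
      rw [this, β.time_last, β'.time_last, β.pos_last, β'.pos_last]
      exact ⟨rfl, rfl⟩
    | cast k ih =>
      obtain ⟨j, a, b, ε, hw, hw', hs⟩ := hstep k
      obtain ⟨i, c, hi, -, hq⟩ := β.exists_ray hC k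
      obtain ⟨i', c', hi', -, hq'⟩ := β'.exists_ray hC (Fin.cast hr k)
      have hij : i = j := C.wall.injective (Subtype.ext (hi.symm.trans hw))
      have hij' : i' = j := C.wall.injective (Subtype.ext (hi'.symm.trans hw'))
      rw [hij] at hq
      rw [hij'] at hq'
      have hc := β.continuous k
      have hc' := β'.continuous (Fin.cast hr k)
      rw [hw] at hc
      have e1 : β'.exp (Fin.cast hr k).succ = β.exp k.succ := (hexp k.succ).symm
      have e2 : β'.cell (Fin.cast hr k).succ = β.cell k.succ := (hcell k.succ).symm
      have e3 : β'.cell (Fin.cast hr k).castSucc = β.cell k.castSucc := (hcell k.castSucc).symm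
      have e4 : β'.pos (Fin.cast hr k).succ = β.pos k.succ := ih.2.symm
      have e5 : β'.time (Fin.cast hr k).succ = β.time k.succ := ih.1.symm
      rw [e3] at hq'
      rw [hw', e1, e2, e3, e4, e5] at hc'
      have hcr : S.Crosses 𝔧 (C.wall j) (β.cell k.castSucc) (β.cell k.succ) := hs.crosses
      have hne : det2 (toReal (C.ray j)) (C.D (β.cell k.succ) (toReal (β.exp k.succ))) ≠ 0 := by
        rw [← C.cast_normal]
        have h1 : C.normal j (β.cell k.succ) ⬝ᵥ β.exp k.succ = _ := hs.normal_eq hC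
        rw [h1]
        have := hs.pos
        intro h0
        rw [Int.cast_eq_zero.1 h0] at this
        simp at this
      have d1 := congrArg (fun v => det2 (toReal (C.ray j)) (C.D (β.cell k.succ) v)) hc
      have d2 := congrArg (fun v => det2 (toReal (C.ray j)) (C.D (β.cell k.succ) v)) hc'
      simp only [hcr.D_transfer (C := C), hq, hq', map_add, map_smul, det2_add_right,
        det2_smul_right, det2_self, mul_zero] at d1 d2
      have ht : β.time k.castSucc = β'.time (Fin.cast hr k).castSucc := by
        have h1 : (β.time k.succ - β.time k.castSucc) =
            (β.time k.succ - β'.time (Fin.cast hr k).castSucc) :=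
          mul_right_cancel₀ hne (by linarith)
        linarith
      refine ⟨ht, ?_⟩
      rw [← ht, hc] at hc'
      exact realMul_injective _ hc'
  exact BrokenLine.ext_of_cast hr hst (fun k => (hpos k).1) (fun k => (hpos k).2) fun k => by
    obtain ⟨j, _, _, _, h1, h2, -⟩ := hstep k
    rw [h1, h2]

end

/-! ### Existence of broken lines -/

lemma BrokenLine.states_snoc {σ : X.MaxCell} {q : Fin n → ℝ} (β : S.BrokenLine 𝔧 σ q)
    (s : S.LineState) (p : Fin n → ℝ) (i : S.ι) (τ : ℝ) (hτ hch hexp hcoeff hp hseg hcr hq hcont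
      hres) :
    (β.snoc s p i τ hτ hch hexp hcoeff hp hseg hcr hq hcont hres).states = s :: β.states := by
  set γ := β.snoc s p i τ hτ hch hexp hcoeff hp hseg hcr hq hcont hres with hγ
  have h : γ.state = Fin.snoc (α := fun _ => S.LineState) β.state s := by
    funext k
    change Fin (β.r + 1 + 1) at k
    change LineState.mk (Fin.snoc (α := fun _ => X.MaxCell) β.cell s.cell k)
      (Fin.snoc (α := fun _ => Set (Fin n → ℝ)) β.chamber s.chamber k)
      (Fin.snoc (α := fun _ => Fin n → ℤ) β.exp s.exp k)
      (Fin.snoc (α := fun _ => BaseRing A Q ⧸ I) β.coeff s.coeff k) = _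
    refine Fin.lastCases ?_ (fun k => ?_) k
    · simp only [Fin.snoc_last]
    · simp only [Fin.snoc_castSucc, BrokenLine.state]
  have h2 : List.ofFn γ.state = List.ofFn (n := β.r + 1 + 1)
      (Fin.snoc (α := fun _ => S.LineState) β.state s) := by rw [h]; rfl
  rw [BrokenLine.states, h2, List.ofFn_succ', List.concat_eq_append, List.reverse_append]
  simp [BrokenLine.states]

/-- A broken line with one segment. -/
def BrokenLine.single (s : S.LineState) (p : Fin n → ℝ) (hch : S.IsChamberAt 𝔧 s.cell s.chamber)
    (hexp : s.exp ≠ 0) (hcoeff : s.coeff ≠ 0) (hp : p ∉ X.wedge 𝔧 𝔧 s.cell)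
    (hseg : ∀ u : ℝ, 0 < u → p + u • toReal s.exp ∈ s.chamber) : S.BrokenLine 𝔧 s.cell p where
  r := 0
  cell _ := s.cell
  chamber _ := s.chamber
  exp _ := s.exp
  coeff _ := s.coeff
  time _ := 0
  pos _ := p
  wall := Fin.elim0
  time_strictMono a b hab := absurd hab (by omega)
  time_last := rfl
  cell_last := rfl
  pos_last := rfl
  isChamber _ := hch
  exp_ne _ := hexp
  coeff_ne _ := hcoeff
  pos_notMem _ := hp
  first t ht := hseg _ (by linarith)
  segment k := k.elim0
  crosses k := k.elim0
  pos_wall k := k.elim0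
  continuous k := k.elim0
  result k := k.elim0

variable (C) in
/-- `p` can be the endpoint of a broken line with last segment `s`. -/
structure LineState.IsEnd (w : ℕ → Fin 2 → ℝ) (s : S.LineState) (k : ℕ) (p : Fin n → ℝ) :
    Prop where
  mem_closure : C.D s.cell p ∈ closure (C.V s.cell k)
  pos : 0 < det2 (w k) (C.D s.cell p)
  cases : C.D s.cell p ∈ C.V s.cell k ∨ ∃ (j : Fin C.r) (ε : ℤ) (t : ℝ), Side j k ε ∧ 0 < t ∧
    C.D s.cell p = t • toReal (C.ray j) ∧ 0 < ε * (C.normal j s.cell ⬝ᵥ s.exp)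

section

variable {δ : Fin C.r → ℤ} {w : ℕ → Fin 2 → ℝ} {den : ℕ → ℝ} (hC : IsConvexChart C δ w den)
include hC

omit hC in
lemma LineState.IsEnd.notMem (hj : S.IsJoint 𝔧) {s : S.LineState} (hs : 𝔧 ⊆ X.cellSet s.cell)
    {k : ℕ} {p : Fin n → ℝ} (h : s.IsEnd C w k p) : p ∉ X.wedge 𝔧 𝔧 s.cell := by
  rw [PlaneChart.mem_wedge_joint_iff (C := C) hj hs]
  intro h0
  have := h.pos
  rw [h0, det2_zero_right] at this
  exact this.false

lemma LineState.InSector.isChamberAt {s : S.LineState} {k : ℕ} (h : s.InSector C k) :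
    S.IsChamberAt 𝔧 s.cell s.chamber :=
  (PlaneChart.isChamberAt_iff hC.joint hC.fan).2
    ⟨h.joint_subset, k, h.le, h.nonempty, h.chamber_eq⟩

lemma LineState.IsStart.exists_brokenLine {σ₀ : X.MaxCell} {m : Fin n → ℤ} {s : S.LineState}
    {k : ℕ} (hs : s.IsStart C σ₀ m k) {p : Fin n → ℝ} (hp : s.IsEnd C w k p) :
    ∃ β : S.BrokenLine 𝔧 s.cell p, β.states = [s] ∧ β.coeff 0 = 1 ∧
      S.SamePoint 𝔧 σ₀ (toReal m) (β.cell 0) (toReal (β.exp 0)) := by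
  refine ⟨.single s p (hs.toInSector.isChamberAt hC) hs.exp_ne hs.coeff_ne
    (hp.notMem hC.joint hs.joint_subset) fun u hu => ?_, ?_, hs.coeff_eq, hs.samePoint⟩
  · rw [hs.chamber_eq]
    change C.D s.cell _ ∈ C.V s.cell k
    have hV := PlaneChart.V_isOpenCone (C := C) hC.joint hs.joint_subset k
    have hmem := hV.smul_mem_closure hs.mem_closure hu
    rw [map_add, map_smul]
    -- From an endpoint on a wall, the line traced back enters the open chamber only because the
    -- exponent is transverse to the ray.
    rcases hp.cases with h | ⟨j, ε, t, -, ht, h, h1⟩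
    · exact hV.add_mem h hmem
    · refine hV.add_mem_of_det2_ne_zero hs.nonempty hp.mem_closure hmem ?_
      rw [h, det2_smul_left, det2_smul_right, ← C.cast_normal]
      have : C.normal j s.cell ⬝ᵥ s.exp ≠ 0 := fun h0 => by simp [h0] at h1
      have h2 : ((C.normal j s.cell ⬝ᵥ s.exp : ℤ) : ℝ) ≠ 0 := Int.cast_ne_zero.2 this
      positivity
  · rfl

/-- The rays bounding a sector on both sides span an angle less than `π`. -/
lemma IsConvexChart.det2_ray_ray {j j' : Fin C.r} {k : ℕ} {ε : ℤ} (h : Side j k ε)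
    (h' : Side j' k (-ε)) : 0 < ε * det2 (toReal (C.ray j)) (toReal (C.ray j')) := by
  have hj := j.2
  have hj' := j'.2
  rw [← C.edge_ray, ← C.edge_ray]
  rcases h with ⟨h5, h6⟩ | ⟨h5, h6⟩ <;> rcases h' with ⟨h7, h8⟩ | ⟨h7, h8⟩
  · omega
  · have := hC.fan.det2_neg_of_inner (k := j) (by omega) hj
    rw [show (j' : ℕ) + 1 = j by omega, h6, det2_swap]
    push_cast
    linarith
  · have := hC.fan.det2_neg_of_inner (k := j') (by omega) hj'
    rw [show (j : ℕ) + 1 = j' by omega, h6]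
    push_cast
    linarith
  · omega

/-- The point at which a broken line with a given end enters its last chamber. -/
lemma LineState.IsStep.exists_prev {s s' : S.LineState} {j : Fin C.r} {k k' : ℕ} {ε : ℤ}
    (hst : s.IsStep C s' j k k' ε) (h0 : 0 ≤ det2 (w k') (C.D s'.cell (toReal s'.exp)))
    {p : Fin n → ℝ} (hp : s'.IsEnd C w k' p) :
    ∃ (τ : ℝ) (q : Fin n → ℝ), 0 < τ ∧ s.IsEnd C w k q ∧
      q ∈ X.wedge 𝔧 (S.wall (C.wall j)).carrier s.cell ∧
      p + τ • toReal s'.exp = realMul (S.transfer (C.wall j) s.cell s'.cell).1 q ∧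
      ∀ u, 0 < u → u < τ → p + u • toReal s'.exp ∈ s'.chamber := by
  set e := toReal (C.ray j) with he
  set x := C.D s'.cell p with hx
  set g := C.D s'.cell (toReal s'.exp) with hg
  have hη : 0 < ε * det2 e g := by
    have := hst.pos
    rw [← hst.normal_eq hC] at this
    rw [he, hg, ← C.cast_normal]
    exact_mod_cast this
  have hεsq : (ε : ℝ) * ε = 1 := by exact_mod_cast hst.side.sq
  have hx1 : 0 < -(ε * det2 e x) := by
    rcases hp.cases with h | ⟨j', ε', t, hs, ht, h, h1⟩
    -- An interior endpoint is on the far side of the ray by its sector. An endpoint on a wall must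
    -- lie on the other bounding ray, because the line cannot turn back, and that ray spans an angle
    -- less than `π` with the first.
    · have := hst.side'.det2_pos h.2
      rw [C.edge_ray] at this
      push_cast at this
      linarith
    · have hεε : ε' = ε := by
        by_contra hne
        have h2 : ε' = -ε := by
          rcases hs with ⟨-, a⟩ | ⟨-, a⟩ <;> rcases hst.side with ⟨-, b⟩ | ⟨-, b⟩ <;> omega
        rw [h2] at hs
        have hjj : j' = j := Fin.ext (hs.ray_eq hst.side')
        have h3 := hst.pos
        rw [hjj, h2, hst.normal_eq hC] at h1
        linarith
      rw [← hx] at h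
      rw [hεε] at hs
      have h4 := hC.det2_ray_ray hs hst.side'
      rw [← he, det2_swap] at h4
      rw [h, det2_smul_right]
      have := mul_pos ht h4
      linarith
  -- The time needed to go back from the endpoint to the line spanned by the ray.
  set τ := -(ε * det2 e x) / (ε * det2 e g) with hτ
  have hτ0 : 0 < τ := div_pos hx1 hη
  have hτη : τ * (ε * det2 e g) = -(ε * det2 e x) := div_mul_cancel₀ _ hη.ne'
  have hdet : det2 e (x + τ • g) = 0 := by
    rw [det2_add_right, det2_smul_right]
    linear_combination (ε : ℝ) * hτη - (det2 e x + τ * det2 e g) * hεsq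
  obtain ⟨c, hc⟩ := exists_smul_of_det2_eq_zero (C.ray_ne_zero j) hdet
  have hesc := hC.escape hst.side' hη h0 hp.pos (by linarith)
  -- Here the half-plane invariant is used, through `escape`: the line traced back hits the ray
  -- itself, and neither the joint nor the opposite ray.
  have hc0 : 0 < c := by
    have h1 : τ * (ε * det2 x g) = c * -(ε * det2 e x) := by
      have := congrArg (det2 x) hc
      rw [det2_add_right, det2_smul_right, det2_smul_right, det2_self, zero_add,
        ← he, det2_swap x e] at this
      linear_combination (ε : ℝ) * this
    have h2 := mul_pos hτ0 hesc
    rw [h1] at h2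
    exact pos_of_mul_pos_left h2 hx1.le
  have hVo := PlaneChart.V_isOpenCone (C := C) hC.joint hst.right.joint_subset k'
  have hVs := PlaneChart.V_isOpenCone (C := C) hC.joint hst.left.joint_subset k
  set T := S.transfer (C.wall j) s.cell s'.cell with hT
  have hTq : realMul T.1 (realMul (T⁻¹).1 (p + τ • toReal s'.exp)) = p + τ • toReal s'.exp :=
    realMul_mul_inv _ _
  have hDq : C.D s.cell (realMul (T⁻¹).1 (p + τ • toReal s'.exp)) = c • e := by
    rw [← hst.crosses.D_transfer (C := C), ← hT, hTq, map_add, map_smul]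
    exact hc
  refine ⟨τ, realMul (T⁻¹).1 (p + τ • toReal s'.exp), hτ0, ⟨?_, ?_, Or.inr ⟨j, ε, c, hst.side,
    hc0, hDq, hst.pos⟩⟩, ?_, hTq.symm, fun u hu huτ => ?_⟩
  · rw [hDq]; exact hVs.smul_mem_closure hst.touch hc0
  · rw [hDq, det2_smul_right]; exact mul_pos hc0 (hC.det2_w_ray hst.side)
  · exact (PlaneChart.mem_wedge_wall_iff hC.joint hst.crosses.left hst.crosses.carrier_left).2
      ⟨c, hc0.le, hDq⟩
  · rw [hst.right.chamber_eq]
    change C.D s'.cell _ ∈ C.V s'.cell k'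
    have h1 : 0 < 1 - u / τ := by rw [sub_pos, div_lt_one hτ0]; exact huτ
    have h2 : 0 < u / τ * c := by positivity
    -- Intermediate points interpolate between the endpoint and the hitting point, two independent
    -- vectors of the closed cone.
    have h3 : C.D s'.cell (p + u • toReal s'.exp) = (1 - u / τ) • x + (u / τ * c) • e := by
      rw [map_add, map_smul, ← hx, ← hg, mul_smul, ← hc, smul_add, smul_smul,
        div_mul_cancel₀ _ hτ0.ne']
      module
    rw [h3]
    refine hVo.add_mem_of_det2_ne_zero hst.right.nonempty (hVo.smul_mem_closure hp.mem_closure h1)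
      (hVo.smul_mem_closure hst.touch' h2) ?_
    rw [det2_smul_left, det2_smul_right, det2_swap]
    have : det2 e x ≠ 0 := fun h0 => by simp [h0] at hx1
    have := neg_ne_zero.2 this
    positivity

/-- The point of entry into the last chamber is again an admissible end for the preceding segment,
so the line is built backwards from its endpoint. -/
lemma IsLineChain.exists_brokenLine_aux {σ₀ : X.MaxCell} {m : Fin n → ℤ} {l₀ : List S.LineState}
    (h : IsLineChain C σ₀ m l₀) : ∀ s l, l₀ = s :: l → ∀ k, s.InSector C k → ∀ p,
    s.IsEnd C w k p → ∃ β : S.BrokenLine 𝔧 s.cell p, β.states = s :: l ∧ β.coeff 0 = 1 ∧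
      S.SamePoint 𝔧 σ₀ (toReal m) (β.cell 0) (toReal (β.exp 0)) := by
  induction h with
  | @start s k hs =>
    intro s' l hl k' hk' p hp
    obtain ⟨rfl, rfl⟩ := List.cons.inj hl
    rw [hk'.unique hC hs.toInSector] at hp
    exact hs.exists_brokenLine hC hp
  | @step s s' l j k k' ε hch hst ih =>
    intro s'' l' hl k'' hk'' p hp
    obtain ⟨rfl, rfl⟩ := List.cons.inj hl
    rw [hk''.unique hC hst.right] at hp
    obtain ⟨a, ha⟩ := (IsLineChain.step hch hst).inv hC
    have hak : a = k' := ha.inSector.unique hC hst.right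
    subst hak
    obtain ⟨τ, q, hτ, hq, hqw, hcont, hseg⟩ := hst.exists_prev hC ha.nonneg hp
    obtain ⟨β, h1, h2, h3⟩ := ih s l rfl k hst.left q hq
    obtain ⟨l', hl'⟩ := β.states_eq_cons
    have hlast : β.state (Fin.last β.r) = s := by
      rw [h1] at hl'
      exact (List.cons.inj hl').1.symm
    have hexp : β.exp (Fin.last β.r) = s.exp := congrArg LineState.exp hlast
    have hcoeff : β.coeff (Fin.last β.r) = s.coeff := congrArg LineState.coeff hlast
    refine ⟨β.snoc s' p (C.wall j) τ hτ (hst.right.isChamberAt hC) hst.right.exp_ne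
      hst.right.coeff_ne (hp.notMem hC.joint hst.right.joint_subset) hseg
      (by rw [β.cell_last]; exact hst.crosses) (by rw [β.cell_last, β.pos_last]; exact hqw)
      (by rw [β.cell_last, β.pos_last]; exact hcont) ?_, ?_, ?_, ?_⟩
    · refine ⟨C.normal j s.cell, ?_, ?_⟩
      · rw [β.cell_last]
        exact PlaneChart.isWallNormal_normal hC.joint hst.crosses.left hst.crosses.carrier_left
      · rw [hexp, hcoeff, β.cell_last]
        exact hst.coeff_eq
    · rw [BrokenLine.states_snoc, h1]
    · exact (Fin.snoc_castSucc (α := fun _ => BaseRing A Q ⧸ I) s'.coeff β.coeff 0).trans h2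
    · have e1 : Fin.snoc (α := fun _ => X.MaxCell) β.cell s'.cell 0 = β.cell 0 :=
        Fin.snoc_castSucc (α := fun _ => X.MaxCell) s'.cell β.cell 0
      have e2 : Fin.snoc (α := fun _ => Fin n → ℤ) β.exp s'.exp 0 = β.exp 0 :=
        Fin.snoc_castSucc (α := fun _ => Fin n → ℤ) s'.exp β.exp 0
      change S.SamePoint 𝔧 σ₀ (toReal m) (Fin.snoc (α := fun _ => X.MaxCell) β.cell s'.cell 0)
        (toReal (Fin.snoc (α := fun _ => Fin n → ℤ) β.exp s'.exp 0))
      rw [e1, e2]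
      exact h3

end

end WallStructure

namespace WallStructure

variable {n : ℕ} {X : PolyhedralPseudomanifold n} {A : Type*} [CommRing A] {L : Type*}
  [AddCommGroup L] {Q : AddSubmonoid L} {φ : ConvexMPA X Q} {I : Ideal (BaseRing A Q)}
  {F : SlabFunctions φ I} {S : WallStructure F} {𝔧 : Set X.Pt} {C : S.PlaneChart 𝔧}

/-! ### Theta functions as finite sums over chains -/

variable (C) in
/-- The chains ending in the chamber `u` of `σ`, split into last segment and rest. -/
def endChains (σ₀ : X.MaxCell) (m : Fin n → ℤ) (σ : X.MaxCell) (u : Set (Fin n → ℝ)) :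
    Set (S.LineState × List S.LineState) :=
  {c | IsLineChain C σ₀ m (c.1 :: c.2) ∧ c.1.cell = σ ∧ c.1.chamber = u}

/-- The monomial of a segment. -/
def LineState.monomial (s : S.LineState) : CellRing I n := AddMonoidAlgebra.single s.exp s.coeff

section

variable {δ : Fin C.r → ℤ} {w : ℕ → Fin 2 → ℝ} {den : ℕ → ℝ} (hC : IsConvexChart C δ w den)
include hC

omit hC in
lemma IsLineChain.cases {σ₀ : X.MaxCell} {m : Fin n → ℤ} {s : S.LineState}
    {l : List S.LineState} (h : IsLineChain C σ₀ m (s :: l)) :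
    (l = [] ∧ ∃ k, s.IsStart C σ₀ m k) ∨ ∃ s₁ l₁ j k₁ k ε, l = s₁ :: l₁ ∧
      IsLineChain C σ₀ m (s₁ :: l₁) ∧ s₁.IsStep C s j k₁ k ε := by
  cases h with
  | start h => exact Or.inl ⟨rfl, _, h⟩
  | step h h' => exact Or.inr ⟨_, _, _, _, _, _, rfl, h, h'⟩

/-- The segment that follows `c` and has exponent `v`, if `c` crosses the ray `j` to the chamber
`u` of `σ`. -/
def LineState.next (j : Fin C.r) (σ : X.MaxCell) (u : Set (Fin n → ℝ)) (s : S.LineState)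
    (v : Fin n → ℤ) : S.LineState :=
  ⟨σ, u, v, s.coeff * (S.transport (C.wall j) s.cell σ s.exp
    (C.normal j s.cell ⬝ᵥ s.exp).natAbs).coeff v⟩

lemma finite_endChains_of_length (σ₀ : X.MaxCell) (m : Fin n → ℤ) (N : ℕ) :
    ∀ (σ : X.MaxCell) (u : Set (Fin n → ℝ)),
      {c ∈ endChains C σ₀ m σ u | c.2.length < N}.Finite := by
  induction N with
  | zero => intro σ u; simp
  | succ N ih =>
    intro σ u
    -- All predecessors through the ray `j` end in one and the same chamber, so the induction
    -- hypothesis applies; each has finitely many successors, by the support of the transported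
    -- monomial.
    set P : Fin C.r → Set (S.LineState × List S.LineState) := fun j =>
      {c | IsLineChain C σ₀ m (c.1 :: c.2) ∧ c.2.length < N ∧ ∃ s' k k' ε, s'.cell = σ ∧
        s'.chamber = u ∧ c.1.IsStep C s' j k k' ε} with hP
    have hPfin : ∀ j, (P j).Finite := by
      intro j
      rcases (P j).eq_empty_or_nonempty with h | ⟨c, hc⟩
      · rw [h]; exact Set.finite_empty
      · refine (ih c.1.cell c.1.chamber).subset ?_
        rintro c₁ hc₁
        obtain ⟨-, -, s', k, k', ε, e1, e2, hst⟩ := hc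
        obtain ⟨h1, h2, s₁', k₁, k₁', ε₁, e3, e4, hst₁⟩ := hc₁
        have hk' : k' = k₁' := by
          have h3 := hst₁.right
          refine hst.right.unique hC ⟨hst.right.joint_subset, h3.le, ?_, ?_, hst.right.coeff_ne,
            hst.right.exp_ne⟩
          · rw [e1, ← e3]; exact h3.nonempty
          · rw [e2, ← e4, e1, ← e3]; exact h3.chamber_eq
        have hε : ε = ε₁ := by
          have := hst.side'.sign_eq (hk' ▸ hst₁.side')
          omega
        have hk : k = k₁ := hst.side.index_eq (hε ▸ hst₁.side)
        subst hk
        have hcell : c.1.cell = c₁.1.cell := PlaneChart.cell_eq_of_side hC.joint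
          hst.left.joint_subset hst₁.left.joint_subset hst.side hst.left.nonempty
          hst₁.left.nonempty hst.touch hst₁.touch
        refine ⟨⟨h1, hcell.symm, ?_⟩, h2⟩
        rw [hst.left.chamber_eq, hst₁.left.chamber_eq, hcell]
    have hstart : {c : S.LineState × List S.LineState | c.2 = [] ∧ c.1.cell = σ ∧
        c.1.chamber = u ∧ ∃ k, c.1.IsStart C σ₀ m k}.Finite := by
      apply Set.Subsingleton.finite
      rintro ⟨s, l⟩ ⟨h1, h2, h3, k, h4⟩ ⟨s', l'⟩ ⟨h1', h2', h3', k', h4'⟩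
      -- The asymptotic monomial has at most one representative in a given cell, so at most one
      -- first segment lies in the chamber.
      have hexp : s.exp = s'.exp := by
        apply toReal_injective
        have e1 := h4.samePoint
        have e2 := h4'.samePoint
        rw [h2] at e1
        rw [h2'] at e2
        exact e1.unique e2
      have : s = s' := LineState.ext (h2.trans h2'.symm) (h3.trans h3'.symm) hexp
        (h4.coeff_eq.trans h4'.coeff_eq.symm)
      rw [Prod.mk.injEq]
      exact ⟨this, h1.trans h1'.symm⟩
    refine (hstart.union (Set.finite_iUnion fun j => (hPfin j).biUnion fun c _ =>
      ((S.transport (C.wall j) c.1.cell σ c.1.exp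
        (C.normal j c.1.cell ⬝ᵥ c.1.exp).natAbs).coeff.support.finite_toSet.image
          fun v => (c.1.next j σ u v, c.1 :: c.2)))).subset ?_
    rintro ⟨s, l⟩ ⟨⟨h1, h2, h3⟩, h4⟩
    rcases h1.cases with ⟨h5, h6⟩ | ⟨s₁, l₁, j, k₁, k, ε, h5, h6, h7⟩
    · exact Or.inl ⟨h5, h2, h3, h6⟩
    · right
      dsimp only at h2 h3 h4 h5
      rw [h5, List.length_cons] at h4
      refine Set.mem_iUnion.2 ⟨j, Set.mem_biUnion (x := (s₁, l₁))
        ⟨h6, Nat.lt_of_succ_lt_succ h4, s, _, _, _, h2, h3, h7⟩ ⟨s.exp, ?_, ?_⟩⟩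
      · rw [Finset.mem_coe, Finsupp.mem_support_iff]
        intro h0
        apply h7.right.coeff_ne
        rw [h7.coeff_eq, h2, h0, mul_zero]
      · rw [h5, Prod.mk.injEq]
        refine ⟨LineState.ext h2.symm h3.symm rfl ?_, rfl⟩
        rw [h7.coeff_eq, h2]
        rfl

lemma finite_endChains (σ₀ : X.MaxCell) (m : Fin n → ℤ) (σ : X.MaxCell) (u : Set (Fin n → ℝ)) :
    (endChains C σ₀ m σ u).Finite := by
  refine (finite_endChains_of_length hC σ₀ m (C.r + 1) σ u).subset ?_
  rintro ⟨s, l⟩ h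
  refine ⟨h, ?_⟩
  obtain ⟨k, hk⟩ := h.1.inv hC
  change l.length < C.r + 1
  rcases hk.cases with ⟨h1, -⟩ | ⟨j, ε, -, -, -, h1⟩
  · rw [show l = [] from h1]
    exact Nat.succ_pos _
  · have := hk.inSector.le
    dsimp only at h1
    split_ifs at h1 <;> omega

/-- Broken lines ending at `p` correspond bijectively to chains ending in the chamber. The
right-hand side does not involve `p`, which settles independence of the endpoint. -/
lemma theta_eq_sum (σ₀ : X.MaxCell) (m : Fin n → ℤ) {σ : X.MaxCell} {u : Set (Fin n → ℝ)}
    (hu : S.IsChamberAt 𝔧 σ u) {p : Fin n → ℝ} (hp : p ∈ u) :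
    S.theta 𝔧 σ₀ m σ p =
      ∑ c ∈ (finite_endChains hC σ₀ m σ u).toFinset, c.1.monomial := by
  obtain ⟨hσ, k, hk, hne, rfl⟩ := (PlaneChart.isChamberAt_iff hC.joint hC.fan).1 hu
  rw [← finsum_mem_eq_finite_toFinset_sum, ← finsum_set_coe_eq_finsum_mem, theta]
  have hmem : ∀ β : S.BrokenLine 𝔧 σ p, β.coeff 0 = 1 →
      S.SamePoint 𝔧 σ₀ (toReal m) (β.cell 0) (toReal (β.exp 0)) →
      ∃ c : endChains C σ₀ m σ (C.Ch σ k), β.states = c.1.1 :: c.1.2 ∧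
        c.1.1 = β.state (Fin.last β.r) := by
    intro β h1 h2
    obtain ⟨l, hl⟩ := β.states_eq_cons
    have hch := β.isLineChain_states hC h1 h2
    rw [hl] at hch
    refine ⟨⟨(β.state (Fin.last β.r), l), hch, β.cell_last, ?_⟩, hl, rfl⟩
    obtain ⟨a, ha⟩ := β.inSector hC (Fin.last β.r)
    have hcell : (β.state (Fin.last β.r)).cell = σ := β.cell_last
    -- The last segment lies in its own chamber just before the end, and in that of `p` because `p`
    -- is an interior point; disjointness of sectors identifies the two.
    obtain ⟨t, ht, hnear⟩ := β.exists_near (Fin.last β.r)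
    have h5 : (β.state (Fin.last β.r)).chamber = C.Ch σ a := by rw [ha.chamber_eq, hcell]
    have hopen : IsOpen (C.Ch σ k) :=
      (PlaneChart.V_isOpenCone (C := C) hC.joint hσ k).isOpen.preimage (C.D σ).continuous
    have h6 : ∃ τ, 0 < τ ∧ τ < t ∧ p + τ • toReal (β.exp (Fin.last β.r)) ∈ C.Ch σ k := by
      have hc : Filter.Tendsto (fun τ : ℝ => p + τ • toReal (β.exp (Fin.last β.r)))
          (nhdsWithin 0 (Set.Ioi 0)) (nhds p) := by
        have : ContinuousAt (fun τ : ℝ => p + τ • toReal (β.exp (Fin.last β.r))) 0 := by fun_prop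
        have h2 := this.tendsto
        simp only [zero_smul, add_zero] at h2
        exact h2.mono_left nhdsWithin_le_nhds
      obtain ⟨τ, h7, h8⟩ := ((hc.eventually (hopen.mem_nhds hp)).and (Ioo_mem_nhdsGT ht)).exists
      exact ⟨τ, h8.1, h8.2, h7⟩
    obtain ⟨τ, h7, h8, h9⟩ := h6
    have h10 := hnear τ h7 h8
    rw [β.pos_last, show β.chamber (Fin.last β.r) = C.Ch σ a from h5] at h10
    change (β.state (Fin.last β.r)).chamber = _
    rw [h5, hC.fan.sector_disjoint hk ha.le h9.2 h10.2]
  choose g hg using hmem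
  refine finsum_eq_of_bijective (fun β => g β.1 β.2.1 β.2.2) ⟨?_, ?_⟩ ?_
  · rintro ⟨β, h1, h2⟩ ⟨β', h1', h2'⟩ h
    dsimp only at h
    apply Subtype.ext
    apply BrokenLine.eq_of_states hC
    dsimp only
    rw [(hg β h1 h2).1, (hg β' h1' h2').1, h]
  · rintro ⟨⟨s, l⟩, h1, h2, h3⟩
    dsimp only at h1 h2 h3
    subst h2
    obtain ⟨a, ha⟩ := h1.inv hC
    have hak : k = a := PlaneChart.index_eq_of_Ch_eq hC.fan hσ hk ha.inSector.le hne
      (by rw [← h3, ← ha.inSector.chamber_eq])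
    subst hak
    obtain ⟨β, h4, h5, h6⟩ := h1.exists_brokenLine_aux hC s l rfl k ha.inSector p
      ⟨subset_closure hp, hC.fan.det2_w_pos_of_mem hk hp.2, Or.inl hp⟩
    refine ⟨⟨β, h5, h6⟩, Subtype.ext ?_⟩
    have h7 := (hg β h5 h6).1
    rw [h4] at h7
    obtain ⟨e1, e2⟩ := List.cons.inj h7
    exact Prod.ext e1.symm e2.symm
  · rintro ⟨β, h1, h2⟩
    dsimp only
    rw [(hg β h1 h2).2]
    rfl

end

end WallStructure

lemma Side.le {j r k : ℕ} {ε : ℤ} (h : Side j k ε) (hj : j < r) : k ≤ r := by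
  rcases h with ⟨h, -⟩ | ⟨h, -⟩ <;> omega

lemma det2_neg_right (x y : Fin 2 → ℝ) : det2 x (-y) = -det2 x y := by
  rw [← neg_one_smul ℝ, det2_smul_right, neg_one_mul]

lemma Side.det2_nonneg {j k : ℕ} {ε : ℤ} (h : Side j k ε) {e : ℕ → Fin 2 → ℝ} {x : Fin 2 → ℝ}
    (hx : x ∈ closure (sector e k)) : 0 ≤ ε * det2 (e (j + 1)) x := by
  have hx' := IsConvexFan.det2_of_mem_closure hx
  rcases h with ⟨rfl, rfl⟩ | ⟨rfl, rfl⟩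
  · simpa using hx'.2
  · simpa using hx'.1

lemma Side.mem_sector {j j' k : ℕ} {ε : ℤ} (h : Side j k ε) (h' : Side j' k (-ε))
    {e : ℕ → Fin 2 → ℝ} {x : Fin 2 → ℝ} (hx : 0 < ε * det2 (e (j + 1)) x)
    (hx' : 0 < -ε * det2 (e (j' + 1)) x) : x ∈ sector e k := by
  rcases h with ⟨h1, h2⟩ | ⟨h1, h2⟩ <;> rcases h' with ⟨h3, h4⟩ | ⟨h3, h4⟩
  · omega
  · rw [← h3, h2] at hx'
    rw [← h1, h2] at hx
    push_cast at hx hx'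
    exact ⟨by linarith, by linarith⟩
  · rw [← h3, h2] at hx'
    rw [← h1, h2] at hx
    push_cast at hx hx'
    exact ⟨by linarith, by linarith⟩
  · omega

lemma IsOpenCone.zero_mem_closure {V : Set (Fin 2 → ℝ)} (hV : IsOpenCone V) (hne : V.Nonempty) :
    0 ∈ closure V := by
  obtain ⟨x, hx⟩ := hne
  have hc : Filter.Tendsto (fun c : ℝ => c • x) (nhdsWithin 0 (Set.Ioi 0)) (nhds 0) := by
    have h1 : ContinuousAt (fun c : ℝ => c • x) 0 := by fun_prop
    have h2 := h1.tendsto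
    rw [zero_smul] at h2
    exact h2.mono_left nhdsWithin_le_nhds
  refine mem_closure_of_tendsto hc ?_
  filter_upwards [self_mem_nhdsWithin] with c hc
  exact hV.smul_mem x hx c hc

namespace WallStructure

variable {n : ℕ} {X : PolyhedralPseudomanifold n} {A : Type*} [CommRing A] {L : Type*}
  [AddCommGroup L] {Q : AddSubmonoid L} {φ : ConvexMPA X Q} {I : Ideal (BaseRing A Q)}
  {F : SlabFunctions φ I} {S : WallStructure F} {𝔧 : Set X.Pt} {C : S.PlaneChart 𝔧}

/-! ### Theta functions on both sides of a wall -/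

variable (C) in
/-- The chambers with numbers `k`, `k'` in `σ` and `σ'` are separated by the ray with number `j`. -/
structure Adjacent (j : Fin C.r) (k k' : ℕ) (ε : ℤ) (σ σ' : X.MaxCell) : Prop where
  side : Side j k ε
  side' : Side j k' (-ε)
  nonempty : (C.V σ k).Nonempty
  nonempty' : (C.V σ' k').Nonempty
  touch : toReal (C.ray j) ∈ closure (C.V σ k)
  touch' : toReal (C.ray j) ∈ closure (C.V σ' k')
  crosses : S.Crosses 𝔧 (C.wall j) σ σ'

namespace Adjacent

variable {j : Fin C.r} {k k' : ℕ} {ε : ℤ} {σ σ' : X.MaxCell}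

lemma symm (h : Adjacent C j k k' ε σ σ') : Adjacent C j k' k (-ε) σ' σ :=
  ⟨h.side', by rw [neg_neg]; exact h.side, h.nonempty', h.nonempty, h.touch', h.touch,
    h.crosses.symm⟩

lemma transfer_mulVec (h : Adjacent C j k k' ε σ σ') (v : Fin n → ℤ) :
    (S.transfer (C.wall j) σ' σ).1 *ᵥ ((S.transfer (C.wall j) σ σ').1 *ᵥ v) = v := by
  rw [h.crosses.transfer_symm, Matrix.mulVec_mulVec, ← Units.val_mul, inv_mul_cancel,
    Units.val_one, Matrix.one_mulVec]

variable {δ : Fin C.r → ℤ} {w : ℕ → Fin 2 → ℝ} {den : ℕ → ℝ} (hC : IsConvexChart C δ w den)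
include hC

lemma inSector (h : Adjacent C j k k' ε σ σ') {σ₀ : X.MaxCell} {m : Fin n → ℤ}
    {c : S.LineState × List S.LineState} (hc : c ∈ endChains C σ₀ m σ (C.Ch σ k)) :
    ChainInv C w σ₀ m c.1 c.2 k := by
  obtain ⟨a, ha⟩ := hc.1.inv hC
  have h1 := hc.2.2
  rw [ha.inSector.chamber_eq, hc.2.1] at h1
  have hne := ha.inSector.nonempty
  rw [hc.2.1] at hne
  have : a = k := PlaneChart.index_eq_of_Ch_eq hC.fan h.crosses.left ha.inSector.le (h.side.le j.2) hne h1
  rwa [this] at ha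

/-- A monomial moving away from the wall must have come through it. This makes the correspondence
between the two sides surjective. -/
lemma exists_step (h : Adjacent C j k k' ε σ σ') {σ₀ : X.MaxCell} {m : Fin n → ℤ}
    {c : S.LineState × List S.LineState} (hc : c ∈ endChains C σ₀ m σ' (C.Ch σ' k'))
    (hpos : 0 < ε * (C.normal j σ' ⬝ᵥ c.1.exp)) :
    ∃ c₀ ∈ endChains C σ₀ m σ (C.Ch σ k), c.2 = c₀.1 :: c₀.2 ∧ c₀.1.IsStep C c.1 j k k' ε := by
  have hinv := h.symm.inSector hC hc
  have hdet : 0 < ε * det2 (toReal (C.ray j)) (C.D σ' (toReal c.1.exp)) := by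
    rw [← C.cast_normal]; exact_mod_cast hpos
  rcases hc.1.cases with ⟨-, a, ha⟩ | ⟨s₁, l₁, j₁, k₁, k₂, ε₁, h1, h2, h3⟩
  · exfalso
    have hak : a = k' := ha.toInSector.unique hC hinv.inSector
    -- A first exponent lies in the closure of its chamber, hence not strictly on the other side of
    -- the wall.
    have := h.side'.det2_nonneg (closure_mono Set.inter_subset_right (hak ▸ ha.mem_closure))
    rw [C.edge_ray, hc.2.1] at this
    push_cast at this
    linarith
  · have hk : k₂ = k' := h3.right.unique hC hinv.inSector
    subst hk
    have hε : ε₁ = ε := by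
      by_contra hne
      have hε' : ε₁ = -ε := by
        rcases h3.side' with ⟨-, a⟩ | ⟨-, a⟩ <;> rcases h.side with ⟨-, b⟩ | ⟨-, b⟩ <;> omega
      have h4 := h3.pos
      rw [← h3.normal_eq hC, hε', hc.2.1] at h4
      have h5 : 0 < ((-ε : ℤ) : ℝ) *
          det2 (toReal (C.ray j₁)) (C.D σ' (toReal c.1.exp)) := by
        rw [← C.cast_normal]; exact_mod_cast h4
      have h6 := h3.side'
      rw [hε', neg_neg] at h6
      -- Had the line come through the other bounding ray, the negative of its exponent would lie in
      -- the sector, strictly to the left of `w`, against the invariant.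
      have h7 : -C.D σ' (toReal c.1.exp) ∈ sector C.edge k₂ := by
        refine h6.mem_sector h.side' ?_ ?_
        · rw [C.edge_ray, det2_neg_right]
          push_cast at h5
          linarith
        · rw [C.edge_ray, det2_neg_right]
          linarith
      have h8 := hC.fan.det2_w_pos_of_mem h3.right.le h7
      rw [det2_neg_right] at h8
      have h9 := hinv.nonneg
      rw [hc.2.1] at h9
      linarith
    subst hε
    have hj : j₁ = j := Fin.ext (h3.side'.ray_eq h.side')
    subst hj
    have hk : k₁ = k := h3.side.index_eq h.side
    subst hk
    have hcell : s₁.cell = σ := PlaneChart.cell_eq_of_side hC.joint h3.left.joint_subset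
      h.crosses.left h.side h3.left.nonempty h.nonempty h3.touch h.touch
    exact ⟨(s₁, l₁), ⟨h2, hcell, by rw [h3.left.chamber_eq, hcell]⟩, h1, h3⟩

lemma isStep_next (h : Adjacent C j k k' ε σ σ') {σ₀ : X.MaxCell} {m : Fin n → ℤ}
    {c : S.LineState × List S.LineState} (hc : c ∈ endChains C σ₀ m σ (C.Ch σ k))
    (hpos : 0 < ε * (C.normal j σ ⬝ᵥ c.1.exp)) {v : Fin n → ℤ}
    (hv : (c.1.next j σ' (C.Ch σ' k') v).coeff ≠ 0) :
    c.1.IsStep C (c.1.next j σ' (C.Ch σ' k') v) j k k' ε := by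
  have hinv := h.inSector hC hc
  have hcr : S.Crosses 𝔧 (C.wall j) c.1.cell σ' := by rw [hc.2.1]; exact h.crosses
  refine ⟨hinv.inSector, ⟨h.crosses.symm.left, h.side'.le j.2, h.nonempty', rfl, hv, ?_⟩, h.side,
    h.side', by rw [hc.2.1]; exact h.touch, h.touch', hcr, by rw [hc.2.1]; exact hpos, rfl⟩
  change v ≠ 0
  rintro rfl
  -- A zero exponent cannot arise, since the non-zero normal component is preserved.
  obtain ⟨d, -, hd⟩ := hcr.dev_of_mem_support_transport hC.joint (hC.max j) (m := c.1.exp)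
    (v := 0) (Finsupp.mem_support_iff.2 fun h0 => hv (by
      rw [LineState.next, h0, mul_zero]))
  rw [hc.2.1, Matrix.mulVec_zero] at hd
  rw [C.normal_dotProduct, sub_eq_zero.1 hd.symm] at hpos
  simp only [Pi.smul_apply, smul_eq_mul] at hpos
  ring_nf at hpos
  exact hpos.false

/-- The monomials moving away from the wall after crossing it. -/
lemma sum_pos (h : Adjacent C j k k' ε σ σ') (σ₀ : X.MaxCell) (m : Fin n → ℤ) :
    ∑ c ∈ (finite_endChains hC σ₀ m σ' (C.Ch σ' k')).toFinset with
        0 < ε * (C.normal j σ' ⬝ᵥ c.1.exp), c.1.monomial =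
      ∑ c ∈ (finite_endChains hC σ₀ m σ (C.Ch σ k)).toFinset with
        0 < ε * (C.normal j σ ⬝ᵥ c.1.exp), const c.1.coeff *
          S.transport (C.wall j) σ σ' c.1.exp (C.normal j σ ⬝ᵥ c.1.exp).natAbs := by
  symm
  have hterm : ∀ c ∈ (finite_endChains hC σ₀ m σ (C.Ch σ k)).toFinset.filter
      (fun c => 0 < ε * (C.normal j σ ⬝ᵥ c.1.exp)), const c.1.coeff *
          S.transport (C.wall j) σ σ' c.1.exp (C.normal j σ ⬝ᵥ c.1.exp).natAbs =
      ∑ v ∈ (S.transport (C.wall j) σ σ' c.1.exp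
        (C.normal j σ ⬝ᵥ c.1.exp).natAbs).coeff.support,
          (c.1.next j σ' (C.Ch σ' k') v).monomial := by
    intro c hc
    rw [Finset.mem_filter, Set.Finite.mem_toFinset] at hc
    rw [← hc.1.2.1]
    conv_lhs => rw [← AddMonoidAlgebra.sum_coeff_single (S.transport (C.wall j) c.1.cell σ' c.1.exp
      (C.normal j c.1.cell ⬝ᵥ c.1.exp).natAbs)]
    rw [Finsupp.sum, Finset.mul_sum]
    refine Finset.sum_congr rfl fun v _ => ?_
    rw [const, AddMonoidAlgebra.single_mul_single, zero_add]
    rfl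
  rw [Finset.sum_congr rfl hterm, Finset.sum_sigma']
  have hne : ∀ s : S.LineState, s.monomial ≠ 0 → s.coeff ≠ 0 := fun s hs h0 =>
    hs (AddMonoidAlgebra.single_eq_zero.2 h0)
  -- A product of non-zero coefficients may vanish in `A[Q]/I`. Such terms belong to no broken line,
  -- so only non-zero terms are matched.
  refine Finset.sum_bij_ne_zero (fun a _ _ => (a.1.1.next j σ' (C.Ch σ' k') a.2, a.1.1 :: a.1.2))
    ?_ ?_ ?_ ?_
  · rintro ⟨c, v⟩ h1 h2
    rw [Finset.mem_sigma, Finset.mem_filter, Set.Finite.mem_toFinset] at h1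
    have hst := h.isStep_next hC h1.1.1 h1.1.2 (hne _ h2)
    rw [Finset.mem_filter, Set.Finite.mem_toFinset]
    refine ⟨⟨.step h1.1.1.1 hst, rfl, rfl⟩, ?_⟩
    have h3 := hst.normal_eq hC
    rw [h1.1.1.2.1] at h3
    change 0 < ε * (C.normal j (c.1.next j σ' (C.Ch σ' k') v).cell ⬝ᵥ _)
    rw [h3]
    exact h1.1.2
  · rintro ⟨⟨s, l⟩, v⟩ - - ⟨⟨s', l'⟩, v'⟩ - - heq
    rw [Prod.mk.injEq, List.cons.injEq] at heq
    obtain ⟨h1, rfl, rfl⟩ := heq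
    have : v = v' := congrArg LineState.exp h1
    rw [this]
  · rintro ⟨s', l'⟩ h1 -
    rw [Finset.mem_filter, Set.Finite.mem_toFinset] at h1
    obtain ⟨c, hc, h2, h3⟩ := h.exists_step hC h1.1 h1.2
    have hcoeff := h3.coeff_eq
    have hcell : s'.cell = σ' := h1.1.2.1
    have hch : s'.chamber = C.Ch σ' k' := h1.1.2.2
    have hnext : c.1.next j σ' (C.Ch σ' k') s'.exp = s' := by
      refine LineState.ext hcell.symm hch.symm rfl ?_
      rw [hcoeff, hcell]
      rfl
    have hpos := h3.pos
    rw [hc.2.1] at hpos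
    refine ⟨⟨c, s'.exp⟩, ?_, ?_, ?_⟩
    · rw [Finset.mem_sigma, Finset.mem_filter, Set.Finite.mem_toFinset]
      refine ⟨⟨hc, hpos⟩, ?_⟩
      rw [Finsupp.mem_support_iff]
      intro h0
      apply h3.right.coeff_ne
      rw [hcoeff]
      dsimp only at h0 ⊢
      rw [hc.2.1, hcell, h0, mul_zero]
    · dsimp only
      rw [hnext]
      intro h0
      exact h3.right.coeff_ne (AddMonoidAlgebra.single_eq_zero.1 h0)
    · dsimp only
      rw [hnext, ← h2]
  · intros
    rfl

/-- The half-plane invariant makes the multiple of the ray non-negative. A previous crossing is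
impossible: its normal component would vanish at this wall, or have the wrong sign at the other
bounding wall. -/
lemma start_of_normal_eq_zero (h : Adjacent C j k k' ε σ σ') {σ₀ : X.MaxCell} {m : Fin n → ℤ}
    {c : S.LineState × List S.LineState} (hc : c ∈ endChains C σ₀ m σ (C.Ch σ k))
    (hz : C.normal j σ ⬝ᵥ c.1.exp = 0) :
    c.2 = [] ∧ c.1.IsStart C σ₀ m k ∧
      ∃ t : ℝ, 0 ≤ t ∧ C.D σ (toReal c.1.exp) = t • toReal (C.ray j) := by
  have hinv := h.inSector hC hc
  have hdet : det2 (toReal (C.ray j)) (C.D σ (toReal c.1.exp)) = 0 := by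
    rw [← C.cast_normal, hz, Int.cast_zero]
  obtain ⟨t, ht⟩ := exists_smul_of_det2_eq_zero (C.ray_ne_zero j) hdet
  have ht0 : 0 ≤ t := by
    have h1 := hinv.nonneg
    rw [hc.2.1, ht, det2_smul_right] at h1
    exact nonneg_of_mul_nonneg_left h1 (hC.det2_w_ray h.side)
  rcases hinv.cases with ⟨h1, h2⟩ | ⟨j₁, ε₁, h1, -, h2, -⟩
  · exact ⟨h1, h2, t, ht0, ht⟩
  · exfalso
    rw [hc.2.1] at h2
    have hε : ε₁ = ε := by
      by_contra hne
      have hε' : -ε₁ = ε := by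
        rcases h1 with ⟨-, a⟩ | ⟨-, a⟩ <;> rcases h.side with ⟨-, b⟩ | ⟨-, b⟩ <;> omega
      rw [hε'] at h1
      rw [Fin.ext (h1.ray_eq h.side), hz, mul_zero] at h2
      exact h2.false
    subst hε
    have h3 := hC.det2_ray_ray h.side h1
    have h4 : (0 : ℝ) < ε₁ * det2 (toReal (C.ray j₁)) (C.D σ (toReal c.1.exp)) := by
      rw [← C.cast_normal]; exact_mod_cast h2
    rw [ht, det2_smul_right, det2_swap] at h4
    nlinarith

omit hC in
/-- The segment on the other side of the wall of a broken line parallel to the wall. -/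
def other (j : Fin C.r) (σ σ' : X.MaxCell) (u : Set (Fin n → ℝ))
    (c : S.LineState × List S.LineState) : S.LineState × List S.LineState :=
  (⟨σ', u, (S.transfer (C.wall j) σ σ').1 *ᵥ c.1.exp, c.1.coeff⟩, c.2)

lemma other_mem (h : Adjacent C j k k' ε σ σ') {σ₀ : X.MaxCell} (hσ₀ : 𝔧 ⊆ X.cellSet σ₀)
    {m : Fin n → ℤ} {c : S.LineState × List S.LineState}
    (hc : c ∈ endChains C σ₀ m σ (C.Ch σ k)) (hz : C.normal j σ ⬝ᵥ c.1.exp = 0) :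
    other j σ σ' (C.Ch σ' k') c ∈ endChains C σ₀ m σ' (C.Ch σ' k') ∧
      C.normal j σ' ⬝ᵥ (other j σ σ' (C.Ch σ' k') c).1.exp = 0 := by
  obtain ⟨h1, h2, t, ht, h3⟩ := h.start_of_normal_eq_zero hC hc hz
  have hexp : toReal c.1.exp ≠ 0 := fun h0 => h2.exp_ne (toReal_eq_zero.1 h0)
  have hV' := PlaneChart.V_isOpenCone (C := C) hC.joint h.crosses.symm.left k'
  have hsp : S.SamePoint 𝔧 σ (toReal c.1.exp) σ'
      (toReal ((S.transfer (C.wall j) σ σ').1 *ᵥ c.1.exp)) := by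
    rw [← realMul_toReal]
    exact h.crosses.samePoint ((PlaneChart.mem_wedge_wall_iff hC.joint h.crosses.left
      h.crosses.carrier_left).2 ⟨t, ht, h3⟩)
  refine ⟨⟨?_, rfl, rfl⟩, ?_⟩
  · change IsLineChain C σ₀ m (_ :: c.2)
    rw [h1]
    refine .start (k := k') ⟨⟨h.crosses.symm.left, h.side'.le j.2, h.nonempty', rfl,
      h2.coeff_ne, ?_⟩, ?_, ?_, h2.coeff_eq⟩
    · intro h0
      apply h2.exp_ne
      change (S.transfer (C.wall j) σ σ').1 *ᵥ c.1.exp = 0 at h0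
      rw [← h.transfer_mulVec c.1.exp, h0, Matrix.mulVec_zero]
    · have h4 := h2.samePoint
      rw [hc.2.1] at h4
      exact h4.trans hC.joint hσ₀ h.crosses.left h.crosses.symm.left hexp hsp
    · change C.D σ' (toReal ((S.transfer (C.wall j) σ σ').1 *ᵥ c.1.exp)) ∈ closure (C.V σ' k')
      rw [← realMul_toReal, h.crosses.D_transfer (C := C), h3]
      -- The case `t = 0` is an exponent tangent to the joint; its image `0` lies in the closure of
      -- every chamber.
      rcases ht.eq_or_lt with rfl | ht
      · rw [zero_smul]; exact hV'.zero_mem_closure h.nonempty'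
      · exact hV'.smul_mem_closure h.touch' ht
  · exact (h.crosses.normal_transfer _).trans hz

/-- The monomials moving parallel to the wall. -/
lemma sum_zero (h : Adjacent C j k k' ε σ σ') {σ₀ : X.MaxCell} (hσ₀ : 𝔧 ⊆ X.cellSet σ₀)
    (m : Fin n → ℤ) :
    ∑ c ∈ (finite_endChains hC σ₀ m σ' (C.Ch σ' k')).toFinset with
        C.normal j σ' ⬝ᵥ c.1.exp = 0, c.1.monomial =
      ∑ c ∈ (finite_endChains hC σ₀ m σ (C.Ch σ k)).toFinset with
        C.normal j σ ⬝ᵥ c.1.exp = 0, const c.1.coeff *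
          S.transport (C.wall j) σ σ' c.1.exp (C.normal j σ ⬝ᵥ c.1.exp).natAbs := by
  symm
  refine Finset.sum_bij' (fun c _ => other j σ σ' (C.Ch σ' k') c)
    (fun c _ => other j σ' σ (C.Ch σ k) c) ?_ ?_ ?_ ?_ ?_
  · intro c hc
    rw [Finset.mem_filter, Set.Finite.mem_toFinset] at hc ⊢
    exact h.other_mem hC hσ₀ hc.1 hc.2
  · intro c hc
    rw [Finset.mem_filter, Set.Finite.mem_toFinset] at hc ⊢
    exact h.symm.other_mem hC hσ₀ hc.1 hc.2
  · intro c hc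
    rw [Finset.mem_filter, Set.Finite.mem_toFinset] at hc
    exact Prod.ext (LineState.ext hc.1.2.1.symm hc.1.2.2.symm (h.transfer_mulVec _) rfl) rfl
  · intro c hc
    rw [Finset.mem_filter, Set.Finite.mem_toFinset] at hc
    exact Prod.ext (LineState.ext hc.1.2.1.symm hc.1.2.2.symm (h.symm.transfer_mulVec _) rfl) rfl
  · intro c hc
    rw [Finset.mem_filter] at hc
    rw [hc.2, Int.natAbs_zero, transport, pow_zero, mul_one, const, zM,
      AddMonoidAlgebra.single_mul_single, zero_add, mul_one]
    rfl

omit hC in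
/-- Pairs of a monomial and its image under the change of chambers. -/
def transportPairs (j : Fin C.r) (ε : ℤ) (σ σ' : X.MaxCell) :
    Set (CellRing I n × CellRing I n) :=
  {h | ∃ (e : Fin n → ℤ) (a : BaseRing A Q ⧸ I), 0 ≤ ε * (C.normal j σ ⬝ᵥ e) ∧
    h = (AddMonoidAlgebra.single e a,
      const a * S.transport (C.wall j) σ σ' e (C.normal j σ ⬝ᵥ e).natAbs)}

/-- The theta functions on both sides of a wall. -/
lemma sum_mem_closure (h : Adjacent C j k k' ε σ σ') {σ₀ : X.MaxCell} (hσ₀ : 𝔧 ⊆ X.cellSet σ₀)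
    (m : Fin n → ℤ) :
    (∑ c ∈ (finite_endChains hC σ₀ m σ (C.Ch σ k)).toFinset, c.1.monomial,
      ∑ c ∈ (finite_endChains hC σ₀ m σ' (C.Ch σ' k')).toFinset, c.1.monomial) ∈
    AddSubmonoid.closure (transportPairs j ε σ σ' ∪ Prod.swap '' transportPairs j (-ε) σ' σ) := by
  have hsplit : ∀ (s : Finset (S.LineState × List S.LineState)) (τ : X.MaxCell),
      ∑ c ∈ s, c.1.monomial = ∑ c ∈ s with 0 < ε * (C.normal j τ ⬝ᵥ c.1.exp), c.1.monomial +
        (∑ c ∈ s with C.normal j τ ⬝ᵥ c.1.exp = 0, c.1.monomial +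
          ∑ c ∈ s with 0 < -ε * (C.normal j τ ⬝ᵥ c.1.exp), c.1.monomial) := by
    intro s τ
    rw [Finset.sum_filter, Finset.sum_filter, Finset.sum_filter, ← Finset.sum_add_distrib,
      ← Finset.sum_add_distrib]
    refine Finset.sum_congr rfl fun c _ => ?_
    have hε : ε = 1 ∨ ε = -1 := h.side.imp And.right And.right
    rcases lt_trichotomy (ε * (C.normal j τ ⬝ᵥ c.1.exp)) 0 with h1 | h1 | h1
    · rw [if_neg h1.le.not_gt, if_neg (fun h0 => by simp [h0] at h1), if_pos (by linarith)]
      simp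
    · have h2 : C.normal j τ ⬝ᵥ c.1.exp = 0 := by
        rcases hε with h | h <;> rw [h] at h1 <;> omega
      simp [h2]
    · rw [if_pos h1, if_neg (fun h0 => by simp [h0] at h1), if_neg (by linarith)]
      simp
  -- The first two groups on the right become transports from the left. The third group on the left
  -- becomes, by symmetry, transports from the right.
  rw [hsplit _ σ, hsplit (finite_endChains hC σ₀ m σ' (C.Ch σ' k')).toFinset σ',
    h.sum_pos hC, h.sum_zero hC hσ₀, h.symm.sum_pos hC, ← Prod.mk_add_mk, ← Prod.mk_add_mk]
  refine add_mem ?_ (add_mem ?_ ?_)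
  · rw [prod_mk_sum]
    refine sum_mem fun c hc => AddSubmonoid.subset_closure (Or.inl ⟨c.1.exp, c.1.coeff, ?_, rfl⟩)
    exact (Finset.mem_filter.1 hc).2.le
  · rw [prod_mk_sum]
    refine sum_mem fun c hc => AddSubmonoid.subset_closure (Or.inl ⟨c.1.exp, c.1.coeff, ?_, rfl⟩)
    rw [(Finset.mem_filter.1 hc).2, mul_zero]
  · rw [prod_mk_sum]
    refine sum_mem fun c hc => AddSubmonoid.subset_closure (Or.inr
      ⟨_, ⟨c.1.exp, c.1.coeff, ?_, rfl⟩, rfl⟩)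
    exact (Finset.mem_filter.1 hc).2.le

end Adjacent

end WallStructure

section

variable {n : ℕ} {A : Type*} [CommRing A] {L : Type*} [AddCommGroup L] {Q : AddSubmonoid L}
  {I : Ideal (BaseRing A Q)}

/-! ### Wall crossing -/

lemma wallCrossing_zero (f : CellRing I n) (ν : Fin n → ℤ) : wallCrossing f ν 0 = 0 := by
  simp [wallCrossing]

lemma wallCrossing_add (f : CellRing I n) (ν : Fin n → ℤ) (g h : CellRing I n) :
    wallCrossing f ν (g + h) = wallCrossing f ν g + wallCrossing f ν h := by
  rw [wallCrossing, AddMonoidAlgebra.coeff_add, Finsupp.sum_add_index']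
  · rfl
  · intro m
    rw [AddMonoidAlgebra.single_zero, zero_mul]
  · intro m a b
    rw [AddMonoidAlgebra.single_add, add_mul]

lemma wallCrossing_of_support (f : CellRing I n) (ν : Fin n → ℤ) (h : CellRing I n) (d : ℤ)
    (hd : ∀ v ∈ h.coeff.support, ν ⬝ᵥ v = d) : wallCrossing f ν h = h * intPow f d := by
  conv_rhs => rw [← AddMonoidAlgebra.sum_coeff_single h]
  rw [wallCrossing, Finsupp.sum, Finsupp.sum, Finset.sum_mul]
  exact Finset.sum_congr rfl fun v hv => by rw [hd v hv]

lemma intPow_natCast {R : Type*} [CommRing R] (f : R) (N : ℕ) : intPow f N = f ^ N := by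
  simp [intPow]

lemma pow_mul_intPow_neg {R : Type*} [CommRing R] {f : R} (hf : IsUnit f) (N : ℕ) :
    f ^ N * intPow f (-N) = 1 := by
  rcases N.eq_zero_or_pos with rfl | hN
  · simp [intPow]
  · rw [intPow, if_neg (by omega), neg_neg, Int.toNat_natCast, ← mul_pow,
      Ring.mul_inverse_cancel _ hf, one_pow]

lemma CellRing.pow_mul_intPow_neg {f : CellRing I n} (hf : IsUnit f) (N : ℕ) :
    f ^ N * intPow f (-N) = 1 :=
  ThetaFunctions.pow_mul_intPow_neg (R := CellRing I n) hf N

lemma isNilpotent_of_coeff {R M : Type*} [CommRing R] [AddCommMonoid M] {f : AddMonoidAlgebra R M}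
    (hf : ∀ v, IsNilpotent (f.coeff v)) : IsNilpotent f := by
  rw [← AddMonoidAlgebra.sum_coeff_single f, Finsupp.sum]
  refine isNilpotent_sum fun v _ => ?_
  obtain ⟨N, hN⟩ := hf v
  exact ⟨N, by rw [AddMonoidAlgebra.single_pow, hN, AddMonoidAlgebra.single_zero]⟩

lemma isUnit_changeChart (g : GL (Fin n) ℤ) {f : CellRing I n} (hf : IsUnit f) :
    IsUnit (changeChart g f) :=
  hf.map (AddMonoidAlgebra.mapDomainRingHom (BaseRing A Q ⧸ I)
    (AddMonoidHom.mk' (fun m : Fin n → ℤ => g.1 *ᵥ m) (Matrix.mulVec_add g.1)))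

lemma const_mul (a : BaseRing A Q ⧸ I) (f : CellRing I n) : const a * f = a • f := by
  ext v
  simp [const]

lemma zM_mul_zM (v v' : Fin n → ℤ) : zM I v * zM I v' = zM I (v + v') := by
  simp [zM]

lemma zM_pow (v : Fin n → ℤ) (N : ℕ) : zM I v ^ N = zM I (N • v) := by
  simp [zM, AddMonoidAlgebra.single_pow]

lemma single_eq_smul (v : Fin n → ℤ) (a : BaseRing A Q ⧸ I) :
    (AddMonoidAlgebra.single v a : CellRing I n) = a • zM I v := by
  simp [zM]

lemma smul_zM_mul_pow (a : BaseRing A Q ⧸ I) (v ξ : Fin n → ℤ) (N : ℕ) :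
    a • (zM I v * zM I ξ ^ N) = AddMonoidAlgebra.single (v + N • ξ) a := by
  rw [zM_pow, zM_mul_zM, single_eq_smul]

lemma smul_zM_mul_mul_pow (a : BaseRing A Q ⧸ I) (v ξ : Fin n → ℤ) (g : CellRing I n) (N : ℕ) :
    a • (zM I v * (zM I ξ * g) ^ N) = const a * (zM I (v + N • ξ) * g ^ N) := by
  have h : (zM I ξ * g) ^ N = zM I ξ ^ N * g ^ N := mul_pow (zM I ξ) g N
  rw [h, zM_pow, ← mul_assoc, zM_mul_zM, const_mul]

end

namespace WallStructure

variable {n : ℕ} {X : PolyhedralPseudomanifold n} {A : Type*} [CommRing A] {L : Type*}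
  [AddCommGroup L] {Q : AddSubmonoid L} {φ : ConvexMPA X Q} {I : Ideal (BaseRing A Q)}
  {F : SlabFunctions φ I} {S : WallStructure F} {𝔧 : Set X.Pt} {C : S.PlaneChart 𝔧}

/-- Modulo `I` the function differs from `1` by an element with nilpotent coefficients, which is
nilpotent. -/
lemma Crosses.isUnit_fnIn {i : S.ι} {σ : X.MaxCell} (h : S.Crosses 𝔧 i σ σ) :
    IsUnit (S.fnIn i σ) := by
  refine isUnit_changeChart _ ?_
  set φ' := AddMonoidAlgebra.mapRingHom (Fin n → ℤ) (Ideal.Quotient.mk I) with hφ'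
  have hnil : IsNilpotent (φ' ((S.wall i).fn - 1)) := by
    refine isNilpotent_of_coeff fun v => ?_
    obtain ⟨N, hN⟩ := (S.wall i).codim_zero_fn (h.2.2 rfl) v
    refine ⟨N, ?_⟩
    rw [hφ', AddMonoidAlgebra.coeff_mapRingHom, ← map_pow]
    exact Ideal.Quotient.eq_zero_iff_mem.2 hN
  have := hnil.isUnit_add_one
  rwa [← map_one φ', ← map_add, sub_add_cancel] at this

/-! ### Wall crossing and slab rings on pairs of transported monomials. -/

namespace Adjacent

variable {j : Fin C.r} {k k' : ℕ} {ε : ℤ} {σ σ' : X.MaxCell}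
variable {δ : Fin C.r → ℤ} {w : ℕ → Fin 2 → ℝ} {den : ℕ → ℝ} (hC : IsConvexChart C δ w den)
include hC

lemma wallCrossing_eq {k k' : ℕ} (h : Adjacent C j k k' ε σ σ)
    {p : CellRing I n × CellRing I n}
    (hp : p ∈ AddSubmonoid.closure
      (transportPairs j ε σ σ ∪ Prod.swap '' transportPairs (C := C) j (-ε) σ σ)) :
    p.2 = wallCrossing (S.fnIn (C.wall j) σ) (ε • C.normal j σ) p.1 := by
  have htr : ∀ e N, S.transport (C.wall j) σ σ e N = zM I e * S.fnIn (C.wall j) σ ^ N := by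
    intro e N
    have h1 : (const (1 : BaseRing A Q ⧸ I) : CellRing I n) = 1 := rfl
    rw [transport, transfer_self, kinkFactor, if_pos rfl, h1, mul_one, Units.val_one,
      Matrix.one_mulVec]
  have hN : ∀ e, 0 ≤ ε * (C.normal j σ ⬝ᵥ e) →
      ((C.normal j σ ⬝ᵥ e).natAbs : ℤ) = ε * (C.normal j σ ⬝ᵥ e) := by
    intro e he
    rcases h.side with ⟨-, h2⟩ | ⟨-, h2⟩ <;> rw [h2] at he ⊢ <;> omega
  have hN' : ∀ e, 0 ≤ -ε * (C.normal j σ ⬝ᵥ e) →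
      ((C.normal j σ ⬝ᵥ e).natAbs : ℤ) = -ε * (C.normal j σ ⬝ᵥ e) := by
    intro e he
    rcases h.side with ⟨-, h2⟩ | ⟨-, h2⟩ <;> rw [h2] at he ⊢ <;> omega
  induction hp using AddSubmonoid.closure_induction with
  | mem p hp =>
    rcases hp with ⟨e, a, he, rfl⟩ | ⟨_, ⟨e, a, he, rfl⟩, rfl⟩
    · rw [wallCrossing_of_support _ _ _ (ε * (C.normal j σ ⬝ᵥ e)), ← hN e he, intPow_natCast, htr,
        single_eq_smul, const_mul, smul_mul_assoc]
      intro v hv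
      have : v = e := by
        have := Finsupp.support_single_subset hv
        simpa using this
      rw [this, smul_dotProduct, smul_eq_mul]
    · simp only [Prod.swap_prod_mk]
      -- For a transport in the opposite direction, exponents of `f` are tangent to the wall. All
      -- its terms have the same pairing `-N`, and wall crossing cancels the factor `f ^ N`.
      rw [wallCrossing_of_support _ _ _ (-((C.normal j σ ⬝ᵥ e).natAbs : ℤ)), htr, mul_assoc,
        mul_assoc, CellRing.pow_mul_intPow_neg h.crosses.isUnit_fnIn, mul_one, const_mul, single_eq_smul]
      intro v hv
      obtain ⟨d, -, hd⟩ := h.crosses.dev_of_mem_support_transport hC.joint (hC.max j) (m := e)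
        (v := v) (N := (C.normal j σ ⬝ᵥ e).natAbs) (by
          rw [Finsupp.mem_support_iff] at hv ⊢
          intro h0
          apply hv
          rw [const_mul, AddMonoidAlgebra.coeff_smul, Finsupp.smul_apply, h0, smul_zero])
      rw [hN' e he, smul_dotProduct, C.normal_dotProduct, C.normal_dotProduct, hd]
      simp only [Pi.sub_apply, Pi.smul_apply, smul_eq_mul]
      ring
  | zero => exact (wallCrossing_zero _ _).symm
  | add p q _ _ hp hq => rw [Prod.snd_add, hp, hq, Prod.fst_add, wallCrossing_add]

/-- The cell `σ` lies on one side of a slab. -/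
lemma wedge_nonneg (h : Adjacent C j k k' ε σ σ') (hne : σ ≠ σ') {v : Fin n → ℝ}
    (hv : v ∈ X.wedge 𝔧 Set.univ σ) : 0 ≤ ε * det2 (toReal (C.ray j)) (C.D σ v) := by
  by_contra hneg
  push Not at hneg
  have hσ := h.crosses.left
  have hconv := (convex_wedge_univ hC.joint hσ).linear_image
    (C.D σ : (Fin n → ℝ) →ₗ[ℝ] (Fin 2 → ℝ))
  change Convex ℝ (C.D σ '' X.wedge 𝔧 Set.univ σ) at hconv
  obtain ⟨y, hy⟩ := h.nonempty
  have hcl : C.D σ v ∈ closure (interior (C.D σ '' X.wedge 𝔧 Set.univ σ)) := by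
    have h1 := hconv.closure_interior_eq_closure_of_nonempty_interior ⟨y, hy.1⟩
    have h2 := subset_closure (s := C.D σ '' X.wedge 𝔧 Set.univ σ) ⟨v, hv, rfl⟩
    rw [← h1] at h2
    exact h2
  have hopen : IsOpen {x | (ε : ℝ) * det2 (toReal (C.ray j)) x < 0} :=
    isOpen_lt (continuous_const.mul (continuous_det2 _)) continuous_const
  obtain ⟨x, hx, hx'⟩ := mem_closure_iff.1 hcl _ hopen hneg
  obtain ⟨z, hz⟩ := h.nonempty'
  have hz' := h.side'.det2_pos hz.2
  rw [C.edge_ray] at hz'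
  push_cast at hz'
  have hε : (ε : ℝ) * ε = 1 := by exact_mod_cast h.side.sq
  -- A part of `σ` on the far side of the ray would overlap the chamber of `σ'` next to the ray.
  obtain ⟨p, hp, hp'⟩ := (PlaneChart.interior_isOpenCone (C := C) hC.joint hσ).inter_nonempty
    (PlaneChart.V_isOpenCone (C := C) hC.joint h.crosses.symm.left k') (C.ray_ne_zero j)
    (closure_mono Set.inter_subset_left h.touch) h.touch' hx' hz (by
      have hx0 : (ε : ℝ) * det2 (toReal (C.ray j)) x < 0 := hx
      nlinarith)
  exact hne (PlaneChart.disjoint_interior hC.joint hσ h.crosses.symm.left hp hp'.1)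

lemma isInwardNormal (h : Adjacent C j k k' ε σ σ') (hne : σ ≠ σ') :
    X.IsInwardNormal σ (S.basePt (C.wall j)) (ε • C.normal j σ) := by
  have hσ := h.crosses.left
  refine ⟨?_, fun x hx hxb z hz => ?_⟩
  · obtain ⟨v, hv⟩ := C.exists_normal_eq_one j hσ
    refine ⟨ε • v, ?_⟩
    rw [smul_dotProduct, dotProduct_smul, hv, smul_eq_mul, smul_eq_mul, mul_one, h.side.sq]
  · obtain ⟨y, hy⟩ := (hC.joint.part_props hσ).2.1
    have hxc : X.toB σ x ∈ (S.wall (C.wall j)).carrier := by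
      rw [hxb]
      exact ⟨_, intrinsicInterior_subset (S.wall (C.wall j)).base_mem, rfl⟩
    obtain ⟨s, -, hs⟩ := (PlaneChart.mem_wedge_wall_iff hC.joint hσ h.crosses.carrier_left).1
      ⟨y, hy.1, x, hx, hy.2, hxc, 1, zero_le_one, (one_smul ℝ (x - y)).symm⟩
    have h1 := h.wedge_nonneg hC hne
      ⟨y, hy.1, z, hz, hy.2, Set.mem_univ _, 1, zero_le_one, (one_smul ℝ (z - y)).symm⟩
    have h2 : pair (ε • C.normal j σ) (z - x) = ε * pair (C.normal j σ) (z - x) := by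
      simp only [pair, Finset.mul_sum, Pi.smul_apply, smul_eq_mul, Int.cast_mul, mul_assoc]
    have h3 : z - x = (z - y) - (x - y) := by abel
    rw [h2, C.pair_normal, h3, map_sub, hs, det2_sub_right, det2_smul_right, det2_self, mul_zero,
      sub_zero]
    exact h1

/-- With `e = e' + N ξ` and `e'` tangent to the slab, a transport from `σ` is a multiple of `z^e'
Z_+^N`; one from `σ'` is, in the same way, a multiple of a tangent monomial times `Z_-^N`. -/
lemma mem_slabRing (h : Adjacent C j k k' ε σ σ') (hne : σ ≠ σ')
    {p : CellRing I n × CellRing I n}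
    (hp : p ∈ AddSubmonoid.closure
      (transportPairs j ε σ σ' ∪ Prod.swap '' transportPairs (C := C) j (-ε) σ' σ)) :
    p ∈ S.slabRing (C.wall j) σ σ' := by
  have hν := h.isInwardNormal hC hne
  set ν := ε • C.normal j σ with hνdef
  obtain ⟨ξ, hξ⟩ := hν.1
  have hzero : ∀ v, ν ⬝ᵥ v = 0 →
      (zM I v, zM I ((S.transfer (C.wall j) σ σ').1 *ᵥ v)) ∈ S.slabRing (C.wall j) σ σ' :=
    fun v hv => Algebra.subset_adjoin (Or.inl ⟨ν, v, hν, hv, rfl⟩)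
  induction hp using AddSubmonoid.closure_induction with
  | mem p hp =>
    rcases hp with ⟨e, a, he, rfl⟩ | ⟨_, ⟨e, a, he, rfl⟩, rfl⟩
    · set N := (C.normal j σ ⬝ᵥ e).natAbs with hN
      have hNe : ν ⬝ᵥ e = N := by
        rw [hνdef, smul_dotProduct, smul_eq_mul, hN]
        rcases h.side with ⟨-, h2⟩ | ⟨-, h2⟩ <;> rw [h2] at he ⊢ <;> omega
      have h1 := hzero (e - N • ξ) (by
        rw [dotProduct_sub, dotProduct_smul, hξ, hNe, nsmul_eq_mul, mul_one, sub_self])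
      have h2 : (zM I ξ, zM I ((S.transfer (C.wall j) σ σ').1 *ᵥ ξ) *
          (S.fnIn (C.wall j) σ' * const (S.kinkFactor (C.wall j) σ σ'))) ∈
            S.slabRing (C.wall j) σ σ' :=
        Algebra.subset_adjoin (Or.inr ⟨ν, ξ, hν, hξ, Or.inl rfl⟩)
      have h3 := Subalgebra.smul_mem _ (mul_mem h1 (pow_mem h2 N)) a
      convert h3 using 1
      refine Prod.ext ((smul_zM_mul_pow a _ ξ N).trans ?_).symm
        ((smul_zM_mul_mul_pow a _ _ _ N).trans ?_).symm
      · rw [sub_add_cancel]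
      · rw [← Matrix.mulVec_smul, ← Matrix.mulVec_add, sub_add_cancel]
        rfl
    · set N := (C.normal j σ' ⬝ᵥ e).natAbs with hN
      set e₀ := (S.transfer (C.wall j) σ' σ).1 *ᵥ e with he₀
      have hTe : (S.transfer (C.wall j) σ σ').1 *ᵥ e₀ = e := h.symm.transfer_mulVec e
      have hNe : ν ⬝ᵥ e₀ = -N := by
        rw [hνdef, smul_dotProduct, smul_eq_mul, he₀, h.symm.crosses.normal_transfer, hN]
        rcases h.side with ⟨-, h2⟩ | ⟨-, h2⟩ <;> rw [h2] at he ⊢ <;> omega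
      have h1 := hzero (e₀ + N • ξ) (by
        rw [dotProduct_add, dotProduct_smul, hξ, hNe, nsmul_eq_mul, mul_one, neg_add_cancel])
      have h2 : (zM I (-ξ) * (S.fnIn (C.wall j) σ * const (S.kinkFactor (C.wall j) σ σ')),
          zM I ((S.transfer (C.wall j) σ σ').1 *ᵥ (-ξ))) ∈ S.slabRing (C.wall j) σ σ' :=
        Algebra.subset_adjoin (Or.inr ⟨ν, ξ, hν, hξ, Or.inr rfl⟩)
      have h3 := Subalgebra.smul_mem _ (mul_mem h1 (pow_mem h2 N)) a
      convert h3 using 1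
      -- The exponent is brought to `σ`, where its pairing with the normal is `-N`; adding `N • ξ`
      -- makes it tangent.
      have h4 : e₀ + N • ξ + N • -ξ = e₀ := by rw [smul_neg]; abel
      refine Prod.ext ((smul_zM_mul_mul_pow a _ _ _ N).trans ?_).symm
        ((smul_zM_mul_pow a _ _ N).trans ?_).symm
      · rw [h4, ← kinkFactor_symm]
        rfl
      · rw [← Matrix.mulVec_smul, ← Matrix.mulVec_add, h4, hTe]
        rfl
  | zero => exact zero_mem _
  | add p q _ _ hp hq => exact add_mem hp hq

end Adjacent

section

variable {δ : Fin C.r → ℤ} {w : ℕ → Fin 2 → ℝ} {den : ℕ → ℝ} (hC : IsConvexChart C δ w den)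
include hC

lemma IsConvexChart.ray_mem_closure {j : Fin C.r} {σ : X.MaxCell} (hσ : 𝔧 ⊆ X.cellSet σ)
    (hjσ : (S.wall (C.wall j)).carrier ⊆ X.cellSet σ) {k : ℕ}
    (h : X.wedge 𝔧 (S.wall (C.wall j)).carrier σ ⊆ closure (C.Ch σ k)) :
    toReal (C.ray j) ∈ closure (C.V σ k) := by
  obtain ⟨v, hv⟩ := PlaneChart.D_surjective (C := C) hσ (toReal (C.ray j))
  have h1 := h ((PlaneChart.mem_wedge_wall_iff hC.joint hσ hjσ).2
    ⟨1, zero_le_one, by rw [hv, one_smul]⟩)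
  have h2 := (C.D σ).continuous.closure_preimage_subset _ h1
  rwa [Set.mem_preimage, hv] at h2

theorem IsConvexChart.consistentAt : S.ConsistentAt 𝔧 where
  indep σ₀ m _ σ u hu p hp p' hp' _ _ := by
    rw [theta_eq_sum hC σ₀ m hu hp, theta_eq_sum hC σ₀ m hu hp']
  compat_wall σ₀ m hm i σ hcr u u' hu hu' hne hsub hsub' ν hν hpos p hp p' hp' _ _ := by
    rw [theta_eq_sum hC σ₀ m hu hp, theta_eq_sum hC σ₀ m hu' hp']
    obtain ⟨hσ, k, hk, hVne, rfl⟩ := (PlaneChart.isChamberAt_iff hC.joint hC.fan).1 hu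
    obtain ⟨-, k', hk', hVne', rfl⟩ := (PlaneChart.isChamberAt_iff hC.joint hC.fan).1 hu'
    obtain ⟨j, hj⟩ := C.wall.surjective ⟨i, hcr.1⟩
    obtain rfl : i = C.wall j := by rw [hj]
    have htouch := hC.ray_mem_closure hσ hcr.carrier_left hsub
    have htouch' := hC.ray_mem_closure hσ hcr.carrier_left hsub'
    obtain ⟨ε, hs⟩ := PlaneChart.exists_side hC.fan hk htouch
    obtain ⟨ε', hs'⟩ := PlaneChart.exists_side hC.fan hk' htouch'
    have hε : ε' = -ε := by
      have : ε ≠ ε' := fun h => hne (by rw [hs.index_eq (h ▸ hs')])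
      rcases hs with ⟨-, a⟩ | ⟨-, a⟩ <;> rcases hs' with ⟨-, b⟩ | ⟨-, b⟩ <;> omega
    subst hε
    have hadj : Adjacent C j k k' ε σ σ := ⟨hs, hs', hVne, hVne', htouch, htouch', hcr⟩
    -- Positivity of the normal on the chamber that is left selects the sign.
    have hνε : ν = ε • C.normal j σ := by
      have h1 := hs.det2_pos hp.2
      have h2 := hpos p hp
      rw [C.edge_ray, ← C.pair_normal] at h1
      rcases hs with ⟨-, a⟩ | ⟨-, a⟩ <;> rw [a] at h1 ⊢ <;> push_cast at h1 <;>
        rcases PlaneChart.eq_normal_or_eq_neg hC.joint hσ hcr.carrier_left hν with h | h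
      · rw [h, one_smul]
      · rw [h, pair_neg] at h2
        linarith
      · rw [h] at h2
        linarith
      · rw [h, neg_one_smul]
    rw [hνε]
    exact hadj.wallCrossing_eq hC (hadj.sum_mem_closure hC hm.1 m)
  compat_slab σ₀ m hm i σ σ' hne hcr u u' hu hu' hsub hsub' p hp p' hp' _ _ := by
    rw [theta_eq_sum hC σ₀ m hu hp, theta_eq_sum hC σ₀ m hu' hp']
    obtain ⟨hσ, k, hk, hVne, rfl⟩ := (PlaneChart.isChamberAt_iff hC.joint hC.fan).1 hu
    obtain ⟨hσ', k', hk', hVne', rfl⟩ := (PlaneChart.isChamberAt_iff hC.joint hC.fan).1 hu'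
    obtain ⟨j, hj⟩ := C.wall.surjective ⟨i, hcr.1⟩
    obtain rfl : i = C.wall j := by rw [hj]
    have htouch := hC.ray_mem_closure hσ hcr.carrier_left hsub
    have htouch' := hC.ray_mem_closure hσ' hcr.symm.carrier_left hsub'
    obtain ⟨ε, hs⟩ := PlaneChart.exists_side hC.fan hk htouch
    obtain ⟨ε', hs'⟩ := PlaneChart.exists_side hC.fan hk' htouch'
    have hε : ε' = -ε := by
      -- Two chambers on the same side of the ray would lie in the same cell, contrary to the
      -- crossing of a slab.
      have : ε ≠ ε' := by
        rintro rfl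
        obtain rfl := hs.index_eq hs'
        exact hne (PlaneChart.cell_eq_of_side hC.joint hσ hσ' hs hVne hVne' htouch htouch')
      rcases hs with ⟨-, a⟩ | ⟨-, a⟩ <;> rcases hs' with ⟨-, b⟩ | ⟨-, b⟩ <;> omega
    subst hε
    have hadj : Adjacent C j k k' ε σ σ' := ⟨hs, hs', hVne, hVne', htouch, htouch', hcr⟩
    exact hadj.mem_slabRing hC hne (hadj.sum_mem_closure hC hm.1 m)

end

theorem ConvexAt.consistentAt (hj : S.IsJoint 𝔧) (hconv : S.ConvexAt 𝔧) : S.ConsistentAt 𝔧 := by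
  obtain ⟨C, δ, lam, hmax, hslope, hlast⟩ := hconv
  exact IsConvexChart.consistentAt ⟨hj, hmax, PlaneChart.isConvexFan hslope hlast⟩

end WallStructure

end ThetaFunctions

end

theorem mainTheorem9 {n : ℕ} (X : ThetaFunctions.PolyhedralPseudomanifold n)
    {A : Type*} [CommRing A] [IsNoetherianRing A]
    {L : Type*} [AddCommGroup L] (Q : AddSubmonoid L) (hQ : ThetaFunctions.IsToric Q)
    (φ : ThetaFunctions.ConvexMPA X Q) (I : Ideal (ThetaFunctions.BaseRing A Q))
    (hI : ∀ σ σ', σ ≠ σ' → ∀ p ∈ X.facetLocus σ σ',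
      (AddMonoidAlgebra.single (φ.kink p) 1 : ThetaFunctions.BaseRing A Q) ∈ I.radical)
    (F : ThetaFunctions.SlabFunctions φ I) (S : ThetaFunctions.WallStructure F)
    (𝔧 : Set X.Pt) (hj : S.IsCodimTwoJoint 𝔧) (hb : 𝔧 ⊆ X.boundary)
    (hconv : S.ConvexAt 𝔧) :
    S.ConsistentAt 𝔧 :=
  hconv.consistentAt hj.1
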